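/- **Setting.** Let $\mathbb T=\{|\omega|=1\}$, positively oriented. Fix $b\in(0,1)$, $\varepsilon\in(0,1)$, an integer $k\ge 3$ and $\Omega\in\mathbb R$. $X^{k+\log}$ is the space of functions $h(z)=\sum_{n\ge1}h_nz^{-n}$ with $h_n\in\mathbb R$, holomorphic on $\{|z|>\varepsilon\}$, such that the norm $$\|h\|_{X^{k+\log}}=\|h(\varepsilon\,\cdot)\|_{L^2(\mathbb T)}+\|(\partial_z^kh)(\varepsilon\,\cdot)\|_{L^2(\mathbb T)}+\Big\|\int_{\mathbb T}\frac{(\partial_z^kh)(\varepsilon\tau)-(\partial_z^kh)(\varepsilon\,\cdot)}{|\tau-\cdot|}\frac{d\tau}{\tau}\Big\|_{L^2(\mathbb T)}$$ is finite. $Y^{k-1}$ is the space of functions $g(z)=i\sum_{n\ge1}g_n(z^n-z^{-n})$ with $g_n\in\mathbb R$, holomorphic on $\{\varepsilon<|z|<1/\varepsilon\}$, such that the norm $\|g\|_{Y^{k-1}}=\|g(\varepsilon\,\cdot)\|_{L^2(\mathbb T)}+\|(\partial_z^{k-1}g)(\varepsilon\,\cdot)\|_{L^2(\mathbb T)}$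 is finite. The norms on the boundary circle $|z|=\varepsilon$ are understood as suprema of the corresponding norms over the circles $|z|=r$ contained in the open domain. Elements of $Y^{k-1}$ are identified with their restrictions to $\mathbb T$. For $f_1,f_2\in X^{k+\log}$ put $\Phi_1(z)=z+f_1(z)$, $\Phi_2(z)=bz+f_2(z)$ and, for $j=1,2$ and $\omega\in\mathbb T$, $$G_j(\Omega,f_1,f_2)(\omega)=\mathrm{Im}\Big\{\big(\Omega\Phi_j(\omega)-S(\Phi_1,\Phi_j)(\omega)+S(\Phi_2,\Phi_j)(\omega)\big)\overline{\Phi_j'(\omega)}\,\overline\omega\Big\},$$ $$S(\Phi_i,\Phi_j)(\omega)=\frac1{2\pi i}\int_{\mathbb T}\frac{\tau\Phi_i'(\tau)-\omega\Phi_j'(\omega)}{|\Phi_i(\tau)-\Phi_j(\omega)|}\frac{d\tau}{\tau}.$$ For $n\ge 1$ put $$\Lambda_n(b)=\frac1b\int_0^{\infty}J_n(bt)J_n(t)\,dt,\qquad S_n=\frac2\pi\sum_{k=1}^{n-1}\frac1{2k+1},$$ where $J_n$ is the Bessel function of the first kind, and for $n\ge2$ $$M_n=\begin{pmatrix}\Omega-S_n+b^2\Lambda_1(b)&-b^2\Lambda_n(b)\\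 b\Lambda_n(b)&b\Omega+S_n-b\Lambda_1(b)\end{pmatrix}.$$ **Proposition.** The improper integrals $\int_0^\infty J_n(bt)J_n(t)\,dt=\lim_{R\to\infty}\int_0^R J_n(bt)J_n(t)\,dt$ converge for $n\ge1$. For $(f_1,f_2)$ in a neighbourhood of $(0,0)$ in $X^{k+\log}\times X^{k+\log}$ the functions $G_j(\Omega,f_1,f_2)$ belong to $Y^{k-1}$, and the map $(f_1,f_2)\mapsto G(\Omega,f_1,f_2)=(G_1,G_2)(\Omega,f_1,f_2)\in Y^{k-1}\times Y^{k-1}$ is Fréchet differentiable at the annulus $(f_1,f_2)=(0,0)$. Its derivative $DG(\Omega,0,0)$ is a Fourier multiplier: for all $h_1,h_2\in X^{k+\log}$ with $h_1(\omega)=\sum_{n\ge1}a_n\overline\omega^{\,n}$ and $h_2(\omega)=\sum_{n\ge1}c_n\overline\omega^{\,n}$ on $\mathbb T$ ($a_n,c_n\in\mathbb R$), $$DG(\Omega,0,0)(h_1,h_2)(\omega)=\frac i2\sum_{n\ge1}(n+1)M_{n+1}\begin{pmatrix}a_n\\c_n\end{pmatrix}\big(\omega^{n+1}-\overline\omega^{\,n+1}\big)\qquad\text{for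 all }\omega\in\mathbb T.$$ -/

import Mathlib

open Set Filter Topology MeasureTheory Complex ComplexConjugate
open scoped Real ENNReal Matrix

noncomputable section

namespace VStates

/-! ### Special functions and the multiplier matrices -/

/-- Bessel function of the first kind of order `n`, on the real line. -/
def besselJ (n : ℕ) (t : ℝ) : ℝ :=
  ∑' k : ℕ, (-1 : ℝ) ^ k / ((k.factorial : ℝ) * ((n + k).factorial : ℝ)) * (t / 2) ^ (2 * k + n)

/-- `Λ_n(b) = (1/b) ∫_0^∞ J_n(bt) J_n(t) dt`, an improper (conditionally convergent) integral. -/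
def Lam (n : ℕ) (b : ℝ) : ℝ :=
  (1 / b) * limUnder atTop (fun R : ℝ => ∫ t in (0 : ℝ)..R, besselJ n (b * t) * besselJ n t)

/-- `S_n = (2/π) ∑_{k=1}^{n-1} 1/(2k+1)`. -/
def Sn (n : ℕ) : ℝ := (2 / π) * ∑ k ∈ Finset.Ico 1 n, 1 / (2 * (k : ℝ) + 1)

/-- The matrix `M_n`. -/
def M (b Ω : ℝ) (n : ℕ) : Matrix (Fin 2) (Fin 2) ℝ :=
  !![Ω - Sn n + b ^ 2 * Lam 1 b, -(b ^ 2 * Lam n b);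
     b * Lam n b, b * Ω + Sn n - b * Lam 1 b]

/-! ### The nonlinear functional -/

/-- The mean value `(1/(2πi)) ∫_𝕋 F(τ) dτ` over the unit circle. -/
def fint (F : ℂ → ℂ) : ℂ := (2 * π * I)⁻¹ * ∮ τ in C(0, 1), F τ

/-- `S(P,Q)(ω) = ⨍_𝕋 (τ P'(τ) - ω Q'(ω)) / |P(τ) - Q(ω)| dτ/τ`. -/
def S (P Q : ℂ → ℂ) (ω : ℂ) : ℂ :=
  fint fun τ => (τ * deriv P τ - ω * deriv Q ω) / (‖P τ - Q ω‖ : ℂ) / τ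

/-- `Φ_1 = Id + f_1` (index `0`) and `Φ_2 = b Id + f_2` (index `1`). -/
def Phi (b : ℝ) (f : Fin 2 → ℂ → ℂ) (j : Fin 2) (z : ℂ) : ℂ := (b : ℂ) ^ (j : ℕ) * z + f j z

/-- The real-valued functions `G_1` (index `0`) and `G_2` (index `1`) on the unit circle. -/
def Gfun (b Ω : ℝ) (f : Fin 2 → ℂ → ℂ) (j : Fin 2) (ω : ℂ) : ℝ :=
  ((Ω * Phi b f j ω - S (Phi b f 0) (Phi b f j) ω + S (Phi b f 1) (Phi b f j) ω)
    * conj (deriv (Phi b f j) ω) * conj ω).im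

/-! ### Function spaces -/

/-- The exterior domain `{ε < |z|}`. -/
def extDom (ε : ℝ) : Set ℂ := {z | ε < ‖z‖}

/-- The annulus `{ε < |z| < 1/ε}`. -/
def annulus (ε : ℝ) : Set ℂ := {z | ε < ‖z‖ ∧ ‖z‖ < ε⁻¹}

/-- The radii of the circles centered at the origin that lie in `U`. -/
def radii (U : Set ℂ) : Set ℝ := {r | 0 ≤ r ∧ ∀ ω : ℂ, ‖ω‖ = 1 → (r : ℂ) * ω ∈ U}

/-- The `L²` norm of a function on the unit circle. -/
def eL2 (u : ℂ → ℂ) : ℝ≥0∞ :=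
  eLpNorm (fun θ : ℝ => u (circleMap 0 1 θ)) 2 (volume.restrict (Ioc 0 (2 * π)))

/-- The `L²` norm of the boundary values of a function `u` holomorphic on `U`,
as the supremum of the `L²` norms on the circles contained in `U`. -/
def hardy (U : Set ℂ) (u : ℂ → ℂ) : ℝ≥0∞ := ⨆ r ∈ radii U, eL2 (fun ω => u ((r : ℂ) * ω))

/-- `ω ↦ ∫_𝕋 (u(rτ) - u(rω)) / |τ - ω| dτ/τ`. -/
def logOp (u : ℂ → ℂ) (r : ℝ) (ω : ℂ) : ℂ :=
  ∮ τ in C(0, 1), (u ((r : ℂ) * τ) - u ((r : ℂ) * ω)) / (‖τ - ω‖ : ℂ) / τ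

/-- The `L²` norm of the boundary values of `logOp u`, as a supremum over circles in `U`. -/
def logHardy (U : Set ℂ) (u : ℂ → ℂ) : ℝ≥0∞ := ⨆ r ∈ radii U, eL2 (logOp u r)

/-- The norm of `X^{k+log}`. -/
def XeNorm (ε : ℝ) (k : ℕ) (h : ℂ → ℂ) : ℝ≥0∞ :=
  hardy (extDom ε) h + hardy (extDom ε) (iteratedDeriv k h)
    + logHardy (extDom ε) (iteratedDeriv k h)

/-- The norm of `Y^m`. -/
def YeNorm (ε : ℝ) (m : ℕ) (h : ℂ → ℂ) : ℝ≥0∞ :=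
  hardy (annulus ε) h + hardy (annulus ε) (iteratedDeriv m h)

/-! Helper facts: the norms are norms. -/

lemma circleMap_eq (r θ : ℝ) : circleMap 0 r θ = (r : ℂ) * circleMap 0 1 θ := by
  simp [circleMap]

lemma norm_cm (θ : ℝ) : ‖circleMap 0 1 θ‖ = 1 := by simp

lemma continuous_circle {U : Set ℂ} {u : ℂ → ℂ} (hu : ContinuousOn u U) {r : ℝ}
    (hr : r ∈ radii U) : Continuous fun θ : ℝ => u ((r : ℂ) * circleMap 0 1 θ) := by
  have h : Continuous fun θ : ℝ => (r : ℂ) * circleMap 0 1 θ :=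
    continuous_const.mul (continuous_circleMap 0 1)
  exact hu.comp_continuous h fun θ => hr.2 _ (norm_cm θ)

lemma eL2_congr {u v : ℂ → ℂ} (h : ∀ ω, ‖ω‖ = 1 → u ω = v ω) : eL2 u = eL2 v := by
  unfold eL2
  congr 1
  funext θ
  exact h _ (norm_cm θ)

lemma logOp_congr {U : Set ℂ} {u v : ℂ → ℂ} (h : EqOn u v U) {r : ℝ} (hr : r ∈ radii U)
    {ω : ℂ} (hω : ‖ω‖ = 1) : logOp u r ω = logOp v r ω := by
  unfold logOp
  refine circleIntegral.integral_congr zero_le_one fun τ hτ => ?_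
  have hτ' : ‖τ‖ = 1 := by simpa using hτ
  simp only [h (hr.2 τ hτ'), h (hr.2 ω hω)]

lemma hardy_congr {U : Set ℂ} {u v : ℂ → ℂ} (h : EqOn u v U) : hardy U u = hardy U v :=
  iSup_congr fun _ => iSup_congr fun hr => eL2_congr fun ω hω => h (hr.2 ω hω)

lemma logHardy_congr {U : Set ℂ} {u v : ℂ → ℂ} (h : EqOn u v U) :
    logHardy U u = logHardy U v :=
  iSup_congr fun _ => iSup_congr fun hr => eL2_congr fun _ hω => logOp_congr h hr hω

lemma eL2_smul (c : ℝ) (u : ℂ → ℂ) : eL2 (c • u) = ‖c‖ₑ * eL2 u :=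
  eLpNorm_const_smul c (fun θ : ℝ => u (circleMap 0 1 θ)) 2 (volume.restrict (Ioc 0 (2 * π)))

lemma hardy_smul (U : Set ℂ) (c : ℝ) (u : ℂ → ℂ) : hardy U (c • u) = ‖c‖ₑ * hardy U u := by
  simp only [hardy, ENNReal.mul_iSup]
  exact iSup_congr fun r => iSup_congr fun _ => eL2_smul c fun ω => u ((r : ℂ) * ω)

lemma logOp_smul (c : ℝ) (u : ℂ → ℂ) (r : ℝ) : logOp (c • u) r = c • logOp u r := by
  funext ω
  simp only [logOp, Pi.smul_apply]
  rw [← circleIntegral.integral_smul]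
  congr 1
  funext τ
  simp only [Complex.real_smul]
  ring

lemma logHardy_smul (U : Set ℂ) (c : ℝ) (u : ℂ → ℂ) :
    logHardy U (c • u) = ‖c‖ₑ * logHardy U u := by
  simp only [logHardy, ENNReal.mul_iSup]
  refine iSup_congr fun r => iSup_congr fun _ => ?_
  rw [logOp_smul, eL2_smul]

lemma hardy_add {U : Set ℂ} {u v : ℂ → ℂ} (hu : ContinuousOn u U) (hv : ContinuousOn v U) :
    hardy U (u + v) ≤ hardy U u + hardy U v := by
  refine iSup₂_le fun r hr => ?_
  have h1 := le_iSup₂ (f := fun r (_ : r ∈ radii U) => eL2 (fun ω => u ((r : ℂ) * ω))) r hr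
  have h2 := le_iSup₂ (f := fun r (_ : r ∈ radii U) => eL2 (fun ω => v ((r : ℂ) * ω))) r hr
  refine le_trans ?_ (add_le_add h1 h2)
  exact eLpNorm_add_le (continuous_circle hu hr).aestronglyMeasurable
    (continuous_circle hv hr).aestronglyMeasurable (by norm_num)

lemma measurable_kernel {U : Set ℂ} {u : ℂ → ℂ} (hu : ContinuousOn u U) {r : ℝ}
    (hr : r ∈ radii U) : Measurable fun p : ℝ × ℝ =>
      deriv (circleMap 0 1) p.2 • ((u ((r : ℂ) * circleMap 0 1 p.2)
        - u ((r : ℂ) * circleMap 0 1 p.1)) / (‖circleMap 0 1 p.2 - circleMap 0 1 p.1‖ : ℂ)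
        / circleMap 0 1 p.2) := by
  have h := continuous_circle hu hr
  have hc := continuous_circleMap (0 : ℂ) 1
  have h1 : Measurable fun p : ℝ × ℝ => u ((r : ℂ) * circleMap 0 1 p.1) :=
    (h.comp continuous_fst).measurable
  have h2 : Measurable fun p : ℝ × ℝ => u ((r : ℂ) * circleMap 0 1 p.2) :=
    (h.comp continuous_snd).measurable
  have h3 : Measurable fun p : ℝ × ℝ => circleMap (0 : ℂ) 1 p.2 :=
    (hc.comp continuous_snd).measurable
  have h4 : Measurable fun p : ℝ × ℝ =>
      ((‖circleMap (0 : ℂ) 1 p.2 - circleMap 0 1 p.1‖ : ℝ) : ℂ) :=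
    (Complex.continuous_ofReal.comp
      ((hc.comp continuous_snd).sub (hc.comp continuous_fst)).norm).measurable
  simp only [deriv_circleMap]
  exact (h3.mul_const I).smul (((h2.sub h1).div h4).div h3)

lemma circleIntegrable_kernel {U : Set ℂ} (hU : IsOpen U) {u : ℂ → ℂ}
    (hu : DifferentiableOn ℂ u U) {r : ℝ} (hr : r ∈ radii U) {ω : ℂ} (hω : ‖ω‖ = 1) :
    CircleIntegrable (fun τ => (u ((r : ℂ) * τ) - u ((r : ℂ) * ω)) / (‖τ - ω‖ : ℂ) / τ) 0 1 := by
  have hmem : U ∈ 𝓝 ((r : ℂ) * ω) := hU.mem_nhds (hr.2 ω hω)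
  have hd : ContinuousOn (dslope u ((r : ℂ) * ω)) U :=
    (continuousOn_dslope hmem).2 ⟨hu.continuousOn, hu.differentiableAt hmem⟩
  have hcont := continuous_circle hd hr
  have hK : ∃ C : ℝ, ∀ θ ∈ Icc (0 : ℝ) (2 * π),
      ‖dslope u ((r : ℂ) * ω) ((r : ℂ) * circleMap 0 1 θ)‖ ≤ C :=
    isCompact_Icc.exists_bound_of_continuousOn hcont.continuousOn
  obtain ⟨C, hC⟩ := hK
  have hc := continuous_circleMap (0 : ℂ) 1
  have hmeas : Measurable fun θ : ℝ => (u ((r : ℂ) * circleMap 0 1 θ) - u ((r : ℂ) * ω))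
      / (‖circleMap 0 1 θ - ω‖ : ℂ) / circleMap 0 1 θ :=
    (((continuous_circle hu.continuousOn hr).measurable.sub_const _).div
      (Complex.continuous_ofReal.comp (hc.sub continuous_const).norm).measurable).div
      hc.measurable
  unfold CircleIntegrable
  rw [intervalIntegrable_iff, uIoc_of_le Real.two_pi_pos.le]
  refine Measure.integrableOn_of_bounded (M := r * C) measure_Ioc_lt_top.ne
    hmeas.aestronglyMeasurable ?_
  filter_upwards [ae_restrict_mem measurableSet_Ioc] with θ hθ
  have hb := hC θ ⟨hθ.1.le, hθ.2⟩
  have hCn : 0 ≤ r * C := mul_nonneg hr.1 ((norm_nonneg _).trans hb)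
  have hs := sub_smul_dslope u ((r : ℂ) * ω) ((r : ℂ) * circleMap 0 1 θ)
  rw [← hs, norm_div, norm_div, norm_cm, div_one, norm_smul, Complex.norm_real, norm_norm,
    ← mul_sub, norm_mul, Complex.norm_real, Real.norm_of_nonneg hr.1]
  rcases eq_or_ne (‖circleMap 0 1 θ - ω‖) 0 with h0 | h0
  · rw [h0]; simpa using hCn
  · rw [div_le_iff₀ (lt_of_le_of_ne (norm_nonneg _) h0.symm)]
    have := mul_le_mul_of_nonneg_left hb
      (mul_nonneg hr.1 (norm_nonneg (circleMap 0 1 θ - ω)))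
    linarith

lemma logOp_add {U : Set ℂ} (hU : IsOpen U) {u v : ℂ → ℂ} (hu : DifferentiableOn ℂ u U)
    (hv : DifferentiableOn ℂ v U) {r : ℝ} (hr : r ∈ radii U) {ω : ℂ} (hω : ‖ω‖ = 1) :
    logOp (u + v) r ω = logOp u r ω + logOp v r ω := by
  unfold logOp
  rw [← circleIntegral.integral_add (circleIntegrable_kernel hU hu hr hω)
    (circleIntegrable_kernel hU hv hr hω)]
  congr 1
  funext τ
  simp only [Pi.add_apply]
  ring

lemma aestronglyMeasurable_logOp {U : Set ℂ} {u : ℂ → ℂ} (hu : ContinuousOn u U) {r : ℝ}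
    (hr : r ∈ radii U) : AEStronglyMeasurable (fun θ : ℝ => logOp u r (circleMap 0 1 θ))
      (volume.restrict (Ioc 0 (2 * π))) := by
  have h := (measurable_kernel hu hr).stronglyMeasurable
  have h' := h.integral_prod_right' (ν := volume.restrict (Ioc 0 (2 * π)))
  refine h'.aestronglyMeasurable.congr (Eventually.of_forall fun θ => ?_)
  simp only [logOp, circleIntegral]
  rw [intervalIntegral.integral_of_le Real.two_pi_pos.le]

lemma logHardy_add {U : Set ℂ} (hU : IsOpen U) {u v : ℂ → ℂ} (hu : DifferentiableOn ℂ u U)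
    (hv : DifferentiableOn ℂ v U) : logHardy U (u + v) ≤ logHardy U u + logHardy U v := by
  refine iSup₂_le fun r hr => ?_
  have h1 := le_iSup₂ (f := fun r (_ : r ∈ radii U) => eL2 (logOp u r)) r hr
  have h2 := le_iSup₂ (f := fun r (_ : r ∈ radii U) => eL2 (logOp v r)) r hr
  refine le_trans ?_ (add_le_add h1 h2)
  have : eL2 (logOp (u + v) r) = eL2 (logOp u r + logOp v r) :=
    eL2_congr fun ω hω => logOp_add hU hu hv hr hω
  rw [this]
  exact eLpNorm_add_le (aestronglyMeasurable_logOp hu.continuousOn hr)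
    (aestronglyMeasurable_logOp hv.continuousOn hr) (by norm_num)

lemma differentiableOn_iteratedDeriv {U : Set ℂ} (hU : IsOpen U) {u : ℂ → ℂ}
    (hu : DifferentiableOn ℂ u U) (k : ℕ) : DifferentiableOn ℂ (iteratedDeriv k u) U := by
  rw [iteratedDeriv_eq_iterate]
  exact ((hu.analyticOnNhd hU).iterated_deriv k).differentiableOn

lemma iteratedDeriv_add_on {U : Set ℂ} (hU : IsOpen U) {u v : ℂ → ℂ}
    (hu : DifferentiableOn ℂ u U) (hv : DifferentiableOn ℂ v U) (k : ℕ) :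
    EqOn (iteratedDeriv k (u + v)) (iteratedDeriv k u + iteratedDeriv k v) U := fun z hz =>
  iteratedDeriv_add ((hu.analyticOnNhd hU z hz).contDiffAt) ((hv.analyticOnNhd hU z hz).contDiffAt)

lemma iteratedDeriv_smul_real (k : ℕ) (c : ℝ) (u : ℂ → ℂ) :
    iteratedDeriv k (c • u) = c • iteratedDeriv k u := by
  funext z
  have h := iteratedDeriv_const_smul_field (n := k) (x := z) (c : ℂ) u
  have e : (c • u) = ((c : ℂ) • u) := by
    funext w
    simp
  rw [e, h]
  simp

lemma eqOn_zero_of_hardy {U : Set ℂ} {u : ℂ → ℂ} (hu : ContinuousOn u U)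
    (hrad : ∀ z ∈ U, ‖z‖ ∈ radii U) (h0 : hardy U u = 0) : ∀ z ∈ U, u z = 0 := by
  intro z hz
  have hr := hrad z hz
  have h1 : eL2 (fun ω => u (((‖z‖ : ℝ) : ℂ) * ω)) = 0 := by
    have h2 := le_iSup₂ (f := fun r (_ : r ∈ radii U) => eL2 (fun ω => u ((r : ℂ) * ω))) _ hr
    exact le_antisymm (h2.trans h0.le) bot_le
  have hc := continuous_circle hu hr
  rw [eL2, eLpNorm_eq_zero_iff hc.aestronglyMeasurable (by norm_num)] at h1
  have h3 := Measure.eqOn_Ioc_of_ae_eq volume h1 hc.continuousOn continuousOn_const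
  have h4 : circleMap 0 ‖z‖ z.arg = z := by simp [circleMap, Complex.norm_mul_exp_arg_mul_I]
  obtain ⟨θ, hθ, he⟩ := (periodic_circleMap 0 1).exists_mem_Ioc Real.two_pi_pos z.arg 0
  rw [zero_add] at hθ
  have h5 := h3 hθ
  simp only [Pi.zero_apply] at h5
  rw [← h4, circleMap_eq, he]
  exact h5

lemma isOpen_extDom (ε : ℝ) : IsOpen (extDom ε) := isOpen_lt continuous_const continuous_norm

lemma isOpen_annulus (ε : ℝ) : IsOpen (annulus ε) :=
  (isOpen_lt continuous_const continuous_norm).inter (isOpen_lt continuous_norm continuous_const)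

lemma radii_extDom {ε : ℝ} {z : ℂ} (hz : z ∈ extDom ε) : ‖z‖ ∈ radii (extDom ε) := by
  refine ⟨norm_nonneg z, fun ω hω => ?_⟩
  simpa [extDom, hω] using hz

lemma radii_annulus {ε : ℝ} {z : ℂ} (hz : z ∈ annulus ε) : ‖z‖ ∈ radii (annulus ε) := by
  refine ⟨norm_nonneg z, fun ω hω => ?_⟩
  simpa [annulus, hω] using hz

lemma XeNorm_smul (ε : ℝ) (k : ℕ) (c : ℝ) (h : ℂ → ℂ) :
    XeNorm ε k (c • h) = ‖c‖ₑ * XeNorm ε k h := by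
  simp only [XeNorm, iteratedDeriv_smul_real, hardy_smul, logHardy_smul, mul_add]

lemma YeNorm_smul (ε : ℝ) (m : ℕ) (c : ℝ) (h : ℂ → ℂ) :
    YeNorm ε m (c • h) = ‖c‖ₑ * YeNorm ε m h := by
  simp only [YeNorm, iteratedDeriv_smul_real, hardy_smul, mul_add]

lemma hardy_iteratedDeriv_add {U : Set ℂ} (hU : IsOpen U) {u v : ℂ → ℂ}
    (hu : DifferentiableOn ℂ u U) (hv : DifferentiableOn ℂ v U) (k : ℕ) :
    hardy U (iteratedDeriv k (u + v)) ≤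
      hardy U (iteratedDeriv k u) + hardy U (iteratedDeriv k v) := by
  rw [hardy_congr (iteratedDeriv_add_on hU hu hv k)]
  exact hardy_add (differentiableOn_iteratedDeriv hU hu k).continuousOn
    (differentiableOn_iteratedDeriv hU hv k).continuousOn

lemma XeNorm_add {ε : ℝ} {k : ℕ} {u v : ℂ → ℂ} (hu : DifferentiableOn ℂ u (extDom ε))
    (hv : DifferentiableOn ℂ v (extDom ε)) :
    XeNorm ε k (u + v) ≤ XeNorm ε k u + XeNorm ε k v := by
  have hU := isOpen_extDom ε
  have h1 := hardy_add hu.continuousOn hv.continuousOn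
  have h2 := hardy_iteratedDeriv_add hU hu hv k
  have h3 := logHardy_add hU (differentiableOn_iteratedDeriv hU hu k)
    (differentiableOn_iteratedDeriv hU hv k)
  rw [← logHardy_congr (iteratedDeriv_add_on hU hu hv k)] at h3
  refine (add_le_add (add_le_add h1 h2) h3).trans_eq ?_
  simp only [XeNorm]
  ring

lemma YeNorm_add {ε : ℝ} {m : ℕ} {u v : ℂ → ℂ} (hu : DifferentiableOn ℂ u (annulus ε))
    (hv : DifferentiableOn ℂ v (annulus ε)) :
    YeNorm ε m (u + v) ≤ YeNorm ε m u + YeNorm ε m v := by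
  have h1 := hardy_add hu.continuousOn hv.continuousOn
  have h2 := hardy_iteratedDeriv_add (isOpen_annulus ε) hu hv m
  refine (add_le_add h1 h2).trans_eq ?_
  simp only [YeNorm]
  ring

/-- The space `𝒜_ε` of functions holomorphic on `{ε < |z|}` of the form `∑_{n ≥ 1} h_n z^{-n}` with
real coefficients. Functions are extended by zero outside their domain. -/
def Aspace (ε : ℝ) : Submodule ℝ (ℂ → ℂ) where
  carrier := {h | (∀ z ∉ extDom ε, h z = 0) ∧ DifferentiableOn ℂ h (extDom ε) ∧
    ∃ a : ℕ+ → ℝ, ∀ z ∈ extDom ε, HasSum (fun n : ℕ+ => (a n : ℂ) * (z ^ (n : ℕ))⁻¹) (h z)}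
  zero_mem' := ⟨fun _ _ => rfl, differentiableOn_const 0, 0, fun z _ => by
    simp⟩
  add_mem' := by
    rintro u v ⟨hu0, hu, a, ha⟩ ⟨hv0, hv, c, hc⟩
    refine ⟨fun z hz => by simp [hu0 z hz, hv0 z hz], hu.add hv, a + c, fun z hz => ?_⟩
    simpa [add_mul] using (ha z hz).add (hc z hz)
  smul_mem' := by
    rintro s u ⟨hu0, hu, a, ha⟩
    refine ⟨fun z hz => by simp [hu0 z hz], hu.const_smul s, s • a, fun z hz => ?_⟩
    simpa [mul_assoc] using (ha z hz).mul_left (s : ℂ)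

/-- The space `Â_ε` of functions holomorphic on `{ε < |z| < 1/ε}` of the form
`i ∑_{n ≥ 1} h_n (z^n - z^{-n})` with real coefficients. Functions are extended by zero outside
their domain. -/
def Ahat (ε : ℝ) : Submodule ℝ (ℂ → ℂ) where
  carrier := {h | (∀ z ∉ annulus ε, h z = 0) ∧ DifferentiableOn ℂ h (annulus ε) ∧
    ∃ a : ℕ+ → ℝ, ∀ z ∈ annulus ε,
      HasSum (fun n : ℕ+ => I * ((a n : ℂ) * (z ^ (n : ℕ) - (z ^ (n : ℕ))⁻¹))) (h z)}
  zero_mem' := ⟨fun _ _ => rfl, differentiableOn_const 0, 0, fun z _ => by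
    simp⟩
  add_mem' := by
    rintro u v ⟨hu0, hu, a, ha⟩ ⟨hv0, hv, c, hc⟩
    refine ⟨fun z hz => by simp [hu0 z hz, hv0 z hz], hu.add hv, a + c, fun z hz => ?_⟩
    simpa [add_mul, mul_add] using (ha z hz).add (hc z hz)
  smul_mem' := by
    rintro s u ⟨hu0, hu, a, ha⟩
    refine ⟨fun z hz => by simp [hu0 z hz], hu.const_smul s, s • a, fun z hz => ?_⟩
    have e : (fun n : ℕ+ => I * (((s • a) n : ℂ) * (z ^ (n : ℕ) - (z ^ (n : ℕ))⁻¹))) =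
        fun n : ℕ+ => (s : ℂ) * (I * ((a n : ℂ) * (z ^ (n : ℕ) - (z ^ (n : ℕ))⁻¹))) := by
      funext n
      simp only [Pi.smul_apply, smul_eq_mul, Complex.ofReal_mul]
      ring
    rw [e, Pi.smul_apply, Complex.real_smul]
    exact (ha z hz).mul_left (s : ℂ)

/-- The set of `h ∈ 𝒜_ε` for which the three norms defining `X^{k+log}` are finite. -/
def Xsub (ε : ℝ) (k : ℕ) : Submodule ℝ (ℂ → ℂ) where
  carrier := {h | h ∈ Aspace ε ∧ XeNorm ε k h < ∞}
  zero_mem' := ⟨(Aspace ε).zero_mem, by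
    have h := XeNorm_smul ε k 0 0
    rw [zero_smul, enorm_zero, zero_mul] at h
    rw [h]
    exact ENNReal.zero_lt_top⟩
  add_mem' := fun {u v} hu hv => ⟨(Aspace ε).add_mem hu.1 hv.1,
    (XeNorm_add hu.1.2.1 hv.1.2.1).trans_lt (ENNReal.add_lt_top.2 ⟨hu.2, hv.2⟩)⟩
  smul_mem' := fun c u hu => ⟨(Aspace ε).smul_mem c hu.1, by
    rw [XeNorm_smul]
    exact ENNReal.mul_lt_top enorm_lt_top hu.2⟩

/-- The set of `h ∈ Â_ε` for which the two norms defining `Y^m` are finite. -/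
def Ysub (ε : ℝ) (m : ℕ) : Submodule ℝ (ℂ → ℂ) where
  carrier := {h | h ∈ Ahat ε ∧ YeNorm ε m h < ∞}
  zero_mem' := ⟨(Ahat ε).zero_mem, by
    have h := YeNorm_smul ε m 0 0
    rw [zero_smul, enorm_zero, zero_mul] at h
    rw [h]
    exact ENNReal.zero_lt_top⟩
  add_mem' := fun {u v} hu hv => ⟨(Ahat ε).add_mem hu.1 hv.1,
    (YeNorm_add hu.1.2.1 hv.1.2.1).trans_lt (ENNReal.add_lt_top.2 ⟨hu.2, hv.2⟩)⟩
  smul_mem' := fun c u hu => ⟨(Ahat ε).smul_mem c hu.1, by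
    rw [YeNorm_smul]
    exact ENNReal.mul_lt_top enorm_lt_top hu.2⟩

/-- The normed space `X^{k+log}`. -/
def X (ε : ℝ) (k : ℕ) : Type := ↥(Xsub ε k)

/-- The normed space `Y^m`. -/
def Y (ε : ℝ) (m : ℕ) : Type := ↥(Ysub ε m)

instance (ε : ℝ) (k : ℕ) : AddCommGroup (X ε k) := inferInstanceAs (AddCommGroup ↥(Xsub ε k))

instance (ε : ℝ) (k : ℕ) : Module ℝ (X ε k) := inferInstanceAs (Module ℝ ↥(Xsub ε k))

instance (ε : ℝ) (m : ℕ) : AddCommGroup (Y ε m) := inferInstanceAs (AddCommGroup ↥(Ysub ε m))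

instance (ε : ℝ) (m : ℕ) : Module ℝ (Y ε m) := inferInstanceAs (Module ℝ ↥(Ysub ε m))

instance (ε : ℝ) (k : ℕ) : CoeFun (X ε k) (fun _ => ℂ → ℂ) := ⟨fun h => h.1⟩

instance (ε : ℝ) (m : ℕ) : CoeFun (Y ε m) (fun _ => ℂ → ℂ) := ⟨fun h => h.1⟩

instance (ε : ℝ) (k : ℕ) : Norm (X ε k) := ⟨fun h => (XeNorm ε k h).toReal⟩

instance (ε : ℝ) (m : ℕ) : Norm (Y ε m) := ⟨fun h => (YeNorm ε m h).toReal⟩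

lemma X_core (ε : ℝ) (k : ℕ) : NormedSpace.Core ℝ (X ε k) where
  norm_nonneg _ := ENNReal.toReal_nonneg
  norm_smul c h := by
    have e := XeNorm_smul ε k c h.1
    change (XeNorm ε k (c • h.1)).toReal = ‖c‖ * (XeNorm ε k h.1).toReal
    rw [e, ENNReal.toReal_mul, toReal_enorm]
  norm_triangle u v := by
    have e := XeNorm_add (k := k) u.2.1.2.1 v.2.1.2.1
    change (XeNorm ε k (u.1 + v.1)).toReal ≤ (XeNorm ε k u.1).toReal + (XeNorm ε k v.1).toReal
    rw [← ENNReal.toReal_add u.2.2.ne v.2.2.ne]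
    exact ENNReal.toReal_mono (ENNReal.add_lt_top.2 ⟨u.2.2, v.2.2⟩).ne e
  norm_eq_zero_iff u := by
    constructor
    · intro h
      have h1 : XeNorm ε k u.1 = 0 :=
        ((ENNReal.toReal_eq_zero_iff _).1 h).resolve_right u.2.2.ne
      have h2 : hardy (extDom ε) u.1 = 0 := by
        simp only [XeNorm, add_eq_zero] at h1
        exact h1.1.1
      have h3 := eqOn_zero_of_hardy u.2.1.2.1.continuousOn (fun z hz => radii_extDom hz) h2
      refine Subtype.ext (funext fun z => ?_)
      by_cases hz : z ∈ extDom ε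
      · exact h3 z hz
      · exact u.2.1.1 z hz
    · rintro rfl
      have e := XeNorm_smul ε k 0 0
      rw [zero_smul, enorm_zero, zero_mul] at e
      change (XeNorm ε k (0 : ℂ → ℂ)).toReal = 0
      rw [e, ENNReal.toReal_zero]

lemma Y_core (ε : ℝ) (m : ℕ) : NormedSpace.Core ℝ (Y ε m) where
  norm_nonneg _ := ENNReal.toReal_nonneg
  norm_smul c h := by
    have e := YeNorm_smul ε m c h.1
    change (YeNorm ε m (c • h.1)).toReal = ‖c‖ * (YeNorm ε m h.1).toReal
    rw [e, ENNReal.toReal_mul, toReal_enorm]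
  norm_triangle u v := by
    have e := YeNorm_add (m := m) u.2.1.2.1 v.2.1.2.1
    change (YeNorm ε m (u.1 + v.1)).toReal ≤ (YeNorm ε m u.1).toReal + (YeNorm ε m v.1).toReal
    rw [← ENNReal.toReal_add u.2.2.ne v.2.2.ne]
    exact ENNReal.toReal_mono (ENNReal.add_lt_top.2 ⟨u.2.2, v.2.2⟩).ne e
  norm_eq_zero_iff u := by
    constructor
    · intro h
      have h1 : YeNorm ε m u.1 = 0 :=
        ((ENNReal.toReal_eq_zero_iff _).1 h).resolve_right u.2.2.ne
      have h2 : hardy (annulus ε) u.1 = 0 := by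
        simp only [YeNorm, add_eq_zero] at h1
        exact h1.1
      have h3 := eqOn_zero_of_hardy u.2.1.2.1.continuousOn (fun z hz => radii_annulus hz) h2
      refine Subtype.ext (funext fun z => ?_)
      by_cases hz : z ∈ annulus ε
      · exact h3 z hz
      · exact u.2.1.1 z hz
    · rintro rfl
      have e := YeNorm_smul ε m 0 0
      rw [zero_smul, enorm_zero, zero_mul] at e
      change (YeNorm ε m (0 : ℂ → ℂ)).toReal = 0
      rw [e, ENNReal.toReal_zero]

instance (ε : ℝ) (k : ℕ) : NormedAddCommGroup (X ε k) := NormedAddCommGroup.ofCore (X_core ε k)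

instance (ε : ℝ) (k : ℕ) : NormedSpace ℝ (X ε k) := NormedSpace.ofCore (X_core ε k)

instance (ε : ℝ) (m : ℕ) : NormedAddCommGroup (Y ε m) := NormedAddCommGroup.ofCore (Y_core ε m)

instance (ε : ℝ) (m : ℕ) : NormedSpace ℝ (Y ε m) := NormedSpace.ofCore (Y_core ε m)

/-! ### The functional between the function spaces -/

/-- `g ∈ Y^m` is the holomorphic extension of the function `G_j(Ω, f_1, f_2)` on the circle. -/
def Represents {ε : ℝ} {k m : ℕ} (b Ω : ℝ) (f : Fin 2 → X ε k) (j : Fin 2) (g : Y ε m) : Prop :=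
  ∀ ω : ℂ, ‖ω‖ = 1 → g ω = (Gfun b Ω (fun i => f i) j ω : ℂ)

open Classical in
/-- `(f_1, f_2) ↦ (G_1(Ω, f_1, f_2), G_2(Ω, f_1, f_2))`, from `X^{k+log} × X^{k+log}` to
`Y^{k-1} × Y^{k-1}`; only its values for small `(f_1, f_2)`, where `G_j(Ω, f_1, f_2)` does belong to
`Y^{k-1}`, are meaningful. -/
def G (ε : ℝ) (k : ℕ) (b Ω : ℝ) (f : Fin 2 → X ε k) : Fin 2 → Y ε (k - 1) := fun j =>
  if h : ∃ g : Y ε (k - 1), Represents b Ω f j g then h.choose else 0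

/-- The linearized operator `DG(Ω, 0, 0)`: the Fréchet derivative of `(f_1, f_2) ↦ G(Ω, f_1, f_2)` at
the annulus `(f_1, f_2) = (0, 0)`. -/
def DG (ε : ℝ) (k : ℕ) (b Ω : ℝ) : (Fin 2 → X ε k) →L[ℝ] (Fin 2 → Y ε (k - 1)) :=
  fderiv ℝ (G ε k b Ω) 0

end VStates

end

noncomputable section

namespace VStates

/-! ### Weighted square summable sequences and their convolution -/

/-! Everything is transported to Fourier coefficients. Laurent coefficients that are square summable
against the weight `(1+|n|)^(k-1) ε^(-|n|)` produce elements of `Y` (`projY`), and the coefficients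
of an element of `X` are square summable even with the extra factor `(1+|n|)(1+log(1+|n|))`
(`coefX`). The logarithm comes from the last part of the norm of `X`: the operator acts on `z^n` as
the multiplier `sing n`, which is computed exactly and grows like `log |n|` (`Laurent.logOp`,
`two_log_le_lam`). The weighted sequences form a convolution algebra (`conv`), and evaluation on the
circle turns convolution into multiplication (`ev_conv`).

For the nonlocal operator put `τ = ωσ`. At the annulus `Φ_i(ωσ) - Φ_j(ω) = ωR` with `R = b^i σ -
b^j`, which depends on `σ` only. After perturbation this difference becomes `ωR(1+d)` and the
numerator of `S` becomes `R(ω+T)`, so the integrand is `(R/|R|)(ω+T)/|1+d|`. Here `d` is a Laurent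
series in `ω` with values in the bounded functions of the angle of `σ`, and `1/|1+d|` is the product
of the binomial series of `(1+d)^(-1/2)` and of its conjugate. The numerator is read as a Laurent
series of functionals on such functions. Their norms are controlled by the `L¹` norms of the
quotients `(σ^m-1)/(σ-1)`, which grow only logarithmically; with the factor `m` from differentiation
this is exactly what the weight of `X` pays for (`wt_mul_norm_LkMul_le`). Hence `S`, and with it the
expression whose imaginary part is `G_j`, is a map on sequences that is differentiable at `0`
(`S_eq_ev`, `exists_hasFDerivAt_Sop`, `exists_hasFDerivAt_Hop`). Real coefficients make `G_j` odd
under `ω ↦ conj ω` (`Gfun_conj`), so taking the odd part lands in `Y`.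

In the derivative at the annulus the mode `z^(-n)` only produces `ω^(n+1)` and `ω^(-n-1)`. The mean
values of a boundary component with itself are values of `sing`, whence the sums `S_n`. Those of two
different components are Fourier coefficients `Bn` of `1/|σ-b|`, after an integration by parts
removes the third power from the denominator (`integral_Cn`, `integral_Dn`). Finally Neumann's
formula writes `J_n(bt)J_n(t)` as a mean of `J_0(t|σ-b|)σ^(-n)`; since the improper integral of
`J_0` is `1`, the product integral converges to `Bn b n`, so `b Λ_n(b) = Bn b n` (`b_mul_Lam`). The
algebra that assembles `M_(n+1)` is `gam_eq`. -/

/-- Square summable two-sided sequences. -/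
abbrev L2 (E : Type*) [NormedAddCommGroup E] := lp (fun _ : ℤ => E) 2

lemma L2.hasSum_sq {E : Type*} [NormedAddCommGroup E] (x : L2 E) :
    HasSum (fun n => ‖x n‖ ^ 2) (‖x‖ ^ 2) := by
  have h := lp.hasSum_norm (p := 2) (by norm_num) x
  simpa using h

lemma memℓp_two {E : Type*} [NormedAddCommGroup E] {f : ℤ → E}
    (h : Summable fun n => ‖f n‖ ^ 2) : Memℓp f 2 := by
  refine memℓp_gen ?_
  simpa using h

lemma L2.norm_le {E : Type*} [NormedAddCommGroup E] (x : L2 E) {C : ℝ} (hC : 0 ≤ C)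
    (h : ∑' n, ‖x n‖ ^ 2 ≤ C ^ 2) : ‖x‖ ≤ C := by
  rw [(L2.hasSum_sq x).tsum_eq] at h
  exact (sq_le_sq₀ (norm_nonneg _) hC).1 h

lemma summable_mul_of_sq {ι : Type*} {f g : ι → ℝ} (hf : Summable fun i => f i ^ 2)
    (hg : Summable fun i => g i ^ 2) : Summable fun i => f i * g i := by
  refine Summable.of_norm_bounded (hf.add hg) fun i => ?_
  rw [Real.norm_eq_abs, abs_le]
  constructor <;> nlinarith [sq_nonneg (f i + g i), sq_nonneg (f i - g i)]

lemma tsum_mul_sq_le {ι : Type*} {f g : ι → ℝ} (hf : Summable fun i => f i ^ 2)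
    (hg : Summable fun i => g i ^ 2) :
    (∑' i, f i * g i) ^ 2 ≤ (∑' i, f i ^ 2) * ∑' i, g i ^ 2 := by
  have h := (summable_mul_of_sq hf hg).hasSum
  refine le_of_tendsto (h.pow 2) (Eventually.of_forall fun s => ?_)
  refine (Finset.sum_mul_sq_le_sq_mul_sq s f g).trans ?_
  exact mul_le_mul (hf.sum_le_tsum s fun i _ => sq_nonneg _)
    (hg.sum_le_tsum s fun i _ => sq_nonneg _) (Finset.sum_nonneg fun i _ => sq_nonneg _)
    (tsum_nonneg fun i => sq_nonneg _)

/-- A weight on `ℤ` for which the weighted `ℓ²` space is a convolution algebra. -/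
structure ConvWeight where
  w : ℤ → ℝ
  pos : ∀ n, 0 < w n
  summable_inv : Summable fun n => (w n)⁻¹ ^ 2
  K : ℝ
  K_nonneg : 0 ≤ K
  summable_ker : ∀ n, Summable fun m => (w n / (w m * w (n - m))) ^ 2
  tsum_ker : ∀ n, ∑' m, (w n / (w m * w (n - m))) ^ 2 ≤ K ^ 2

/-- The shear `(n, m) ↦ (m, n - m)`. -/
def shear : ℤ × ℤ ≃ ℤ × ℤ where
  toFun p := (p.2, p.1 - p.2)
  invFun p := (p.1 + p.2, p.1)
  left_inv p := by ext <;> simp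
  right_inv p := by ext <;> simp

section Conv

variable {E F G : Type*} [NormedAddCommGroup E] [NormedSpace ℂ E] [NormedAddCommGroup F]
  [NormedSpace ℂ F] [NormedAddCommGroup G] [NormedSpace ℂ G] [CompleteSpace G]

set_option linter.unusedSectionVars false

/-- The terms of the convolution. -/
def convTerm (W : ConvWeight) (B : E →L[ℂ] F →L[ℂ] G) (x : L2 E) (y : L2 F) (n m : ℤ) : G :=
  (W.w n / (W.w m * W.w (n - m))) • B (x m) (y (n - m))

lemma summable_shear (x : L2 E) (y : L2 F) :
    Summable fun p : ℤ × ℤ => (‖x p.2‖ * ‖y (p.1 - p.2)‖) ^ 2 := by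
  have h := (L2.hasSum_sq x).summable.mul_of_nonneg (L2.hasSum_sq y).summable
    (fun _ => sq_nonneg _) (fun _ => sq_nonneg _)
  have h' := shear.summable_iff.2 h
  refine h'.congr fun p => ?_
  simp [shear, mul_pow]

/-- Summing over all diagonals `m + (n - m) = n` only reindexes `ℤ × ℤ` by `shear`, so the double
sum factors. This is the step of the convolution estimate that is summed over `n`. -/
lemma tsum_shear (x : L2 E) (y : L2 F) :
    ∑' n, ∑' m, (‖x m‖ * ‖y (n - m)‖) ^ 2 = ‖x‖ ^ 2 * ‖y‖ ^ 2 := by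
  rw [← (summable_shear x y).tsum_prod (f := fun p : ℤ × ℤ => (‖x p.2‖ * ‖y (p.1 - p.2)‖) ^ 2),
    ← (L2.hasSum_sq x).tsum_eq, ← (L2.hasSum_sq y).tsum_eq,
    (L2.hasSum_sq x).summable.tsum_mul_tsum (L2.hasSum_sq y).summable
      ((L2.hasSum_sq x).summable.mul_of_nonneg (L2.hasSum_sq y).summable
    (fun _ => sq_nonneg _) (fun _ => sq_nonneg _)), ← shear.tsum_eq
      (fun p : ℤ × ℤ => ‖x p.1‖ ^ 2 * ‖y p.2‖ ^ 2)]
  refine tsum_congr fun p => ?_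
  simp [shear, mul_pow]

lemma norm_convTerm_le (W : ConvWeight) (B : E →L[ℂ] F →L[ℂ] G) (x : L2 E) (y : L2 F) (n m : ℤ) :
    ‖convTerm W B x y n m‖ ≤
      ‖B‖ * ((W.w n / (W.w m * W.w (n - m))) * (‖x m‖ * ‖y (n - m)‖)) := by
  have h0 : 0 ≤ W.w n / (W.w m * W.w (n - m)) :=
    (div_pos (W.pos n) (mul_pos (W.pos m) (W.pos _))).le
  rw [convTerm, norm_smul, Real.norm_of_nonneg h0]
  have := mul_le_mul_of_nonneg_left (B.le_opNorm₂ (x m) (y (n - m))) h0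
  linarith

lemma summable_bound (W : ConvWeight) (x : L2 E) (y : L2 F) (n : ℤ) :
    Summable fun m => (W.w n / (W.w m * W.w (n - m))) * (‖x m‖ * ‖y (n - m)‖) :=
  summable_mul_of_sq (W.summable_ker n) ((summable_shear x y).prod_factor n)

lemma summable_convTerm (W : ConvWeight) (B : E →L[ℂ] F →L[ℂ] G) (x : L2 E) (y : L2 F) (n : ℤ) :
    Summable (convTerm W B x y n) :=
  Summable.of_norm_bounded ((summable_bound W x y n).mul_left _) (norm_convTerm_le W B x y n)

/-- Cauchy–Schwarz in `m` separates the weight quotients from the norms. The sum of squared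
quotients is bounded uniformly in `n` by `tsum_ker`, and what remains is summable in `n` by
`tsum_shear`. -/
lemma norm_tsum_convTerm_sq (W : ConvWeight) (B : E →L[ℂ] F →L[ℂ] G) (x : L2 E) (y : L2 F)
    (n : ℤ) : ‖∑' m, convTerm W B x y n m‖ ^ 2 ≤
      (‖B‖ * W.K) ^ 2 * ∑' m, (‖x m‖ * ‖y (n - m)‖) ^ 2 := by
  have h1 := tsum_of_norm_bounded ((summable_bound W x y n).mul_left ‖B‖).hasSum
    (norm_convTerm_le W B x y n)
  rw [tsum_mul_left] at h1
  have h2 := tsum_mul_sq_le (W.summable_ker n) ((summable_shear x y).prod_factor n)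
  have h3 : 0 ≤ ∑' m, (‖x m‖ * ‖y (n - m)‖) ^ 2 := tsum_nonneg fun m => sq_nonneg _
  calc _ ≤ (‖B‖ * ∑' m, (W.w n / (W.w m * W.w (n - m))) * (‖x m‖ * ‖y (n - m)‖)) ^ 2 :=
        pow_le_pow_left₀ (norm_nonneg _) h1 2
    _ ≤ ‖B‖ ^ 2 * (W.K ^ 2 * ∑' m, (‖x m‖ * ‖y (n - m)‖) ^ 2) := by
        rw [mul_pow]
        exact mul_le_mul_of_nonneg_left
          (h2.trans (mul_le_mul_of_nonneg_right (W.tsum_ker n) h3)) (sq_nonneg _)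
    _ = _ := by ring

lemma memℓp_conv (W : ConvWeight) (B : E →L[ℂ] F →L[ℂ] G) (x : L2 E) (y : L2 F) :
    Memℓp (fun n => ∑' m, convTerm W B x y n m) 2 :=
  memℓp_two (Summable.of_nonneg_of_le (fun _ => sq_nonneg _) (norm_tsum_convTerm_sq W B x y)
    ((summable_shear x y).prod.mul_left _))

/-- The weighted convolution of sequences with respect to a bilinear map. -/
def conv (W : ConvWeight) (B : E →L[ℂ] F →L[ℂ] G) : L2 E →L[ℂ] L2 F →L[ℂ] L2 G :=
  LinearMap.mkContinuous₂
    (LinearMap.mk₂ ℂ (fun x y => (⟨_, memℓp_conv W B x y⟩ : L2 G))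
      (fun x x' y => lp.ext <| funext fun n => by
        simp only [lp.coeFn_add, Pi.add_apply]
        rw [← (summable_convTerm W B x y n).tsum_add (summable_convTerm W B x' y n)]
        refine tsum_congr fun m => ?_
        simp [convTerm])
      (fun c x y => lp.ext <| funext fun n => by
        simp only [lp.coeFn_smul, Pi.smul_apply]
        rw [← tsum_const_smul'']
        refine tsum_congr fun m => ?_
        simp [convTerm, smul_comm c])
      (fun x y y' => lp.ext <| funext fun n => by
        simp only [lp.coeFn_add, Pi.add_apply]
        rw [← (summable_convTerm W B x y n).tsum_add (summable_convTerm W B x y' n)]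
        refine tsum_congr fun m => ?_
        simp [convTerm])
      (fun c x y => lp.ext <| funext fun n => by
        simp only [lp.coeFn_smul, Pi.smul_apply]
        rw [← tsum_const_smul'']
        refine tsum_congr fun m => ?_
        simp [convTerm, smul_comm c]))
    (‖B‖ * W.K) fun x y => by
      have hC : 0 ≤ ‖B‖ * W.K := mul_nonneg (norm_nonneg B) W.K_nonneg
      refine L2.norm_le _ (by positivity) ?_
      have h := (L2.hasSum_sq (⟨_, memℓp_conv W B x y⟩ : L2 G)).summable.tsum_le_tsum
        (norm_tsum_convTerm_sq W B x y) ((summable_shear x y).prod.mul_left _)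
      rw [tsum_mul_left, tsum_shear] at h
      refine h.trans_eq (by ring)

lemma conv_apply (W : ConvWeight) (B : E →L[ℂ] F →L[ℂ] G) (x : L2 E) (y : L2 F) (n : ℤ) :
    conv W B x y n = ∑' m, convTerm W B x y n m := rfl

lemma norm_conv_le (W : ConvWeight) (B : E →L[ℂ] F →L[ℂ] G) (x : L2 E) (y : L2 F) :
    ‖conv W B x y‖ ≤ ‖B‖ * W.K * ‖x‖ * ‖y‖ :=
  ((conv W B).le_opNorm₂ x y).trans (by
    gcongr
    exact LinearMap.mkContinuous₂_norm_le _ (mul_nonneg (norm_nonneg B) W.K_nonneg) _)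

/-! ### Evaluation of the corresponding Laurent series on the unit circle -/

lemma norm_evTerm (W : ConvWeight) {ω : ℂ} (hω : ‖ω‖ = 1) (x : L2 G) (n : ℤ) :
    ‖(((W.w n)⁻¹ : ℝ) * ω ^ n : ℂ) • x n‖ = (W.w n)⁻¹ * ‖x n‖ := by
  rw [norm_smul, norm_mul, norm_zpow, hω, one_zpow, mul_one, Complex.norm_real,
    Real.norm_of_nonneg (inv_nonneg.2 (W.pos n).le)]

lemma summable_norm_evTerm (W : ConvWeight) {ω : ℂ} (hω : ‖ω‖ = 1) (x : L2 G) :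
    Summable fun n => ‖(((W.w n)⁻¹ : ℝ) * ω ^ n : ℂ) • x n‖ := by
  simp only [norm_evTerm W hω]
  exact summable_mul_of_sq W.summable_inv (L2.hasSum_sq x).summable

/-- Evaluation of the Laurent series with coefficients `x n / w n` at a point of the unit circle. -/
def ev (W : ConvWeight) {ω : ℂ} (hω : ‖ω‖ = 1) : L2 G →L[ℂ] G :=
  LinearMap.mkContinuous
    { toFun := fun x => ∑' n, (((W.w n)⁻¹ : ℝ) * ω ^ n : ℂ) • x n
      map_add' := fun x y => by
        rw [← (summable_norm_evTerm W hω x).of_norm.tsum_add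
          (summable_norm_evTerm W hω y).of_norm]
        simp
      map_smul' := fun c x => by
        simp only [RingHom.id_apply]
        rw [← tsum_const_smul'']
        refine tsum_congr fun m => ?_
        simp [smul_comm c] }
    (√(∑' n, (W.w n)⁻¹ ^ 2)) fun x => by
      have h := tsum_of_norm_bounded (summable_norm_evTerm W hω x).hasSum fun n => le_rfl
      have h1 : √((∑' n, (W.w n)⁻¹ ^ 2) * ‖x‖ ^ 2) = √(∑' n, (W.w n)⁻¹ ^ 2) * ‖x‖ := by
        rw [Real.sqrt_mul (tsum_nonneg fun n => sq_nonneg _), Real.sqrt_sq (norm_nonneg _)]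
      rw [← h1]
      refine h.trans (Real.le_sqrt_of_sq_le ?_)
      · simp only [norm_evTerm W hω]
        have h2 := tsum_mul_sq_le W.summable_inv (L2.hasSum_sq x).summable
        rwa [(L2.hasSum_sq x).tsum_eq] at h2

lemma hasSum_ev (W : ConvWeight) {ω : ℂ} (hω : ‖ω‖ = 1) (x : L2 G) :
    HasSum (fun n => (((W.w n)⁻¹ : ℝ) * ω ^ n : ℂ) • x n) (ev W hω x) :=
  (summable_norm_evTerm W hω x).of_norm.hasSum

/-- This is the Cauchy product of two absolutely convergent Laurent series, reindexed by `shear`.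
The entries of a sequence are coefficients multiplied by the weight, and the quotient in `convTerm`
is the one that makes these normalisations cancel. -/
lemma ev_conv [CompleteSpace E] [CompleteSpace F] (W : ConvWeight) (B : E →L[ℂ] F →L[ℂ] G)
    {ω : ℂ} (hω : ‖ω‖ = 1) (x : L2 E) (y : L2 F) : ev W hω (conv W B x y) = B (ev W hω x) (ev W hω y) := by
  have hω0 : ω ≠ 0 := by rintro rfl; simp at hω
  set a : ℤ → E := fun n => (((W.w n)⁻¹ : ℝ) * ω ^ n : ℂ) • x n with ha
  set c : ℤ → F := fun n => (((W.w n)⁻¹ : ℝ) * ω ^ n : ℂ) • y n with hc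
  have hs : Summable fun p : ℤ × ℤ => B (a p.1) (c p.2) := by
    refine Summable.of_norm_bounded (((summable_norm_evTerm W hω x).mul_of_nonneg
      (summable_norm_evTerm W hω y) (fun _ => norm_nonneg _) fun _ => norm_nonneg _).mul_left ‖B‖)
      fun p => ?_
    rw [← mul_assoc]
    exact B.le_opNorm₂ _ _
  have h1 : ∑' p : ℤ × ℤ, B (a p.1) (c p.2) = B (ev W hω x) (ev W hω y) := by
    rw [hs.tsum_prod]
    have h2 : ∀ m, ∑' l, B (a m) (c l) = B (a m) (ev W hω y) := fun m =>
      ((hasSum_ev W hω y).mapL (B (a m))).tsum_eq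
    simp only [h2]
    exact (((hasSum_ev W hω x).mapL B).mapL (ContinuousLinearMap.apply ℂ G (ev W hω y))).tsum_eq
  have hs' := shear.summable_iff.2 hs
  rw [← h1, ← shear.tsum_eq (fun p : ℤ × ℤ => B (a p.1) (c p.2)), 
    Summable.tsum_prod (f := fun p : ℤ × ℤ => B (a (shear p).1) (c (shear p).2)) hs', ← (hasSum_ev W hω (conv W B x y)).tsum_eq]
  refine tsum_congr fun n => ?_
  rw [conv_apply, ← tsum_const_smul'']
  refine tsum_congr fun m => ?_
  have e1 := (W.pos n).ne'
  simp only [convTerm, shear, Equiv.coe_fn_mk, ha, hc, map_smul, _root_.smul_apply,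
    ← Complex.coe_smul, smul_smul]
  congr 1
  have e2 : ω ^ n = ω ^ m * ω ^ (n - m) := by rw [← zpow_add₀ hω0]; congr 1; ring
  rw [e2]
  push_cast
  have e3 : (W.w n : ℂ) ≠ 0 := by exact_mod_cast e1
  field_simp

end Conv

/-! ### Elementary sequences and diagonal maps -/

section Diag

variable {E : Type*} [NormedAddCommGroup E] [NormedSpace ℂ E] [CompleteSpace E]

set_option linter.unusedSectionVars false

/-- The sequence of the Laurent monomial `a z^n`. -/
def mono (W : ConvWeight) (n : ℤ) (a : E) : L2 E := lp.single 2 n ((W.w n : ℂ) • a)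

lemma ev_mono (W : ConvWeight) {ω : ℂ} (hω : ‖ω‖ = 1) (n : ℤ) (a : E) :
    ev W hω (mono W n a) = ω ^ n • a := by
  rw [← (hasSum_ev W hω (mono W n a)).tsum_eq, tsum_eq_single n]
  · have : (W.w n : ℂ) ≠ 0 := by exact_mod_cast (W.pos n).ne'
    rw [mono, lp.single_apply_self, smul_smul]
    congr 1
    push_cast
    field_simp
  · intro m hm
    rw [mono, lp.single_apply_ne _ _ _ hm, smul_zero]

lemma summable_diag (W : ConvWeight) {v : ℤ → ℝ} (hv : ∀ n, 0 < v n) (e : ℤ ≃ ℤ) {m : ℤ → E}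
    {C : ℝ} (h : ∀ n, W.w n * ‖m n‖ ≤ C * v (e n)) (x : L2 ℂ) (n : ℤ) :
    ‖((W.w n : ℂ) * (x (e n) / v (e n))) • m n‖ ^ 2 ≤ C ^ 2 * ‖x (e n)‖ ^ 2 := by
  have h1 : ‖((W.w n : ℂ) * (x (e n) / v (e n))) • m n‖ =
      (W.w n * ‖m n‖ / v (e n)) * ‖x (e n)‖ := by
    rw [norm_smul, norm_mul, norm_div, Complex.norm_real, Complex.norm_real,
      Real.norm_of_nonneg (W.pos n).le, Real.norm_of_nonneg (hv _).le]
    ring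
  rw [h1, ← mul_pow]
  have h2 : 0 ≤ W.w n * ‖m n‖ / v (e n) :=
    div_nonneg (mul_nonneg (W.pos n).le (norm_nonneg _)) (hv _).le
  refine pow_le_pow_left₀ (mul_nonneg h2 (norm_nonneg _)) ?_ 2
  exact mul_le_mul_of_nonneg_right ((div_le_iff₀ (hv _)).2 (h n)) (norm_nonneg _)

/-- The map multiplying the coefficients of a `v`-weighted sequence by the vectors `m n` and
reindexing them. -/
def diag (W : ConvWeight) {v : ℤ → ℝ} (hv : ∀ n, 0 < v n) (e : ℤ ≃ ℤ) {m : ℤ → E}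
    {C : ℝ} (h : ∀ n, W.w n * ‖m n‖ ≤ C * v (e n)) : L2 ℂ →L[ℂ] L2 E :=
  LinearMap.mkContinuous
    { toFun := fun x => ⟨fun n => ((W.w n : ℂ) * (x (e n) / v (e n))) • m n,
        memℓp_two (Summable.of_nonneg_of_le (fun _ => sq_nonneg _) (summable_diag W hv e h x)
          ((e.summable_iff.2 (L2.hasSum_sq x).summable).mul_left _))⟩
      map_add' := fun x y => lp.ext <| funext fun n => by
        simp only [lp.coeFn_add, Pi.add_apply]
        rw [← add_smul]
        congr 1
        ring
      map_smul' := fun c x => lp.ext <| funext fun n => by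
        simp only [lp.coeFn_smul, Pi.smul_apply, RingHom.id_apply, smul_smul, smul_eq_mul]
        congr 1
        ring }
    C fun x => by
      have hC : 0 ≤ C := by
        have h0 := (mul_nonneg (W.pos 0).le (norm_nonneg (m 0))).trans (h 0)
        exact nonneg_of_mul_nonneg_left h0 (hv _)
      refine L2.norm_le _ (mul_nonneg hC (norm_nonneg _)) ?_
      have h1 := e.summable_iff.2 (L2.hasSum_sq x).summable
      refine ((Summable.of_nonneg_of_le (fun _ => sq_nonneg _) (summable_diag W hv e h x)
          (h1.mul_left _)).tsum_le_tsum (summable_diag W hv e h x) (h1.mul_left _)).trans_eq ?_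
      rw [tsum_mul_left, e.tsum_eq (fun n => ‖x n‖ ^ 2), (L2.hasSum_sq x).tsum_eq, mul_pow]

lemma hasSum_ev_diag (W : ConvWeight) {v : ℤ → ℝ} (hv : ∀ n, 0 < v n) (e : ℤ ≃ ℤ) {m : ℤ → E}
    {C : ℝ} (h : ∀ n, W.w n * ‖m n‖ ≤ C * v (e n)) {ω : ℂ} (hω : ‖ω‖ = 1) (x : L2 ℂ) :
    HasSum (fun n => (ω ^ n * (x (e n) / v (e n))) • m n) (ev W hω (diag W hv e h x)) := by
  convert hasSum_ev W hω (diag W hv e h x) using 2 with n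
  have : (W.w n : ℂ) ≠ 0 := by exact_mod_cast (W.pos n).ne'
  change _ = _ • (((W.w n : ℂ) * (x (e n) / v (e n))) • m n)
  rw [smul_smul]
  congr 1
  push_cast
  field_simp

end Diag

/-! ### The inverse square root -/

/-- The algebra of bounded continuous functions of the angle. -/
abbrev Ang := BoundedContinuousFunction ℝ ℂ

/-- Convolution product. -/
abbrev cmul (W : ConvWeight) (x y : L2 Ang) : L2 Ang := conv W (ContinuousLinearMap.mul ℂ Ang) x y

/-- `pw W d m` is the convolution power `d^(m+1)`. -/
def pw (W : ConvWeight) (d : L2 Ang) : ℕ → L2 Ang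
  | 0 => d
  | m + 1 => cmul W d (pw W d m)

lemma ev_pw (W : ConvWeight) {ω : ℂ} (hω : ‖ω‖ = 1) (d : L2 Ang) (m : ℕ) :
    ev W hω (pw W d m) = ev W hω d ^ (m + 1) := by
  induction m with
  | zero => simp [pw]
  | succ m ih => rw [pw, ev_conv, ih, ContinuousLinearMap.mul_apply', ← pow_succ']

lemma norm_pw_le (W : ConvWeight) (d : L2 Ang) (m : ℕ) :
    ‖pw W d m‖ ≤ (W.K * ‖d‖) ^ m * ‖d‖ := by
  have hK := W.K_nonneg
  induction m with
  | zero => simp [pw]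
  | succ m ih =>
    refine (norm_conv_le W _ d (pw W d m)).trans ?_
    have h1 : ‖ContinuousLinearMap.mul ℂ Ang‖ ≤ 1 := ContinuousLinearMap.opNorm_mul_le ℂ Ang
    calc _ ≤ 1 * W.K * ‖d‖ * ((W.K * ‖d‖) ^ m * ‖d‖) := by gcongr
      _ = _ := by ring

/-- The coefficients of `(1 + x)^(-1/2)`. -/
def bc (m : ℕ) : ℂ := Ring.choose (-1 / 2 : ℂ) m

lemma bc_zero : bc 0 = 1 := by simp [bc]

lemma bc_one : bc 1 = -1 / 2 := by simp [bc]

lemma hasSum_bc {z : ℂ} (hz : ‖z‖ < 1) :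
    HasSum (fun m => bc m * z ^ m) ((1 + z) ^ (-1 / 2 : ℂ)) := by
  have h := Complex.one_add_cpow_hasFPowerSeriesOnBall_zero (a := (-1 / 2 : ℂ))
  have h1 := h.hasSum (y := z) (by
    rw [← ENNReal.ofReal_one, Metric.eball_ofReal]; simpa using hz)
  simpa [bc, binomialSeries, FormalMultilinearSeries.coeff_ofScalars, mul_comm] using h1

/-- The binomial series converges at `1/2`, so its terms there are bounded. A crude geometric bound
suffices, since only small `d` matter. -/
lemma exists_bc_bound : ∃ C : ℝ, 0 < C ∧ ∀ m, ‖bc m‖ ≤ C * 2 ^ m := by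
  have h1 := (hasSum_bc (z := 1 / 2) (by norm_num)).summable.tendsto_atTop_zero
  have h2 := h1.norm.bddAbove_range
  obtain ⟨C, hC⟩ := h2
  refine ⟨max C 1, by positivity, fun m => ?_⟩
  have h3 := hC ⟨m, rfl⟩
  simp only [norm_mul, norm_pow] at h3
  norm_num at h3
  have h4 : ‖bc m‖ * (1 / 2) ^ m ≤ max C 1 := by
    refine le_trans (le_of_eq ?_) (h3.trans (le_max_left _ _))
    norm_num
  have h5 : (0:ℝ) < 2 ^ m := by positivity
  calc ‖bc m‖ = (‖bc m‖ * (1 / 2) ^ m) * 2 ^ m := by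
        rw [mul_assoc, ← mul_pow]; norm_num
    _ ≤ _ := by gcongr

/-- `(1 + d)^(-1/2)` in the convolution algebra, for small `d`. -/
def invSqrt (W : ConvWeight) (d : L2 Ang) : L2 Ang :=
  mono W 0 1 + ∑' m, bc (m + 1) • pw W d m

lemma invSqrt_zero (W : ConvWeight) : invSqrt W 0 = mono W 0 1 := by
  have h : ∀ m, bc (m + 1) • pw W 0 m = 0 := fun m => by
    have := norm_pw_le W 0 m
    rw [norm_zero, mul_zero] at this
    rw [norm_le_zero_iff.1 this, smul_zero]
  simp [invSqrt, h]

/-- The threshold `1/4` beats the growth `2^m` of the coefficients and leaves the ratio `1/2`. -/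
lemma norm_bc_pw_le (W : ConvWeight) {C : ℝ} (hC : ∀ m, ‖bc m‖ ≤ C * 2 ^ m) {d : L2 Ang}
    (hd : W.K * ‖d‖ ≤ 1 / 4) (m : ℕ) :
    ‖bc (m + 1) • pw W d m‖ ≤ (2 * C * ‖d‖) * (1 / 2) ^ m := by
  rw [norm_smul]
  have hK := mul_nonneg W.K_nonneg (norm_nonneg d)
  have hC0 : 0 ≤ C := by simpa using (norm_nonneg _).trans (hC 0)
  calc _ ≤ (C * 2 ^ (m + 1)) * ((W.K * ‖d‖) ^ m * ‖d‖) := by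
        gcongr
        · exact hC _
        · exact norm_pw_le W d m
    _ ≤ (C * 2 ^ (m + 1)) * ((1 / 4) ^ m * ‖d‖) := by gcongr
    _ = (2 * C * ‖d‖) * (2 * (1 / 4)) ^ m := by rw [mul_pow]; ring
    _ = _ := by norm_num

lemma summable_bc_pw (W : ConvWeight) {d : L2 Ang} (hd : W.K * ‖d‖ ≤ 1 / 4) :
    Summable fun m => bc (m + 1) • pw W d m := by
  obtain ⟨C, -, hC⟩ := exists_bc_bound
  exact Summable.of_norm_bounded ((summable_geometric_of_lt_one (by norm_num)
    (by norm_num)).mul_left _) (norm_bc_pw_le W hC hd)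

/-- Removing the constant and the linear term from the series leaves a tail that starts with `d²`.
It is bounded by a multiple of `‖d‖²`, with the same geometric ratio `1/2`. -/
lemma hasFDerivAt_invSqrt (W : ConvWeight) :
    HasFDerivAt (invSqrt W) ((-1 / 2 : ℂ) • ContinuousLinearMap.id ℂ (L2 Ang)) 0 := by
  obtain ⟨C, hC0, hC⟩ := exists_bc_bound
  have hK := W.K_nonneg
  have key : ∀ d : L2 Ang, W.K * ‖d‖ ≤ 1 / 4 →
      ‖invSqrt W d - invSqrt W 0 - (-1 / 2 : ℂ) • d‖ ≤ (8 * C * W.K) * ‖d‖ ^ 2 := by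
    intro d hd
    have h1 := summable_bc_pw W hd
    have e : invSqrt W d - invSqrt W 0 - (-1 / 2 : ℂ) • d =
        ∑' m, bc (m + 1 + 1) • pw W d (m + 1) := by
      rw [invSqrt_zero, invSqrt, h1.tsum_eq_zero_add, zero_add, bc_one]
      simp [pw]
    rw [e]
    have hb : ∀ m, ‖bc (m + 1 + 1) • pw W d (m + 1)‖ ≤
        (4 * C * W.K * ‖d‖ ^ 2) * (1 / 2) ^ m := by
      intro m
      rw [norm_smul]
      calc _ ≤ (C * 2 ^ (m + 1 + 1)) * ((W.K * ‖d‖) ^ (m + 1) * ‖d‖) := by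
            gcongr
            · exact hC _
            · exact norm_pw_le W d _
        _ = (C * 2 ^ (m + 1 + 1)) * ((W.K * ‖d‖) ^ m * (W.K * ‖d‖) * ‖d‖) := by ring
        _ ≤ (C * 2 ^ (m + 1 + 1)) * ((1 / 4) ^ m * (W.K * ‖d‖) * ‖d‖) := by gcongr
        _ = (4 * C * W.K * ‖d‖ ^ 2) * (2 * (1 / 4)) ^ m := by rw [mul_pow]; ring
        _ = _ := by norm_num
    have h2 := tsum_of_norm_bounded ((hasSum_geometric_of_lt_one (r := (1 / 2 : ℝ)) (by norm_num)
      (by norm_num)).mul_left (4 * C * W.K * ‖d‖ ^ 2)) hb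
    refine h2.trans_eq ?_
    norm_num
    ring
  rw [hasFDerivAt_iff_isLittleO_nhds_zero]
  refine Asymptotics.IsBigO.trans_isLittleO (g := fun d : L2 Ang => ‖d‖ ^ 2) ?_ ?_
  · refine Asymptotics.IsBigO.of_bound (8 * C * W.K) ?_
    have : ∀ᶠ d : L2 Ang in 𝓝 0, W.K * ‖d‖ < 1 / 4 := by
      have hc : Continuous fun d : L2 Ang => W.K * ‖d‖ := by fun_prop
      exact hc.continuousAt.eventually_lt continuousAt_const (by simp)
    filter_upwards [this] with d hd
    have := key d hd.le
    simpa using this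
  · exact Asymptotics.isLittleO_norm_pow_id one_lt_two

/-- Evaluation at `ω` and then at the angle `θ` is continuous, linear and multiplicative, so it maps
the series in the convolution algebra to the scalar binomial series. Two smallness conditions
appear: one for the series in the algebra, one for the scalar series. -/
lemma ev_invSqrt (W : ConvWeight) {ω : ℂ} (hω : ‖ω‖ = 1) {d : L2 Ang} (hd : W.K * ‖d‖ ≤ 1 / 4)
    (θ : ℝ) (hθ : ‖ev W hω d θ‖ < 1) :
    ev W hω (invSqrt W d) θ = (1 + ev W hω d θ) ^ (-1 / 2 : ℂ) := by
  have h1 := ((summable_bc_pw W hd).hasSum.mapL (ev W hω)).mapL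
    (BoundedContinuousFunction.evalCLM ℂ θ)
  simp only [map_smul, ev_pw, BoundedContinuousFunction.evalCLM_apply,
    BoundedContinuousFunction.coe_pow, Pi.pow_apply,
    smul_eq_mul] at h1
  have h2 := (hasSum_nat_add_iff' 1).2 (hasSum_bc hθ)
  simp only [Finset.range_one, Finset.sum_singleton, bc_zero, pow_zero, mul_one] at h2
  have h3 := h1.unique h2
  rw [invSqrt, map_add, ev_mono, BoundedContinuousFunction.coe_add, Pi.add_apply, h3]
  simp

/-! ### The weights -/

/-- The weight `(1+|n|)^s ρ^|n|`. -/
def wt (s : ℕ) (ρ : ℝ) (n : ℤ) : ℝ := (1 + |(n : ℝ)|) ^ s * ρ ^ n.natAbs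

lemma wt_pos (s : ℕ) {ρ : ℝ} (hρ : 1 < ρ) (n : ℤ) : 0 < wt s ρ n := by
  unfold wt
  positivity

lemma summable_inv_sq_int : Summable fun n : ℤ => ((1 + |(n : ℝ)|)⁻¹) ^ 2 := by
  refine Summable.of_norm_bounded_eventually
    (Real.summable_one_div_int_pow (p := 2) |>.2 one_lt_two) ?_
  rw [Filter.eventually_cofinite]
  refine (Set.finite_singleton (0 : ℤ)).subset fun n hn => ?_
  by_contra h0
  refine hn ?_
  have h1 : (0 : ℝ) < |(n : ℝ)| := abs_pos.2 (by exact_mod_cast h0)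
  rw [Real.norm_of_nonneg (by positivity), inv_pow, one_div, ← sq_abs (n : ℝ)]
  gcongr
  linarith

/-- The exponential factors are submultiplicative, and `1+|n| ≤ A+B` bounds the quotient of the
polynomial factors by `(A⁻¹+B⁻¹)^s`. For `s ≥ 1` the square of this is summable in `m`, uniformly in
`n`. -/
lemma wt_ker_le {s : ℕ} (hs : 1 ≤ s) {ρ : ℝ} (hρ : 1 < ρ) (n m : ℤ) :
    (wt s ρ n / (wt s ρ m * wt s ρ (n - m))) ^ 2 ≤
      4 ^ s * (((1 + |(m : ℝ)|)⁻¹) ^ 2 + ((1 + |((n - m : ℤ) : ℝ)|)⁻¹) ^ 2) := by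
  set A := 1 + |(m : ℝ)| with hA
  set B := 1 + |((n - m : ℤ) : ℝ)| with hB
  have hA1 : 1 ≤ A := by simp [hA]
  have hB1 : 1 ≤ B := by simp [hB]
  have hn : 1 + |(n : ℝ)| ≤ A + B := by
    have : (n : ℝ) = m + ((n - m : ℤ) : ℝ) := by push_cast; ring
    have h := abs_add_le (m : ℝ) ((n - m : ℤ) : ℝ)
    rw [← this] at h
    linarith
  have hρn : ρ ^ n.natAbs ≤ ρ ^ m.natAbs * ρ ^ (n - m).natAbs := by
    rw [← pow_add]
    exact pow_le_pow_right₀ hρ.le (by omega)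
  have hρ1 : 0 < ρ ^ m.natAbs * ρ ^ (n - m).natAbs := by positivity
  have h1 : wt s ρ n / (wt s ρ m * wt s ρ (n - m)) ≤ ((A + B) / (A * B)) ^ s := by
    rw [div_le_iff₀ (mul_pos (wt_pos s hρ m) (wt_pos s hρ _))]
    have e : ((A + B) / (A * B)) ^ s * (wt s ρ m * wt s ρ (n - m)) =
        (A + B) ^ s * (ρ ^ m.natAbs * ρ ^ (n - m).natAbs) := by
      simp only [wt, ← hA, ← hB, div_pow, mul_pow]
      field_simp
    rw [e, wt]
    gcongr
  have h2 : (A + B) / (A * B) = A⁻¹ + B⁻¹ := by field_simp; ring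
  have hAi : A⁻¹ ≤ 1 := inv_le_one_of_one_le₀ hA1
  have hBi : B⁻¹ ≤ 1 := inv_le_one_of_one_le₀ hB1
  have hAp : 0 < A⁻¹ := by positivity
  have hBp : 0 < B⁻¹ := by positivity
  have h0 : 0 ≤ wt s ρ n / (wt s ρ m * wt s ρ (n - m)) :=
    (div_pos (wt_pos s hρ n) (mul_pos (wt_pos s hρ m) (wt_pos s hρ _))).le
  rw [h2] at h1
  -- One factor `(A⁻¹+B⁻¹)²` is kept for summability; the other `t` are at most `4` because `A⁻¹`
  -- and `B⁻¹` are at most `1`.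
  obtain ⟨t, rfl⟩ : ∃ t, s = t + 1 := ⟨s - 1, by omega⟩
  calc _ ≤ ((A⁻¹ + B⁻¹) ^ (t + 1)) ^ 2 := pow_le_pow_left₀ h0 h1 2
    _ = ((A⁻¹ + B⁻¹) ^ 2) ^ t * (A⁻¹ + B⁻¹) ^ 2 := by
        rw [← pow_mul, ← pow_mul, ← pow_add]; congr 1; ring
    _ ≤ 4 ^ t * (4 * (A⁻¹ ^ 2 + B⁻¹ ^ 2)) := by
        gcongr
        · nlinarith
        · nlinarith [sq_nonneg (A⁻¹ - B⁻¹)]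
    _ = _ := by ring

/-- The weighted algebra with weight `(1+|n|)^s ρ^|n|`. -/
def sobolev {s : ℕ} (hs : 1 ≤ s) {ρ : ℝ} (hρ : 1 < ρ) : ConvWeight where
  w := wt s ρ
  pos := wt_pos s hρ
  summable_inv := by
    refine Summable.of_nonneg_of_le (fun _ => sq_nonneg _) (fun n => ?_) summable_inv_sq_int
    have h1 : 1 + |(n : ℝ)| ≤ wt s ρ n := by
      have h2 : 1 ≤ 1 + |(n : ℝ)| := by simp
      calc 1 + |(n : ℝ)| ≤ (1 + |(n : ℝ)|) ^ s * 1 := by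
            rw [mul_one]; exact le_self_pow₀ h2 (by omega)
        _ ≤ _ := by
            unfold wt
            gcongr
            exact one_le_pow₀ hρ.le
    have h3 := (inv_pos.2 (wt_pos s hρ n)).le
    gcongr
  K := √(4 ^ s * ((∑' n : ℤ, ((1 + |(n : ℝ)|)⁻¹) ^ 2) + ∑' n : ℤ, ((1 + |(n : ℝ)|)⁻¹) ^ 2))
  K_nonneg := Real.sqrt_nonneg _
  summable_ker n := by
    refine Summable.of_nonneg_of_le (fun _ => sq_nonneg _) (wt_ker_le hs hρ n) ?_
    exact (summable_inv_sq_int.add ((Equiv.subLeft n).summable_iff.2 summable_inv_sq_int)).mul_left _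
  tsum_ker n := by
    have h1 := (Equiv.subLeft n).summable_iff.2 summable_inv_sq_int
    have h2 := (summable_inv_sq_int.add h1).mul_left (4 ^ s : ℝ)
    have h3 := (Summable.of_nonneg_of_le (fun _ => sq_nonneg _) (wt_ker_le hs hρ n) h2).tsum_le_tsum
      (wt_ker_le hs hρ n) h2
    rw [Real.sq_sqrt (mul_nonneg (by positivity) (add_nonneg (tsum_nonneg fun _ => sq_nonneg _)
      (tsum_nonneg fun _ => sq_nonneg _)))]
    refine h3.trans_eq ?_
    rw [tsum_mul_left]
    refine congrArg _ ((summable_inv_sq_int.tsum_add h1).trans ?_)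
    congr 1
    exact (Equiv.subLeft n).tsum_eq fun m : ℤ => ((1 + |(m : ℝ)|)⁻¹) ^ 2

lemma wt_add_le (s : ℕ) {ρ : ℝ} (hρ : 1 < ρ) (n m : ℤ) :
    wt s ρ (n + m) ≤ wt s ρ n * wt s ρ m := by
  have h1 : 1 + |((n + m : ℤ) : ℝ)| ≤ (1 + |(n : ℝ)|) * (1 + |(m : ℝ)|) := by
    push_cast
    nlinarith [abs_add_le (n : ℝ) m, abs_nonneg (n : ℝ), abs_nonneg (m : ℝ),
      mul_nonneg (abs_nonneg (n : ℝ)) (abs_nonneg (m : ℝ))]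
  have h2 : ρ ^ (n + m).natAbs ≤ ρ ^ n.natAbs * ρ ^ m.natAbs := by
    rw [← pow_add]
    exact pow_le_pow_right₀ hρ.le (by omega)
  calc _ ≤ ((1 + |(n : ℝ)|) * (1 + |(m : ℝ)|)) ^ s * (ρ ^ n.natAbs * ρ ^ m.natAbs) := by
        unfold wt; gcongr
    _ = _ := by rw [mul_pow]; unfold wt; ring

lemma wt_neg (s : ℕ) (ρ : ℝ) (n : ℤ) : wt s ρ (-n) = wt s ρ n := by simp [wt]

/-- The weight of the space of conformal maps. -/
def vt (s : ℕ) (ρ : ℝ) (n : ℤ) : ℝ :=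
  (1 + |(n : ℝ)|) * (1 + Real.log (1 + |(n : ℝ)|)) * wt s ρ n

lemma log_one_add_abs_nonneg (n : ℤ) : 0 ≤ Real.log (1 + |(n : ℝ)|) := Real.log_nonneg (by simp)

lemma vt_pos (s : ℕ) {ρ : ℝ} (hρ : 1 < ρ) (n : ℤ) : 0 < vt s ρ n := by
  have h1 := log_one_add_abs_nonneg n
  have h2 := wt_pos s hρ n
  unfold vt
  positivity

/-! ### The unit circle -/

/-- The point `e^{iθ}`. -/
abbrev cs (θ : ℝ) : ℂ := circleMap 0 1 θ

lemma cs_eq (θ : ℝ) : cs θ = exp (θ * I) := by simp [circleMap]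

lemma cs_ne_zero (θ : ℝ) : cs θ ≠ 0 := by simp [cs_eq]

lemma cs_zpow (θ : ℝ) (n : ℤ) : cs θ ^ n = exp (n * θ * I) := by
  rw [cs_eq, ← Complex.exp_int_mul]; ring_nf

lemma norm_cs_zpow (θ : ℝ) (n : ℤ) : ‖cs θ ^ n‖ = 1 := by
  rw [norm_zpow, norm_cm, one_zpow]

lemma conj_cs (θ : ℝ) : conj (cs θ) = (cs θ)⁻¹ := by
  rw [Complex.inv_def, Complex.normSq_eq_norm_sq, norm_cm]; simp

lemma continuous_cs : Continuous cs := continuous_circleMap 0 1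

lemma continuous_cs_zpow (n : ℤ) : Continuous fun θ => cs θ ^ n :=
  continuous_cs.zpow₀ n fun θ => Or.inl (cs_ne_zero θ)

lemma hasDerivAt_cs_zpow (n : ℤ) (θ : ℝ) :
    HasDerivAt (fun θ => cs θ ^ n) (n * I * cs θ ^ n) θ := by
  have h1 : HasDerivAt (fun θ : ℝ => (n * I : ℂ) * θ) (n * I) θ := by
    simpa using (hasDerivAt_id θ).ofReal_comp.const_mul (n * I : ℂ)
  have h2 := h1.cexp
  have e : (fun θ => cs θ ^ n) = fun θ : ℝ => exp (n * I * θ) := by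
    funext t; rw [cs_zpow]; ring_nf
  rw [e]
  convert h2 using 1
  rw [cs_zpow]; ring_nf

lemma cs_sub_one (θ : ℝ) : cs θ - 1 = 2 * Real.sin (θ / 2) * (I * exp (θ / 2 * I)) := by
  have h1 : cs θ = exp (θ / 2 * I) * exp (θ / 2 * I) := by
    rw [cs_eq, ← Complex.exp_add]; ring_nf
  have h2 : exp (-(θ / 2 * I)) * exp (θ / 2 * I) = 1 := by rw [← Complex.exp_add]; simp
  push_cast
  rw [Complex.sin, h1]
  have e : -((θ : ℂ) / 2) * I = -(θ / 2 * I) := by ring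
  rw [e]
  linear_combination h2 - (exp (-(θ / 2 * I)) - exp (θ / 2 * I)) * exp (θ / 2 * I) * I_mul_I

lemma norm_cs_sub_one {θ : ℝ} (h : θ ∈ Icc 0 (2 * π)) : ‖cs θ - 1‖ = 2 * Real.sin (θ / 2) := by
  have h0 : 0 ≤ Real.sin (θ / 2) :=
    Real.sin_nonneg_of_nonneg_of_le_pi (by linarith [h.1]) (by linarith [h.2])
  have h1 : ‖exp (θ / 2 * I)‖ = 1 := by
    have := Complex.norm_exp_ofReal_mul_I (θ / 2); push_cast at this; exact this
  rw [cs_sub_one, norm_mul, norm_mul, norm_mul, h1, Complex.norm_real, Real.norm_of_nonneg h0]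
  simp

lemma norm_cs_sub_one_pos {θ : ℝ} (h : θ ∈ Ioo 0 (2 * π)) : 0 < ‖cs θ - 1‖ := by
  rw [norm_cs_sub_one (Ioo_subset_Icc_self h)]
  have := Real.sin_pos_of_pos_of_lt_pi (x := θ / 2) (by linarith [h.1]) (by linarith [h.2])
  linarith

lemma norm_zpow_sub_one_le (θ : ℝ) (n : ℤ) : ‖cs θ ^ n - 1‖ ≤ |(n : ℝ)| * ‖cs θ - 1‖ := by
  have nat : ∀ m : ℕ, ‖cs θ ^ m - 1‖ ≤ m * ‖cs θ - 1‖ := by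
    intro m
    rw [← geom_sum_mul, norm_mul]
    gcongr
    refine (norm_sum_le _ _).trans ?_
    simp
  obtain ⟨m, rfl | rfl⟩ := n.eq_nat_or_neg
  · simpa using nat m
  · have e : cs θ ^ (-(m : ℤ)) - 1 = -(cs θ ^ (-(m : ℤ))) * (cs θ ^ m - 1) := by
      have := pow_ne_zero m (cs_ne_zero θ)
      rw [zpow_neg, zpow_natCast]; field_simp; ring
    rw [e, norm_mul, norm_neg, norm_cs_zpow, one_mul]
    simpa using nat m

/-! ### The logarithmic kernel -/

/-- The integrand of the logarithmic multiplier. -/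
def singKer (n : ℤ) (θ : ℝ) : ℂ := (cs θ ^ n - 1) / (‖cs θ - 1‖ : ℂ)

lemma norm_singKer_le (n : ℤ) (θ : ℝ) : ‖singKer n θ‖ ≤ |(n : ℝ)| := by
  rw [singKer, norm_div, Complex.norm_real, norm_norm]
  exact div_le_of_le_mul₀ (norm_nonneg _) (abs_nonneg _) (norm_zpow_sub_one_le θ n)

lemma measurable_singKer (n : ℤ) : Measurable (singKer n) :=
  ((continuous_cs_zpow n).sub continuous_const).measurable.div
    (Complex.continuous_ofReal.comp (continuous_cs.sub continuous_const).norm).measurable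

lemma intervalIntegrable_of_norm_le {f : ℝ → ℂ} (hf : Measurable f) {C : ℝ} (h : ∀ θ, ‖f θ‖ ≤ C)
    (x y : ℝ) : IntervalIntegrable f volume x y := by
  rw [intervalIntegrable_iff]
  exact Measure.integrableOn_of_bounded (M := C) measure_Ioc_lt_top.ne hf.aestronglyMeasurable
    (Eventually.of_forall h)

lemma intervalIntegrable_singKer (n : ℤ) (x y : ℝ) : IntervalIntegrable (singKer n) volume x y :=
  intervalIntegrable_of_norm_le (measurable_singKer n) (norm_singKer_le n) x y

/-- The multiplier `∫_0^{2π} (e^{inθ} - 1) / |e^{iθ} - 1| dθ`. -/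
def sing (n : ℤ) : ℂ := ∫ θ in (0 : ℝ)..2 * π, singKer n θ

lemma sing_zero : sing 0 = 0 := by simp [sing, singKer]

lemma integral_congr_Ioo {f g : ℝ → ℂ} {x y : ℝ} (hxy : x ≤ y) (h : ∀ θ ∈ Ioo x y, f θ = g θ) :
    ∫ θ in x..y, f θ = ∫ θ in x..y, g θ := by
  rw [intervalIntegral.integral_of_le hxy, intervalIntegral.integral_of_le hxy,
    integral_Ioc_eq_integral_Ioo, integral_Ioc_eq_integral_Ioo]
  exact setIntegral_congr_fun measurableSet_Ioo h

/-- Since `σ - 1 = 2 sin(θ/2) · i e^(iθ/2)`, the difference of consecutive integrands is exactly `i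
e^(i(n+1/2)θ)`. The singular denominator disappears and the integral is elementary. -/
lemma sing_succ (n : ℤ) : sing (n + 1) - sing n = -4 / (2 * n + 1) := by
  have hn : (2 * n + 1 : ℂ) ≠ 0 := by
    have : (2 * n + 1 : ℤ) ≠ 0 := by omega
    exact_mod_cast this
  rw [sing, sing, ← intervalIntegral.integral_sub (intervalIntegrable_singKer _ _ _)
    (intervalIntegrable_singKer _ _ _)]
  set a : ℂ := (n + 1 / 2) * I with ha
  have ha0 : a ≠ 0 := by
    rw [ha]
    refine mul_ne_zero (fun h => hn ?_) I_ne_zero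
    linear_combination 2 * h
  have e : ∀ θ ∈ Ioo (0 : ℝ) (2 * π), singKer (n + 1) θ - singKer n θ = I * exp (a * θ) := by
    intro θ hθ
    have h1 := norm_cs_sub_one_pos hθ
    have h2 : (‖cs θ - 1‖ : ℂ) ≠ 0 := by exact_mod_cast h1.ne'
    have h3 : cs θ - 1 = ‖cs θ - 1‖ * (I * exp (θ / 2 * I)) := by
      rw [norm_cs_sub_one (Ioo_subset_Icc_self hθ)]
      push_cast
      have := cs_sub_one θ
      push_cast at this
      exact this
    have h4 : singKer (n + 1) θ - singKer n θ = cs θ ^ n * (cs θ - 1) / ‖cs θ - 1‖ := by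
      rw [singKer, singKer, zpow_add_one₀ (cs_ne_zero θ)]; ring
    have h5 : (cs θ - 1) / ‖cs θ - 1‖ = I * exp (θ / 2 * I) := by
      rw [div_eq_iff h2, mul_comm]
      exact h3
    rw [h4, mul_div_assoc, h5, cs_zpow, ha, mul_left_comm, ← Complex.exp_add]
    ring_nf
  rw [integral_congr_Ioo (by positivity) e, intervalIntegral.integral_const_mul,
    integral_exp_mul_complex ha0]
  have e1 : exp (a * ((2 * π : ℝ) : ℂ)) = -1 := by
    have : a * ((2 * π : ℝ) : ℂ) = n * (2 * π * I) + π * I := by rw [ha]; push_cast; ring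
    rw [this, Complex.exp_add, Complex.exp_int_mul_two_pi_mul_I, Complex.exp_pi_mul_I, one_mul]
  rw [e1, ha]
  simp only [Complex.ofReal_zero, mul_zero, Complex.exp_zero]
  have h5 : (n + 1 / 2 : ℂ) ≠ 0 := fun h => hn (by linear_combination 2 * h)
  field_simp
  ring

/-- `4 ∑_{j<n} 1/(2j+1)`. -/
def lam (n : ℕ) : ℝ := 4 * ∑ j ∈ Finset.range n, 1 / (2 * (j : ℝ) + 1)

lemma sing_natCast (n : ℕ) : sing n = -(lam n : ℂ) := by
  induction n with
  | zero => simp [lam, sing_zero]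
  | succ n ih =>
    have h := sing_succ n
    push_cast at h ⊢
    rw [sub_eq_iff_eq_add.1 h, ih, lam, lam, Finset.sum_range_succ]
    push_cast
    ring

lemma sing_neg_natCast (n : ℕ) : sing (-n) = -(lam n : ℂ) := by
  induction n with
  | zero => simp [lam, sing_zero]
  | succ n ih =>
    have h := sing_succ (-(n + 1 : ℕ))
    have e : (-((n + 1 : ℕ) : ℤ) + 1) = -n := by push_cast; ring
    rw [e, ih] at h
    have h2 : (2 * n + 1 : ℂ) ≠ 0 := by exact_mod_cast (by omega : (2 * n + 1 : ℕ) ≠ 0)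
    have h3 : (2 * ((-((n + 1 : ℕ) : ℤ) : ℤ) : ℂ) + 1) = -(2 * n + 1) := by push_cast; ring
    rw [h3, neg_div_neg_eq] at h
    rw [lam, Finset.sum_range_succ]
    rw [lam] at h
    push_cast at h ⊢
    linear_combination -h

/-- Compares `4/(2j+1)` with `2/(j+1)` and uses the harmonic sum. This lower bound recovers the
logarithmic weight from the norm of `X`. -/
lemma two_log_le_lam (n : ℕ) : 2 * Real.log (n + 1) ≤ lam n := by
  have h := log_add_one_le_harmonic n
  rw [harmonic] at h
  push_cast at h
  have h2 : ∑ j ∈ Finset.range n, ((j : ℝ) + 1)⁻¹ ≤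
      ∑ j ∈ Finset.range n, 2 * (1 / (2 * (j : ℝ) + 1)) := by
    refine Finset.sum_le_sum fun j _ => ?_
    rw [inv_eq_one_div, mul_one_div, div_le_div_iff₀ (by positivity) (by positivity)]
    linarith
  rw [← Finset.mul_sum] at h2
  rw [lam]
  linarith

/-- Away from the endpoints of the period the numerator is at most `2` and the denominator is
comparable to the distance to the nearer endpoint; near them the bound `|n|` takes over. Each
summand is a smooth version of the minimum of the two bounds at one endpoint, with an elementary
integral. -/
lemma norm_singKer_le_add (n : ℤ) {θ : ℝ} (hθ : θ ∈ Ioo 0 (2 * π)) :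
    ‖singKer n θ‖ ≤ 2 * π * (|(n : ℝ)| / (1 + |(n : ℝ)| * θ)) +
      2 * π * (|(n : ℝ)| / (1 + |(n : ℝ)| * (2 * π - θ))) := by
  set N := |(n : ℝ)| with hN
  have hN0 : 0 ≤ N := abs_nonneg _
  have hg := norm_singKer_le n θ
  have hpi := Real.pi_gt_three
  have hs := norm_cs_sub_one_pos hθ
  have h2 : ‖singKer n θ‖ * ‖cs θ - 1‖ ≤ 2 := by
    rw [singKer, norm_div, Complex.norm_real, norm_norm, div_mul_cancel₀ _ hs.ne']
    refine (norm_sub_le _ _).trans ?_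
    rw [norm_cs_zpow]; norm_num
  rw [norm_cs_sub_one (Ioo_subset_Icc_self hθ)] at h2
  -- Here `t` is the distance to the nearer endpoint. Jordan's inequality gives `‖singKer n θ‖ t ≤
  -- π`; multiplied by `N` and added to `‖singKer n θ‖ ≤ N` this gives `N(1+π) ≤ 2πN`.
  have key : ∀ t : ℝ, 0 < t → t ≤ π → Real.sin (t / 2) = Real.sin (θ / 2) →
      ‖singKer n θ‖ ≤ 2 * π * (N / (1 + N * t)) := by
    intro t ht0 ht1 hts
    have h3 := Real.mul_le_sin (x := t / 2) (by linarith) (by linarith)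
    rw [hts] at h3
    have h3' : t ≤ π * Real.sin (θ / 2) := by
      have : 2 / π * (t / 2) = t / π := by field_simp
      rw [this, div_le_iff₀ Real.pi_pos] at h3
      linarith
    have h4 : ‖singKer n θ‖ * t ≤ π := by
      calc _ ≤ ‖singKer n θ‖ * (π * Real.sin (θ / 2)) := by gcongr
        _ = π * (‖singKer n θ‖ * (2 * Real.sin (θ / 2))) / 2 := by ring
        _ ≤ π * 2 / 2 := by gcongr
        _ = π := by ring
    rw [← mul_div_assoc, le_div_iff₀ (by positivity)]
    nlinarith [mul_le_mul_of_nonneg_left h4 hN0]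
  have hpos1 : 0 ≤ 2 * π * (N / (1 + N * θ)) := by
    have := hθ.1; positivity
  have hpos2 : 0 ≤ 2 * π * (N / (1 + N * (2 * π - θ))) := by
    have : 0 < 2 * π - θ := by linarith [hθ.2]
    positivity
  rcases le_total θ π with h | h
  · have := key θ hθ.1 h rfl
    linarith
  · have := key (2 * π - θ) (by linarith [hθ.2]) (by linarith) (by
      rw [← Real.sin_pi_sub (θ / 2)]; congr 1; ring)
    linarith

lemma integral_log_bound {N : ℝ} (hN : 0 ≤ N) :
    ∫ θ in (0 : ℝ)..2 * π, N / (1 + N * θ) = Real.log (1 + N * (2 * π)) := by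
  have hpos : ∀ θ ∈ uIcc (0 : ℝ) (2 * π), 0 < 1 + N * θ := fun θ hθ => by
    rw [uIcc_of_le (by positivity)] at hθ
    have := mul_nonneg hN hθ.1
    linarith
  have h := intervalIntegral.integral_eq_sub_of_hasDerivAt (a := (0 : ℝ)) (b := 2 * π)
    (f := fun θ => Real.log (1 + N * θ)) (f' := fun θ => N / (1 + N * θ)) (fun θ hθ => by
      have h1 : HasDerivAt (fun θ : ℝ => 1 + N * θ) N θ := by
        simpa using ((hasDerivAt_id θ).const_mul N).const_add 1
      exact h1.log (hpos θ hθ).ne') (by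
      refine ContinuousOn.intervalIntegrable ?_
      exact continuousOn_const.div (by fun_prop) fun θ hθ => (hpos θ hθ).ne')
  rw [h]; simp

/-- Like the Lebesgue constants of Fourier series, the `L¹` norm grows only logarithmically although
the supremum grows linearly. This is why a loss of one derivative and a logarithm is enough for `S`.
-/
lemma integral_norm_singKer_le (n : ℤ) :
    ∫ θ in (0 : ℝ)..2 * π, ‖singKer n θ‖ ≤ 100 * (1 + Real.log (1 + |(n : ℝ)|)) := by
  set N := |(n : ℝ)| with hN
  have hN0 : 0 ≤ N := abs_nonneg _
  have hpos : ∀ θ ∈ uIcc (0 : ℝ) (2 * π), 0 < 1 + N * θ := fun θ hθ => by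
    rw [uIcc_of_le (by positivity)] at hθ
    have := mul_nonneg hN0 hθ.1
    linarith
  have hi : IntervalIntegrable (fun θ => N / (1 + N * θ)) volume 0 (2 * π) :=
    ContinuousOn.intervalIntegrable
      (continuousOn_const.div (by fun_prop) fun θ hθ => (hpos θ hθ).ne')
  have hi2 : IntervalIntegrable (fun θ => N / (1 + N * (2 * π - θ))) volume 0 (2 * π) := by
    refine ContinuousOn.intervalIntegrable
      (continuousOn_const.div (by fun_prop) fun θ hθ => (hpos _ ?_).ne')
    rw [uIcc_of_le (by positivity)] at hθ ⊢
    exact ⟨by linarith [hθ.2], by linarith [hθ.1]⟩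
  have e2 : ∫ θ in (0 : ℝ)..2 * π, N / (1 + N * (2 * π - θ)) = Real.log (1 + N * (2 * π)) := by
    rw [intervalIntegral.integral_comp_sub_left (fun θ => N / (1 + N * θ)), sub_self, sub_zero,
      integral_log_bound hN0]
  have h : ∫ θ in (0 : ℝ)..2 * π, ‖singKer n θ‖ ≤ ∫ θ in (0 : ℝ)..2 * π,
      (2 * π * (N / (1 + N * θ)) + 2 * π * (N / (1 + N * (2 * π - θ)))) := by
    refine intervalIntegral.integral_mono_on_of_le_Ioo (by positivity)
      (intervalIntegrable_singKer n _ _).norm ((hi.const_mul _).add (hi2.const_mul _))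
      fun θ hθ => norm_singKer_le_add n hθ
  rw [intervalIntegral.integral_add (hi.const_mul _) (hi2.const_mul _),
    intervalIntegral.integral_const_mul, intervalIntegral.integral_const_mul, e2,
    integral_log_bound hN0] at h
  have h3 : Real.log (1 + N * (2 * π)) ≤ 2 + Real.log (1 + N) := by
    have h4 : 1 + N * (2 * π) ≤ 7 * (1 + N) := by nlinarith [Real.pi_lt_d2]
    have h5 : Real.log 7 ≤ 2 := by
      rw [Real.log_le_iff_le_exp (by norm_num)]
      have := Real.exp_one_gt_d9
      have e : Real.exp 2 = Real.exp 1 * Real.exp 1 := by rw [← Real.exp_add]; norm_num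
      rw [e]; nlinarith
    calc _ ≤ Real.log (7 * (1 + N)) := Real.log_le_log (by positivity) h4
      _ = Real.log 7 + Real.log (1 + N) := Real.log_mul (by norm_num) (by positivity)
      _ ≤ _ := by linarith
  have h6 : 0 ≤ Real.log (1 + N) := Real.log_nonneg (by linarith)
  nlinarith [Real.pi_lt_d2, Real.pi_pos]

/-! ### The regular kernel -/

section Regular

variable {b : ℝ}

lemma sq_norm_cs_sub (b θ : ℝ) : ‖cs θ - b‖ ^ 2 = 1 + b ^ 2 - 2 * b * Real.cos θ := by
  rw [← Complex.normSq_eq_norm_sq, cs_eq, Complex.exp_mul_I, Complex.normSq_apply]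
  simp [← Complex.ofReal_cos, ← Complex.ofReal_sin]
  nlinarith [Real.sin_sq_add_cos_sq θ]

lemma one_sub_le_norm (hb : b ∈ Ioo (0 : ℝ) 1) (θ : ℝ) : 1 - b ≤ ‖cs θ - b‖ := by
  have h := norm_sub_norm_le (cs θ) b
  rw [norm_cm, Complex.norm_real, Real.norm_of_nonneg hb.1.le] at h
  exact h

lemma norm_cs_sub_pos (hb : b ∈ Ioo (0 : ℝ) 1) (θ : ℝ) : 0 < ‖cs θ - b‖ :=
  (sub_pos.2 hb.2).trans_le (one_sub_le_norm hb θ)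

lemma norm_mul_cs_sub_one (b θ : ℝ) : ‖b * cs θ - 1‖ = ‖cs θ - b‖ := by
  have h : b * cs θ - 1 = -(cs θ * conj (cs θ - b)) := by
    rw [map_sub, conj_cs, Complex.conj_ofReal, mul_sub, mul_inv_cancel₀ (cs_ne_zero θ),
      neg_sub, mul_comm]
  rw [h, norm_neg, norm_mul, norm_cm, one_mul, Complex.norm_conj]

lemma sq_norm_cs_sub' (b θ : ℝ) : (‖cs θ - b‖ : ℂ) ^ 2 = (cs θ - b) * ((cs θ)⁻¹ - b) := by
  have h := Complex.mul_conj (cs θ - b)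
  rw [Complex.normSq_eq_norm_sq, map_sub, conj_cs, Complex.conj_ofReal] at h
  rw [h]; push_cast; rfl

lemma continuous_norm_cs_sub (b : ℝ) : Continuous fun θ => ‖cs θ - b‖ :=
  (continuous_cs.sub continuous_const).norm

/-- The Fourier coefficients of `1 / |e^{iθ} - b|`. -/
def Bn (b : ℝ) (n : ℤ) : ℂ := (2 * π : ℂ)⁻¹ * ∫ θ in (0 : ℝ)..2 * π, cs θ ^ n / ‖cs θ - b‖

lemma continuous_Bn_integrand (hb : b ∈ Ioo (0 : ℝ) 1) (n : ℤ) :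
    Continuous fun θ => cs θ ^ n / (‖cs θ - b‖ : ℂ) :=
  (continuous_cs_zpow n).div (Complex.continuous_ofReal.comp (continuous_norm_cs_sub b))
    fun θ => by exact_mod_cast (norm_cs_sub_pos hb θ).ne'

lemma hasDerivAt_norm_cs_sub (hb : b ∈ Ioo (0 : ℝ) 1) (θ : ℝ) :
    HasDerivAt (fun θ => ‖cs θ - b‖) (b * Real.sin θ / ‖cs θ - b‖) θ := by
  have h1 : HasDerivAt (fun θ => 1 + b ^ 2 - 2 * b * Real.cos θ) (2 * b * Real.sin θ) θ := by
    have := ((Real.hasDerivAt_cos θ).const_mul (2 * b)).const_sub (1 + b ^ 2)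
    refine this.congr_deriv ?_
    ring
  have hp := norm_cs_sub_pos hb θ
  have h0 : 1 + b ^ 2 - 2 * b * Real.cos θ ≠ 0 := by
    rw [← sq_norm_cs_sub]; positivity
  have h2 := h1.sqrt h0
  have e : (fun θ => ‖cs θ - b‖) = fun θ => √(1 + b ^ 2 - 2 * b * Real.cos θ) := by
    funext t
    rw [← sq_norm_cs_sub, Real.sqrt_sq (norm_nonneg _)]
  rw [e]
  convert h2 using 1
  rw [← sq_norm_cs_sub, Real.sqrt_sq (norm_nonneg _)]
  field_simp

lemma continuous_div_cube (hb : b ∈ Ioo (0 : ℝ) 1) {f : ℝ → ℂ} (hf : Continuous f) :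
    Continuous fun θ => f θ / (‖cs θ - b‖ : ℂ) ^ 3 :=
  hf.div ((Complex.continuous_ofReal.comp (continuous_norm_cs_sub b)).pow 3)
    fun θ => pow_ne_zero 3 (by exact_mod_cast (norm_cs_sub_pos hb θ).ne')

/-- The function `σ^n/|σ-b|` is periodic, so its derivative has integral zero. The derivative of
`|σ-b|` is `b sin θ/|σ-b|`, with `sin θ` written in terms of `σ`. -/
lemma Bn_ibp (hb : b ∈ Ioo (0 : ℝ) 1) (n : ℤ) :
    n * Bn b n = (2 * π : ℂ)⁻¹ * ∫ θ in (0 : ℝ)..2 * π,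
      (-(b / 2) * cs θ ^ n * (cs θ - (cs θ)⁻¹)) / (‖cs θ - b‖ : ℂ) ^ 3 := by
  have hc : Continuous fun θ => (cs θ)⁻¹ := continuous_cs.inv₀ cs_ne_zero
  have hd : ∀ θ : ℝ, HasDerivAt (fun θ => cs θ ^ n * (‖cs θ - b‖ : ℂ)⁻¹)
      (I * (n * (cs θ ^ n / ‖cs θ - b‖) -
        (-(b / 2) * cs θ ^ n * (cs θ - (cs θ)⁻¹)) / (‖cs θ - b‖ : ℂ) ^ 3)) θ := by
    intro θ
    have hp : (‖cs θ - b‖ : ℂ) ≠ 0 := by exact_mod_cast (norm_cs_sub_pos hb θ).ne'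
    have h := (hasDerivAt_cs_zpow n θ).mul
      (((hasDerivAt_norm_cs_sub hb θ).ofReal_comp).fun_inv hp)
    refine h.congr_deriv ?_
    have hs : (Real.sin θ : ℂ) = (cs θ - (cs θ)⁻¹) / (2 * I) := by
      rw [cs_eq, ← Complex.exp_neg, Complex.ofReal_sin, Complex.sin]
      have e : -(θ : ℂ) * I = -(θ * I) := by ring
      rw [e]
      field_simp
      linear_combination (exp (-(θ * I)) - exp (θ * I)) * I_sq
    push_cast at hs ⊢
    rw [hs]
    have h2 := cs_ne_zero θ
    generalize (‖cs θ - b‖ : ℂ) = r at hp ⊢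
    generalize cs θ = z at h2 ⊢
    field_simp
    linear_combination (-(b : ℂ) * (z ^ 2 - 1)) * I_sq
  have hi1 : Continuous fun θ => (n : ℂ) * (cs θ ^ n / (‖cs θ - b‖ : ℂ)) :=
    continuous_const.mul (continuous_Bn_integrand hb n)
  have hi2 : Continuous fun θ =>
      (-(b / 2 : ℂ) * cs θ ^ n * (cs θ - (cs θ)⁻¹)) / (‖cs θ - b‖ : ℂ) ^ 3 :=
    continuous_div_cube hb ((continuous_const.mul (continuous_cs_zpow n)).mul
      (continuous_cs.sub hc))
  have h := intervalIntegral.integral_eq_sub_of_hasDerivAt (a := (0 : ℝ)) (b := 2 * π)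
    (fun θ _ => hd θ)
    ((continuous_const.mul (hi1.sub hi2)).intervalIntegrable _ _)
  have hper : cs (2 * π) = cs 0 := by simp [circleMap]
  rw [hper, sub_self, intervalIntegral.integral_const_mul, intervalIntegral.integral_sub
    (hi1.intervalIntegrable _ _) (hi2.intervalIntegrable _ _),
    intervalIntegral.integral_const_mul] at h
  have h3 := (mul_eq_zero.1 h).resolve_left I_ne_zero
  rw [Bn]
  linear_combination (2 * π : ℂ)⁻¹ * h3

/-- The substitution `θ ↦ 2π - θ` conjugates `σ` and preserves `|σ-b|`, as `b` is real. -/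
lemma Bn_neg (b : ℝ) (n : ℤ) : Bn b (-n) = Bn b n := by
  have h := intervalIntegral.integral_comp_sub_left (a := 0) (b := 2 * π)
    (fun θ => cs θ ^ n / (‖cs θ - b‖ : ℂ)) (2 * π)
  rw [sub_self, sub_zero] at h
  rw [Bn, Bn, ← h]
  congr 1
  refine intervalIntegral.integral_congr fun θ _ => ?_
  have e : cs (2 * π - θ) = (cs θ)⁻¹ := by
    rw [cs_eq, cs_eq, ← Complex.exp_neg]
    have : ((2 * π - θ : ℝ) : ℂ) * I = -(θ * I) + 2 * π * I := by push_cast; ring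
    rw [this, Complex.exp_periodic]
  simp only [e]
  rw [inv_zpow', ← conj_cs, ← Complex.conj_ofReal b, ← map_sub, Complex.norm_conj,
    Complex.conj_ofReal]

lemma integral_lincomb {f g h : ℝ → ℂ} (hf : Continuous f) (hg : Continuous g)
    (hh : Continuous h) (c₁ c₂ c₃ : ℂ) (x y : ℝ) :
    c₁ * (∫ θ in x..y, f θ) + c₂ * (∫ θ in x..y, g θ) - c₃ * (∫ θ in x..y, h θ) =
      ∫ θ in x..y, (c₁ * f θ + c₂ * g θ - c₃ * h θ) := by
  rw [intervalIntegral.integral_sub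
      ((by fun_prop : Continuous fun θ => c₁ * f θ + c₂ * g θ).intervalIntegrable _ _)
      ((by fun_prop : Continuous fun θ => c₃ * h θ).intervalIntegrable _ _),
    intervalIntegral.integral_add
      ((by fun_prop : Continuous fun θ => c₁ * f θ).intervalIntegrable _ _)
      ((by fun_prop : Continuous fun θ => c₂ * g θ).intervalIntegrable _ _)]
  simp only [intervalIntegral.integral_const_mul]

/-- `(1/2π) ∫ e^{inθ} (b e^{iθ} - 1)² / |e^{iθ} - b|³ dθ`. -/
lemma integral_Cn (hb : b ∈ Ioo (0 : ℝ) 1) (n : ℤ) :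
    (2 * π : ℂ)⁻¹ * ∫ θ in (0 : ℝ)..2 * π,
      (cs θ ^ n * (b * cs θ - 1) ^ 2) / (‖cs θ - b‖ : ℂ) ^ 3 =
      (2 * n + 1) * Bn b n - 2 * (n + 1) * b * Bn b (n + 1) := by
  have hc : Continuous fun θ => (cs θ)⁻¹ := continuous_cs.inv₀ cs_ne_zero
  have h1 := Bn_ibp hb n
  have h2 := Bn_ibp hb (n + 1)
  have i1 : Continuous fun θ => cs θ ^ n / (‖cs θ - b‖ : ℂ) := continuous_Bn_integrand hb n
  have i2 : ∀ m : ℤ, Continuous fun θ =>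
      (-(b / 2 : ℂ) * cs θ ^ m * (cs θ - (cs θ)⁻¹)) / (‖cs θ - b‖ : ℂ) ^ 3 := fun m =>
    continuous_div_cube hb ((continuous_const.mul (continuous_cs_zpow m)).mul
      (continuous_cs.sub hc))
  push_cast at h2
  -- Grouped so that the multiples `n Bn b n` and `(n+1) Bn b (n+1)` can be replaced by integrals
  -- against `|σ-b|⁻³`. The integrands then agree pointwise by `|σ-b|² = (σ-b)(σ⁻¹-b)`.
  have e : (2 * n + 1) * Bn b n - 2 * (n + 1) * b * Bn b (n + 1) =
      2 * (n * Bn b n) + Bn b n - 2 * b * ((n + 1) * Bn b (n + 1)) := by ring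
  rw [e, h1, h2, Bn]
  have e2 : ∀ x y z : ℂ, 2 * ((2 * π : ℂ)⁻¹ * x) + (2 * π : ℂ)⁻¹ * y -
    2 * b * ((2 * π : ℂ)⁻¹ * z) = (2 * π : ℂ)⁻¹ * (2 * x + 1 * y - 2 * b * z) := by intros; ring
  rw [e2, integral_lincomb (i2 n) i1 (i2 (n + 1))]
  congr 1
  refine intervalIntegral.integral_congr fun θ _ => ?_
  have hp : (‖cs θ - b‖ : ℂ) ≠ 0 := by exact_mod_cast (norm_cs_sub_pos hb θ).ne'
  have h3 := sq_norm_cs_sub' b θ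
  have h4 := cs_ne_zero θ
  simp only [zpow_add_one₀ h4]
  generalize (‖cs θ - b‖ : ℂ) = r at hp h3 ⊢
  generalize cs θ = z at h4 h3 ⊢
  field_simp at h3 ⊢
  linear_combination -h3

/-- `(1/2π) ∫ e^{inθ} (e^{iθ} - b)² / |e^{iθ} - b|³ dθ`. -/
lemma integral_Dn (hb : b ∈ Ioo (0 : ℝ) 1) (n : ℤ) :
    b * ((2 * π : ℂ)⁻¹ * ∫ θ in (0 : ℝ)..2 * π,
      (cs θ ^ n * (cs θ - b) ^ 2) / (‖cs θ - b‖ : ℂ) ^ 3) =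
      (2 * n + 1) * b * Bn b n - 2 * (n + 1) * Bn b (n + 1) := by
  have hc : Continuous fun θ => (cs θ)⁻¹ := continuous_cs.inv₀ cs_ne_zero
  have h1 := Bn_ibp hb n
  have h2 := Bn_ibp hb (n + 1)
  have i1 : Continuous fun θ => cs θ ^ n / (‖cs θ - b‖ : ℂ) := continuous_Bn_integrand hb n
  have i2 : ∀ m : ℤ, Continuous fun θ =>
      (-(b / 2 : ℂ) * cs θ ^ m * (cs θ - (cs θ)⁻¹)) / (‖cs θ - b‖ : ℂ) ^ 3 := fun m =>
    continuous_div_cube hb ((continuous_const.mul (continuous_cs_zpow m)).mul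
      (continuous_cs.sub hc))
  push_cast at h2
  have e : (2 * n + 1) * b * Bn b n - 2 * (n + 1) * Bn b (n + 1) =
      (2 * b) * (n * Bn b n) + b * Bn b n - 2 * ((n + 1) * Bn b (n + 1)) := by ring
  rw [e, h1, h2, Bn]
  have e2 : ∀ x y z : ℂ, (2 * b) * ((2 * π : ℂ)⁻¹ * x) + b * ((2 * π : ℂ)⁻¹ * y) -
    2 * ((2 * π : ℂ)⁻¹ * z) = (2 * π : ℂ)⁻¹ * ((2 * b) * x + b * y - 2 * z) := by intros; ring
  rw [e2, integral_lincomb (i2 n) i1 (i2 (n + 1)), mul_left_comm,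
    ← intervalIntegral.integral_const_mul]
  congr 1
  refine intervalIntegral.integral_congr fun θ _ => ?_
  have hp : (‖cs θ - b‖ : ℂ) ≠ 0 := by exact_mod_cast (norm_cs_sub_pos hb θ).ne'
  have h3 := sq_norm_cs_sub' b θ
  have h4 := cs_ne_zero θ
  simp only [zpow_add_one₀ h4]
  generalize (‖cs θ - b‖ : ℂ) = r at hp h3 ⊢
  generalize cs θ = z at h4 h3 ⊢
  field_simp at h3 ⊢
  linear_combination (-(b : ℂ)) * h3

end Regular

/-! ### Termwise integration and Fourier coefficients -/

lemma hasSum_integral_of_bound {ι : Type*} [Countable ι] {F : ι → ℝ → ℂ} {f : ℝ → ℂ} {u : ι → ℝ}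
    {x y : ℝ} (hu : Summable u) (hF : ∀ i, Measurable (F i))
    (hb : ∀ i, ∀ θ ∈ uIoc x y, ‖F i θ‖ ≤ u i)
    (h : ∀ θ ∈ uIoc x y, HasSum (fun i => F i θ) (f θ)) :
    HasSum (fun i => ∫ θ in x..y, F i θ) (∫ θ in x..y, f θ) :=
  intervalIntegral.hasSum_integral_of_dominated_convergence (fun i _ => u i)
    (fun i => (hF i).aestronglyMeasurable) (fun i => Eventually.of_forall fun θ => hb i θ)
    (Eventually.of_forall fun _ _ => hu) intervalIntegrable_const (Eventually.of_forall h)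

lemma integral_cs_zpow (n : ℤ) :
    ∫ θ in (0 : ℝ)..2 * π, cs θ ^ n = if n = 0 then (2 * π : ℂ) else 0 := by
  split_ifs with h
  · simp [h]
  · have hd : ∀ θ : ℝ, HasDerivAt (fun θ => (n * I : ℂ)⁻¹ * cs θ ^ n) (cs θ ^ n) θ := by
      intro θ
      refine ((hasDerivAt_cs_zpow n θ).const_mul _).congr_deriv ?_
      have : (n : ℂ) ≠ 0 := by exact_mod_cast h
      field_simp
    rw [intervalIntegral.integral_eq_sub_of_hasDerivAt (fun θ _ => hd θ)
      ((continuous_cs_zpow n).intervalIntegrable _ _)]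
    have hper : cs (2 * π) = cs 0 := by simp [circleMap]
    rw [hper, sub_self]

/-- The exponents `k i` need not be distinct. This lets one statement cover simple series as well as
the double series behind the Bessel functions and Parseval's identity. -/
lemma hasSum_fourierCoeff {ι : Type*} [Countable ι] {c : ι → ℂ} (hc : Summable fun i => ‖c i‖)
    (k : ι → ℤ) {u : ℝ → ℂ} (hu : ∀ θ, HasSum (fun i => c i * cs θ ^ k i) (u θ)) (m : ℤ) :
    HasSum (fun i => if k i = m then c i else 0)
      ((2 * π : ℂ)⁻¹ * ∫ θ in (0 : ℝ)..2 * π, u θ * cs θ ^ (-m)) := by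
  have h := hasSum_integral_of_bound (x := 0) (y := 2 * π)
    (F := fun i θ => c i * cs θ ^ k i * cs θ ^ (-m)) (f := fun θ => u θ * cs θ ^ (-m)) hc
    (fun i => by
      have h1 := continuous_cs_zpow (k i)
      have h2 := continuous_cs_zpow (-m)
      exact (by fun_prop : Continuous fun θ => c i * cs θ ^ k i * cs θ ^ (-m)).measurable)
    (fun i θ _ => by rw [norm_mul, norm_mul, norm_cs_zpow, norm_cs_zpow, mul_one, mul_one])
    (fun θ _ => (hu θ).mul_right _)
  refine (h.mul_left (2 * π : ℂ)⁻¹).congr_fun fun i => ?_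
  have e : ∀ θ, c i * cs θ ^ k i * cs θ ^ (-m) = c i * cs θ ^ (k i - m) := fun θ => by
    rw [mul_assoc, ← zpow_add₀ (cs_ne_zero θ)]; rfl
  simp only [e, intervalIntegral.integral_const_mul, integral_cs_zpow, sub_eq_zero]
  split_ifs
  · have : (π : ℂ) ≠ 0 := by exact_mod_cast Real.pi_ne_zero
    field_simp
  · simp

/-! ### The Dirichlet integral -/

/-- The Riemann–Lebesgue lemma, imaginary part. -/
lemma tendsto_integral_sin_mul {f : ℝ → ℝ} (hf : Integrable f) :
    Tendsto (fun x : ℝ => ∫ y, Real.sin (x * y) * f y) atTop (𝓝 0) := by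
  have h := Real.tendsto_integral_exp_smul_cocompact (fun y => (f y : ℂ))
  -- The rescaling absorbs the `2π` in the normalisation of `Real.fourierChar`.
  have h2 : Tendsto (fun x : ℝ => (2 * π)⁻¹ * x) atTop (cocompact ℝ) :=
    (tendsto_id.const_mul_atTop (by positivity)).mono_right atTop_le_cocompact
  have h3 := (Complex.continuous_im.tendsto _).comp (h.comp h2)
  have h4 := h3.neg
  simp only [Complex.zero_im, neg_zero] at h4
  refine h4.congr fun x => ?_
  have hi : Integrable fun y => (Real.fourierChar (-(y * ((2 * π)⁻¹ * x)))) • (f y : ℂ) := by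
    refine (hf.ofReal (𝕜 := ℂ)).bdd_smul (C := 1) ?_ ?_
    · have hc : Continuous fun y : ℝ => -(y * ((2 * π)⁻¹ * x)) := by fun_prop
      exact (continuous_subtype_val.comp
        (Real.continuous_fourierChar.comp hc)).aestronglyMeasurable
    · exact Eventually.of_forall fun y => (Circle.norm_coe _).le
  simp only [Function.comp_apply]
  rw [← Complex.imCLM_apply, ← Complex.imCLM.integral_comp_comm hi, ← integral_neg]
  refine integral_congr_ae (Eventually.of_forall fun y => ?_)
  simp only [Circle.smul_def, Real.fourierChar_apply, smul_eq_mul]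
  have e : ((2 * π * -(y * ((2 * π)⁻¹ * x)) : ℝ) : ℂ) * I = ((-(x * y) : ℝ) : ℂ) * I := by
    congr 2
    field_simp
  rw [e, Complex.imCLM_apply, Complex.im_mul_ofReal, Complex.exp_ofReal_mul_I_im, Real.sin_neg]
  ring

lemma tendsto_setIntegral_sin_mul {f : ℝ → ℝ} {S : Set ℝ} (hS : MeasurableSet S)
    (hf : IntegrableOn f S) :
    Tendsto (fun x : ℝ => ∫ y in S, Real.sin (x * y) * f y) atTop (𝓝 0) := by
  refine (tendsto_integral_sin_mul (hf.integrable_indicator hS)).congr fun x => ?_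
  rw [← integral_indicator hS]
  congr 1
  funext y
  by_cases hy : y ∈ S <;> simp [hy]

lemma continuous_x_sinc (x : ℝ) : Continuous fun y => x * Real.sinc (x * y) :=
  continuous_const.mul (Real.continuous_sinc.comp (by fun_prop))

lemma x_sinc_eq {x y : ℝ} (hy : y ≠ 0) : x * Real.sinc (x * y) = Real.sin (x * y) / y := by
  rcases eq_or_ne x 0 with rfl | hx
  · simp
  · rw [Real.sinc_of_ne_zero (mul_ne_zero hx hy)]; field_simp

/-- Induction through `sin((2m+3)y) - sin((2m+1)y) = 2 cos((2m+2)y) sin y`, whose quotient by `sin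
y` integrates to zero over `[0, π/2]`. Integrability is carried along because the quotient takes a
default value at `0`. -/
lemma dirichlet_kernel (m : ℕ) :
    IntervalIntegrable (fun y => Real.sin ((2 * m + 1) * y) / Real.sin y) volume 0 (π / 2) ∧
    ∫ y in (0 : ℝ)..π / 2, Real.sin ((2 * m + 1) * y) / Real.sin y = π / 2 := by
  have hpi := Real.pi_pos
  induction m with
  | zero =>
    have e : ∀ y ∈ Ioo (0 : ℝ) (π / 2), Real.sin ((2 * (0 : ℕ) + 1) * y) / Real.sin y = 1 := by
      intro y hy
      have := Real.sin_pos_of_pos_of_lt_pi hy.1 (by linarith [hy.2])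
      simp [this.ne']
    constructor
    · refine (intervalIntegrable_const (c := (1 : ℝ))).congr_ae ?_
      rw [uIoc_of_le (by positivity), Measure.restrict_congr_set Ioo_ae_eq_Ioc.symm]
      filter_upwards [ae_restrict_mem measurableSet_Ioo] with y hy
      exact (e y hy).symm
    · rw [intervalIntegral.integral_of_le (by positivity), integral_Ioc_eq_integral_Ioo,
        setIntegral_congr_fun measurableSet_Ioo e]
      simp
      positivity
  | succ m ih =>
    have hc : Continuous fun y : ℝ => 2 * Real.cos ((2 * m + 2) * y) := by fun_prop
    have e : ∀ y ∈ Ioo (0 : ℝ) (π / 2), Real.sin ((2 * (m + 1 : ℕ) + 1) * y) / Real.sin y =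
        Real.sin ((2 * m + 1) * y) / Real.sin y + 2 * Real.cos ((2 * m + 2) * y) := by
      intro y hy
      have := (Real.sin_pos_of_pos_of_lt_pi hy.1 (by linarith [hy.2])).ne'
      have e1 : ((2 * (m + 1 : ℕ) + 1) * y : ℝ) = (2 * m + 2) * y + y := by push_cast; ring
      have e2 : ((2 * m + 1) * y : ℝ) = (2 * m + 2) * y - y := by ring
      rw [e1, e2, Real.sin_add, Real.sin_sub]
      field_simp
      ring
    have hi := ih.1.add (hc.intervalIntegrable 0 (π / 2))
    constructor
    · refine hi.congr_ae ?_
      rw [uIoc_of_le (by positivity), Measure.restrict_congr_set Ioo_ae_eq_Ioc.symm]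
      filter_upwards [ae_restrict_mem measurableSet_Ioo] with y hy
      exact (e y hy).symm
    · have h0 : ∫ y in (0 : ℝ)..π / 2, 2 * Real.cos ((2 * m + 2) * y) = 0 := by
        rw [intervalIntegral.integral_const_mul, intervalIntegral.integral_comp_mul_left
          (fun y => Real.cos y) (by positivity), integral_cos]
        have : (2 * m + 2 : ℝ) * (π / 2) = (m + 1 : ℕ) * π := by push_cast; ring
        rw [this, Real.sin_nat_mul_pi]
        simp
      rw [intervalIntegral.integral_of_le (by positivity), integral_Ioc_eq_integral_Ioo,
        setIntegral_congr_fun measurableSet_Ioo e, ← integral_Ioc_eq_integral_Ioo,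
        ← intervalIntegral.integral_of_le (by positivity), intervalIntegral.integral_add ih.1
          (hc.intervalIntegrable 0 (π / 2)), h0, ih.2, add_zero]

/-- The sine integral. -/
def Si (x : ℝ) : ℝ := ∫ t in (0 : ℝ)..x, Real.sinc t

lemma integral_x_sinc (x c : ℝ) : ∫ y in (0 : ℝ)..c, x * Real.sinc (x * y) = Si (x * c) := by
  rw [intervalIntegral.integral_const_mul, ← smul_eq_mul,
    intervalIntegral.smul_integral_comp_mul_left]
  simp [Si]

lemma abs_inv_sub_inv_sin_le {y : ℝ} (hy : y ∈ Ioc (0 : ℝ) (π / 2)) :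
    |1 / y - 1 / Real.sin y| ≤ 2 := by
  have h0 := hy.1
  have h1 := Real.mul_le_sin h0.le hy.2
  have h2 := Real.sin_lt h0
  have hpi := Real.pi_lt_d2
  have hpi3 := Real.pi_gt_three
  have hs : 0 < Real.sin y := lt_of_lt_of_le (by positivity) h1
  have hs' : y / 2 ≤ Real.sin y := by
    refine le_trans ?_ h1
    rw [div_mul_eq_mul_div, div_le_div_iff₀ (by norm_num) Real.pi_pos]
    nlinarith
  have hle : 1 / y ≤ 1 / Real.sin y := one_div_le_one_div_of_le hs h2.le
  rw [abs_of_nonpos (by linarith)]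
  -- For `y ≤ 1` the cubic lower bound for `sin y` makes the difference at most about `y/2`; for `y
  -- ≥ 1` already `1/sin y ≤ 2`.
  rcases le_total y 1 with h | h
  · have h3 := Real.sin_gt_sub_cube h0
    rw [neg_sub, div_sub_div _ _ hs.ne' h0.ne', div_le_iff₀ (by positivity)]
    nlinarith [mul_pos h0 h0, mul_pos h0 hs]
  · have h4 : 1 / Real.sin y ≤ 2 := by
      rw [div_le_iff₀ hs]
      nlinarith
    have : 0 < 1 / y := by positivity
    linarith

lemma integrable_inv_sub_inv_sin :
    IntegrableOn (fun y => 1 / y - 1 / Real.sin y) (Ioc 0 (π / 2)) := by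
  refine Measure.integrableOn_of_bounded (M := 2) measure_Ioc_lt_top.ne ?_ ?_
  · exact (by fun_prop : Measurable fun y : ℝ => 1 / y - 1 / Real.sin y).aestronglyMeasurable
  · filter_upwards [ae_restrict_mem measurableSet_Ioc] with y hy
    exact abs_inv_sub_inv_sin_le hy

/-- `Si((2m+1)π/2)` is the Dirichlet integral with `1/y` in place of `1/sin y`. The difference of
these factors is bounded, so the error tends to zero by Riemann–Lebesgue. -/
lemma tendsto_Si_odd : Tendsto (fun m : ℕ => Si ((2 * m + 1) * (π / 2))) atTop (𝓝 (π / 2)) := by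
  have hpi := Real.pi_pos
  have h1 := tendsto_setIntegral_sin_mul measurableSet_Ioc integrable_inv_sub_inv_sin
  have h2 : Tendsto (fun m : ℕ => (2 * m + 1 : ℝ)) atTop atTop :=
    tendsto_atTop_add_const_right _ _ (tendsto_natCast_atTop_atTop.const_mul_atTop two_pos)
  have h3 := (h1.comp h2).add_const (π / 2)
  rw [zero_add] at h3
  refine h3.congr fun m => ?_
  obtain ⟨hi, hv⟩ := dirichlet_kernel m
  have hi2 := (continuous_x_sinc (2 * m + 1)).intervalIntegrable (μ := volume) 0 (π / 2)
  symm
  rw [← integral_x_sinc, ← sub_eq_iff_eq_add]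
  refine (congrArg (_ - ·) hv.symm).trans ?_
  rw [← intervalIntegral.integral_sub hi2 hi,
    intervalIntegral.integral_of_le (by positivity), Function.comp_apply]
  refine setIntegral_congr_fun measurableSet_Ioc fun y hy => ?_
  rw [x_sinc_eq hy.1.ne']
  ring

lemma abs_Si_sub_le {x y : ℝ} (hx : 0 < x) (hxy : x ≤ y) : |Si y - Si x| ≤ (y - x) / x := by
  have hc := Real.continuous_sinc
  have e : Si y - Si x = ∫ t in x..y, Real.sinc t :=
    intervalIntegral.integral_interval_sub_left (hc.intervalIntegrable _ _)
      (hc.intervalIntegrable _ _)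
  rw [e]
  have h := intervalIntegral.norm_integral_le_of_norm_le_const (a := x) (b := y) (C := 1 / x)
    (f := Real.sinc) fun t ht => by
      rw [uIoc_of_le hxy] at ht
      have ht0 := hx.trans ht.1
      rw [Real.sinc_of_ne_zero ht0.ne', norm_div, Real.norm_of_nonneg ht0.le]
      exact div_le_div₀ zero_le_one (Real.abs_sin_le_one t) hx ht.1.le
  rw [Real.norm_eq_abs, abs_of_nonneg (sub_nonneg.2 hxy)] at h
  exact h.trans_eq (by ring)

lemma tendsto_Si : Tendsto Si atTop (𝓝 (π / 2)) := by
  have hpi := Real.pi_pos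
  -- `(2N+1)π/2` is the largest odd multiple of `π/2` not exceeding `x`, hence within `π` of it.
  -- Over such an interval `Si` changes by at most `π/(x-π)`.
  set N : ℝ → ℕ := fun x => ⌊(x / (π / 2) - 1) / 2⌋₊ with hN
  have hlim : Tendsto (fun x : ℝ => (x / (π / 2) - 1) / 2) atTop atTop :=
    (tendsto_atTop_add_const_right _ (-1) (tendsto_id.atTop_div_const (by positivity :
      0 < π / 2))).atTop_div_const two_pos
  have h1 : Tendsto (fun x => Si ((2 * N x + 1) * (π / 2))) atTop (𝓝 (π / 2)) :=
    tendsto_Si_odd.comp (tendsto_nat_floor_atTop.comp hlim)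
  have h2 : Tendsto (fun x => Si x - Si ((2 * N x + 1) * (π / 2))) atTop (𝓝 0) := by
    refine squeeze_zero_norm' (a := fun x => π / (x - π)) ?_ ?_
    · filter_upwards [eventually_gt_atTop π] with x hx
      have h0 : 0 ≤ (x / (π / 2) - 1) / 2 := by
        have : 1 ≤ x / (π / 2) := by rw [le_div_iff₀ (by positivity)]; linarith
        linarith
      have h3 := Nat.floor_le h0
      have h4 := Nat.lt_floor_add_one ((x / (π / 2) - 1) / 2)
      have e : x = (2 * ((x / (π / 2) - 1) / 2) + 1) * (π / 2) := by field_simp; ring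
      have h5 : (2 * N x + 1) * (π / 2) ≤ x := by
        nth_rw 2 [e]
        gcongr
      have h6 : x - π ≤ (2 * N x + 1) * (π / 2) := by
        have : x ≤ (2 * (N x + 1) + 1) * (π / 2) := by
          nth_rw 1 [e]
          gcongr
        linarith
      refine (abs_Si_sub_le (by linarith) h5).trans ?_
      exact div_le_div₀ hpi.le (by linarith) (by linarith) h6
    · exact tendsto_const_nhds.div_atTop (tendsto_atTop_add_const_right _ _ tendsto_id)
  have h3 := h2.add h1
  simpa using h3

/-! ### The integral of the Bessel function of order zero -/

/-- The substitution `y = sin β` is injective on the open interval and reduces this to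
Riemann–Lebesgue. The transformed density is integrable even though its Jacobian is unbounded. -/
lemma tendsto_integral_sin_sin {g : ℝ → ℝ} (hg : IntegrableOn g (Ioo 0 (π / 2))) :
    Tendsto (fun x : ℝ => ∫ β in Ioo 0 (π / 2), Real.sin (x * Real.sin β) * g β) atTop (𝓝 0) := by
  have hd : ∀ β ∈ Ioo 0 (π / 2), HasDerivWithinAt Real.sin (Real.cos β) (Ioo 0 (π / 2)) β :=
    fun β _ => (Real.hasDerivAt_sin β).hasDerivWithinAt
  have hinj : InjOn Real.sin (Ioo 0 (π / 2)) :=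
    Real.injOn_sin.mono fun β (hβ : β ∈ Ioo 0 (π / 2)) =>
      (⟨by linarith [hβ.1, Real.pi_pos], hβ.2.le⟩ : β ∈ Icc (-(π / 2)) (π / 2))
  have hS : MeasurableSet (Real.sin '' Ioo 0 (π / 2)) :=
    measurableSet_Ioo.image_of_continuousOn_injOn Real.continuous_sin.continuousOn hinj
  set h : ℝ → ℝ := fun y => g (Real.arcsin y) / Real.cos (Real.arcsin y) with hh
  have e : ∀ β ∈ Ioo 0 (π / 2), |Real.cos β| * h (Real.sin β) = g β := by
    intro β hβ
    have hc := Real.cos_pos_of_mem_Ioo (x := β) ⟨by linarith [hβ.1, Real.pi_pos], hβ.2⟩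
    rw [hh]
    simp only
    rw [Real.arcsin_sin (by linarith [hβ.1, Real.pi_pos]) hβ.2.le, abs_of_pos hc]
    field_simp
  have hi : IntegrableOn h (Real.sin '' Ioo 0 (π / 2)) := by
    rw [integrableOn_image_iff_integrableOn_abs_deriv_smul measurableSet_Ioo hd hinj]
    exact hg.congr_fun (fun β hβ => (e β hβ).symm) measurableSet_Ioo
  refine (tendsto_setIntegral_sin_mul hS hi).congr fun x => ?_
  rw [integral_image_eq_integral_abs_deriv_smul measurableSet_Ioo hd hinj]
  refine setIntegral_congr_fun measurableSet_Ioo fun β hβ => ?_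
  simp only [smul_eq_mul]
  rw [mul_left_comm, e β hβ]

/-- The mean of `x sinc (x sin β)`; this is the integral of `J_0` over `[0,x]`. -/
lemma tendsto_integral_sinc_sin :
    Tendsto (fun x : ℝ => ∫ β in (0 : ℝ)..π / 2, x * Real.sinc (x * Real.sin β)) atTop
      (𝓝 (π / 2)) := by
  have hpi := Real.pi_pos
  -- Split `1 = cos β + (1 - cos β)`. The first part is `Si x` after `y = sin β`; in the second `(1
  -- - cos β)/sin β = tan(β/2)` is integrable, so it tends to zero.
  have h1 := tendsto_integral_sin_sin (g := fun β => Real.tan (β / 2)) (by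
    have hc : ContinuousOn (fun β : ℝ => Real.tan (β / 2)) (Icc 0 (π / 2)) := by
      intro β hβ
      refine ContinuousAt.continuousWithinAt ?_
      have : Real.cos (β / 2) ≠ 0 :=
        (Real.cos_pos_of_mem_Ioo (x := β / 2) ⟨by linarith [hβ.1], by linarith [hβ.2]⟩).ne'
      exact ContinuousAt.comp (g := Real.tan) (f := fun β : ℝ => β / 2)
        (Real.continuousAt_tan.2 this) (by fun_prop)
    exact (hc.integrableOn_compact isCompact_Icc).mono_set Ioo_subset_Icc_self)
  have h2 := h1.add tendsto_Si
  rw [zero_add] at h2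
  refine h2.congr fun x => ?_
  have e1 : Si x = ∫ β in (0 : ℝ)..π / 2, x * Real.sinc (x * Real.sin β) * Real.cos β := by
    have := intervalIntegral.integral_comp_mul_deriv (a := 0) (b := π / 2) (f := Real.sin)
      (f' := Real.cos) (g := fun y => x * Real.sinc (x * y)) (fun β _ => Real.hasDerivAt_sin β)
      Real.continuous_cos.continuousOn (continuous_x_sinc x)
    simp only [Function.comp_apply] at this
    rw [this, Real.sin_zero, Real.sin_pi_div_two, integral_x_sinc, mul_one]
  have hc1 : Continuous fun β => x * Real.sinc (x * Real.sin β) :=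
    (continuous_x_sinc x).comp Real.continuous_sin
  have e2 : ∫ β in Ioo 0 (π / 2), Real.sin (x * Real.sin β) * Real.tan (β / 2) =
      ∫ β in (0 : ℝ)..π / 2, x * Real.sinc (x * Real.sin β) * (1 - Real.cos β) := by
    rw [intervalIntegral.integral_of_le (by positivity), integral_Ioc_eq_integral_Ioo]
    refine setIntegral_congr_fun measurableSet_Ioo fun β hβ => ?_
    have hs := Real.sin_pos_of_pos_of_lt_pi hβ.1 (by linarith [hβ.2])
    have hc := Real.cos_pos_of_mem_Ioo (x := β / 2) ⟨by linarith [hβ.1], by linarith [hβ.2]⟩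
    rw [x_sinc_eq hs.ne', Real.tan_eq_sin_div_cos]
    have hs2 : Real.sin β = 2 * Real.sin (β / 2) * Real.cos (β / 2) := by
      rw [← Real.sin_two_mul]; ring_nf
    have hc2 : 1 - Real.cos β = 2 * Real.sin (β / 2) ^ 2 := by
      have := Real.cos_two_mul (β / 2)
      have h4 := Real.sin_sq_add_cos_sq (β / 2)
      have h5 : 2 * (β / 2) = β := by ring
      rw [h5] at this
      linarith
    rw [hc2, div_mul_eq_mul_div, mul_div_assoc]
    congr 1
    rw [div_eq_div_iff hc.ne' hs.ne', hs2]
    ring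
  rw [e1, e2, ← intervalIntegral.integral_add
    ((by fun_prop : Continuous fun β =>
      x * Real.sinc (x * Real.sin β) * (1 - Real.cos β)).intervalIntegrable _ _)
    ((by fun_prop : Continuous fun β =>
      x * Real.sinc (x * Real.sin β) * Real.cos β).intervalIntegrable _ _)]
  refine intervalIntegral.integral_congr fun β _ => ?_
  ring

/-! ### Integral representations of Bessel functions -/

lemma continuous_besselIntegrand (n : ℤ) (t : ℝ) :
    Continuous fun θ : ℝ => exp (t * Real.sin θ * I) * cs θ ^ (-n) := by
  have := continuous_cs_zpow (-n)
  fun_prop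

lemma hasSum_mul_of_summable_norm {ι : Type*} {f g : ι → ℂ} {a b : ℂ} (hf : HasSum f a)
    (hg : HasSum g b) (hf' : Summable fun n => ‖f n‖) (hg' : Summable fun n => ‖g n‖) :
    HasSum (fun p : ι × ι => f p.1 * g p.2) (a * b) :=
  hf.mul hg (summable_mul_of_summable_norm hf' hg')

lemma hasSum_exp_mul_exp (z w : ℂ) : HasSum (fun p : ℕ × ℕ =>
    (z ^ p.1 / (p.1.factorial : ℂ)) * (w ^ p.2 / (p.2.factorial : ℂ))) (exp z * exp w) := by
  have hexp : ∀ z : ℂ, HasSum (fun j : ℕ => z ^ j / (j.factorial : ℂ)) (exp z) := fun z => by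
    rw [Complex.exp_eq_exp_ℂ]; exact NormedSpace.expSeries_div_hasSum_exp z
  have h := hasSum_mul_of_summable_norm (hexp z) (hexp w)
    (NormedSpace.norm_expSeries_div_summable z) (NormedSpace.norm_expSeries_div_summable w)
  exact h

/-- With `2i sin θ = σ - σ⁻¹` the exponential is the product of the series of `exp(tσ/2)` and
`exp(-tσ⁻¹/2)`, the generating function of the Bessel functions. `besselJ n t` is its coefficient of
`σ^n`. -/
lemma besselJ_eq_integral (n : ℕ) (t : ℝ) : (besselJ n t : ℂ) =
    (2 * π : ℂ)⁻¹ * ∫ θ in (0 : ℝ)..2 * π, exp (t * Real.sin θ * I) * cs θ ^ (-(n : ℤ)) := by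
  have hnorm : ∀ z : ℂ, Summable (fun j : ℕ => ‖z ^ j / (j.factorial : ℂ)‖) := fun z =>
    NormedSpace.norm_expSeries_div_summable z
  set c : ℕ × ℕ → ℂ := fun p =>
    ((t / 2 : ℂ) ^ p.1 / (p.1.factorial : ℂ)) * ((-(t / 2) : ℂ) ^ p.2 / (p.2.factorial : ℂ)) with hc
  have hcs : Summable fun p => ‖c p‖ :=
    (Summable.mul_of_nonneg (hnorm (t / 2)) (hnorm (-(t / 2))) (fun _ => norm_nonneg _)
      fun _ => norm_nonneg _).congr fun p => (norm_mul _ _).symm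
  have hu : ∀ θ : ℝ, HasSum (fun p : ℕ × ℕ => c p * cs θ ^ ((p.1 : ℤ) - p.2))
      (exp (t * Real.sin θ * I)) := by
    intro θ
    have h0 := cs_ne_zero θ
    have e : exp (t * Real.sin θ * I) = exp ((t / 2) * cs θ) * exp (-(t / 2) * (cs θ)⁻¹) := by
      rw [← Complex.exp_add]
      congr 1
      rw [cs_eq, ← Complex.exp_neg, Complex.ofReal_sin, Complex.sin]
      have e : -(θ : ℂ) * I = -(θ * I) := by ring
      rw [e]
      linear_combination (t * (exp (-(θ * I)) - exp (θ * I)) / 2) * I_sq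
    rw [e]
    refine (hasSum_exp_mul_exp _ _).congr_fun fun p => ?_
    rw [zpow_sub₀ h0, zpow_natCast, zpow_natCast, hc]
    simp only [mul_pow, inv_pow]
    field_simp
  have h := hasSum_fourierCoeff hcs (fun p : ℕ × ℕ => (p.1 : ℤ) - p.2) hu n
  rw [← h.tsum_eq, besselJ, Complex.ofReal_tsum]
  -- The pairs with difference `n` are exactly the `(n + k, k)`; all other terms of the double
  -- series vanish.
  have hinj : Function.Injective fun k : ℕ => (n + k, k) := fun _ _ hab =>
    (Prod.mk.inj hab).2
  rw [← hinj.tsum_eq]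
  · refine tsum_congr fun k => ?_
    have : ((n + k : ℕ) : ℤ) - k = n := by push_cast; ring
    simp only [this, if_true, hc]
    have e1 : (-(t / 2) : ℂ) ^ k = (-1) ^ k * (t / 2) ^ k := by rw [← mul_pow]; ring
    rw [e1]
    push_cast
    have h1 : (k.factorial : ℂ) ≠ 0 := by exact_mod_cast k.factorial_ne_zero
    have h2 : ((n + k).factorial : ℂ) ≠ 0 := by exact_mod_cast (n + k).factorial_ne_zero
    rw [show 2 * k + n = (n + k) + k by ring, pow_add _ (n + k) k]
    field_simp
  · intro p hp
    have : (p.1 : ℤ) - p.2 = n := by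
      by_contra hne
      exact hp (if_neg hne)
    exact ⟨p.2, Prod.ext (by simp only; omega) rfl⟩

lemma conj_integral (f : ℝ → ℂ) (x y : ℝ) :
    conj (∫ θ in x..y, f θ) = ∫ θ in x..y, conj (f θ) := by
  rw [intervalIntegral, intervalIntegral, map_sub, ← integral_conj, ← integral_conj]

lemma integral_shift {f : ℝ → ℂ} (hf : ∀ θ, f (θ + 2 * π) = f θ) (ψ : ℝ) :
    ∫ θ in (0 : ℝ)..2 * π, f (θ + ψ) = ∫ θ in (0 : ℝ)..2 * π, f θ := by
  have hp : Function.Periodic f (2 * π) := hf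
  rw [intervalIntegral.integral_comp_add_right]
  have := hp.intervalIntegral_add_eq ψ 0
  rw [zero_add] at this ⊢
  rw [← this]
  congr 1
  ring

lemma cs_add_two_pi (θ : ℝ) : cs (θ + 2 * π) = cs θ := periodic_circleMap 0 1 θ

lemma integral_reflect {f : ℝ → ℂ} (hf : ∀ θ, f (θ + 2 * π) = f θ) (ψ : ℝ) :
    ∫ θ in (0 : ℝ)..2 * π, f (ψ - θ) = ∫ θ in (0 : ℝ)..2 * π, f θ := by
  have hp : Function.Periodic f (2 * π) := hf
  rw [intervalIntegral.integral_comp_sub_left]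
  have := hp.intervalIntegral_add_eq (ψ - 2 * π) 0
  rw [zero_add] at this
  rw [← this]
  congr 1
  ring

/-- Neumann's formula. -/
lemma besselJ_mul (b : ℝ) (n : ℕ) (t : ℝ) : (besselJ n (b * t) * besselJ n t : ℂ) =
    (2 * π : ℂ)⁻¹ * ∫ φ in (0 : ℝ)..2 * π, besselJ 0 (t * ‖cs φ - b‖) * cs φ ^ (-(n : ℤ)) := by
  -- The conjugated integral representation is used for the real number `besselJ n (b * t)`, so that
  -- the two phases are subtracted in the product.
  set g : ℝ → ℂ := fun γ => exp (-(b * t * Real.sin γ * I)) * cs γ ^ (n : ℤ) with hg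
  have hgc : Continuous g := by
    have := continuous_cs_zpow (n : ℤ)
    fun_prop
  have hb : (besselJ n (b * t) : ℂ) = (2 * π : ℂ)⁻¹ * ∫ γ in (0 : ℝ)..2 * π, g γ := by
    have h := congrArg conj (besselJ_eq_integral n (b * t))
    rw [Complex.conj_ofReal, map_mul, conj_integral] at h
    rw [h]
    congr 1
    · have : (2 * π : ℂ)⁻¹ = (((2 * π)⁻¹ : ℝ) : ℂ) := by push_cast; rfl
      rw [this, Complex.conj_ofReal]
    · refine intervalIntegral.integral_congr fun γ _ => ?_
      simp only [hg, map_mul, ← Complex.exp_conj, map_zpow₀, conj_cs, Complex.conj_ofReal,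
        Complex.conj_I, inv_zpow', neg_neg]
      push_cast
      ring_nf
  set F : ℝ → ℝ → ℂ := fun β φ => exp (t * Real.sin β * I) * cs β ^ (-(n : ℤ)) * g (β - φ) with hF
  have hFc : Continuous (Function.uncurry F) := by
    have h1 := continuous_besselIntegrand n t
    exact (h1.comp continuous_fst).mul (hgc.comp (continuous_fst.sub continuous_snd))
  have hgp : ∀ γ, g (γ + 2 * π) = g γ := fun γ => by
    simp only [hg, cs_add_two_pi, Real.sin_add_two_pi]
  have h1 : (∫ γ in (0 : ℝ)..2 * π, g γ) *
      (∫ θ in (0 : ℝ)..2 * π, exp (t * Real.sin θ * I) * cs θ ^ (-(n : ℤ))) =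
      ∫ β in (0 : ℝ)..2 * π, ∫ φ in (0 : ℝ)..2 * π, F β φ := by
    rw [← intervalIntegral.integral_const_mul]
    refine intervalIntegral.integral_congr fun β _ => ?_
    simp only [hF, intervalIntegral.integral_const_mul, integral_reflect hgp]
    ring
  have h2 : ∀ φ : ℝ, ∫ β in (0 : ℝ)..2 * π, F β φ =
      2 * π * (besselJ 0 (t * ‖cs φ - b‖) * cs φ ^ (-(n : ℤ))) := by
    intro φ
    set r := ‖cs φ - b‖ with hr
    -- After `γ = β - φ` the total phase is the imaginary part of `e^(iβ) z`. As `|z| = |e^(iφ) -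
    -- b|`, a shift of `β` by the argument of `z` leaves the integral of `J_0`.
    set z : ℂ := 1 - b * (cs φ)⁻¹ with hz
    have hzr : ‖z‖ = r := by
      have : z = (cs φ)⁻¹ * (cs φ - b) := by
        rw [hz, mul_sub, inv_mul_cancel₀ (cs_ne_zero φ)]; ring
      rw [this, norm_mul, norm_inv, norm_cm, inv_one, one_mul]
    have hpol : (r : ℂ) * cs z.arg = z := by
      rw [← hzr, cs_eq]; exact Complex.norm_mul_exp_arg_mul_I z
    have him : ∀ θ : ℝ, (cs θ).im = Real.sin θ := fun θ => by
      rw [cs_eq, Complex.exp_ofReal_mul_I_im]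
    have hphase : ∀ β : ℝ, Real.sin β - b * Real.sin (β - φ) = r * Real.sin (β + z.arg) := by
      intro β
      have e1 : cs β * z = r * cs (β + z.arg) := by
        have : cs (β + z.arg) = cs β * cs z.arg := by
          rw [cs_eq, cs_eq, cs_eq, ← Complex.exp_add]; push_cast; ring_nf
        rw [this, mul_left_comm, hpol]
      have e2 : cs β * z = cs β - b * cs (β - φ) := by
        rw [hz, cs_eq (β - φ), cs_eq β, cs_eq φ]
        push_cast
        rw [sub_mul, Complex.exp_sub]
        ring
      have e3 := congrArg Complex.im (e2.symm.trans e1)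
      rw [Complex.sub_im, Complex.im_ofReal_mul, Complex.im_ofReal_mul, him, him, him] at e3
      exact e3
    have e4 : ∀ β : ℝ, F β φ =
        exp (((t * r : ℝ) : ℂ) * Real.sin (β + z.arg) * I) * cs φ ^ (-(n : ℤ)) := by
      intro β
      have h5 := congrArg (fun x : ℝ => (x : ℂ)) (hphase β)
      simp only [Complex.ofReal_sub, Complex.ofReal_mul] at h5
      have h6 : cs β ^ (-(n : ℤ)) * cs (β - φ) ^ (n : ℤ) = cs φ ^ (-(n : ℤ)) := by
        simp only [cs_zpow]
        rw [← Complex.exp_add]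
        push_cast
        ring_nf
      have h7 : exp (t * Real.sin β * I) * exp (-(b * t * Real.sin (β - φ) * I)) =
          exp (((t * r : ℝ) : ℂ) * Real.sin (β + z.arg) * I) := by
        rw [← Complex.exp_add]
        congr 1
        push_cast at h5 ⊢
        linear_combination (t * I : ℂ) * h5
      rw [hF, hg, ← h6, ← h7]
      ring
    simp only [e4, intervalIntegral.integral_mul_const]
    rw [integral_shift (f := fun θ => exp (((t * r : ℝ) : ℂ) * Real.sin θ * I))
      (fun θ => by simp only [Real.sin_add_two_pi]), besselJ_eq_integral]
    have : (π : ℂ) ≠ 0 := by exact_mod_cast Real.pi_ne_zero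
    simp only [Nat.cast_zero, neg_zero, zpow_zero, mul_one, ← mul_assoc]
    rw [mul_inv_cancel₀ (mul_ne_zero two_ne_zero this), one_mul]
  rw [hb, besselJ_eq_integral n t, mul_mul_mul_comm, h1, intervalIntegral_intervalIntegral_swap]
  · simp only [h2, intervalIntegral.integral_const_mul]
    have : (π : ℂ) ≠ 0 := by exact_mod_cast Real.pi_ne_zero
    field_simp
  · rw [uIoc_of_le (by positivity)]
    exact (hFc.continuousOn.integrableOn_compact (isCompact_Icc.prod isCompact_Icc)).mono_set
      (prod_mono Ioc_subset_Icc_self Ioc_subset_Icc_self)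

/-! ### The improper integral -/

lemma besselJ_zero_eq (t : ℝ) :
    besselJ 0 t = (2 * π)⁻¹ * ∫ θ in (0 : ℝ)..2 * π, Real.cos (t * Real.sin θ) := by
  have h := congrArg Complex.re (besselJ_eq_integral 0 t)
  have e : (2 * π : ℂ)⁻¹ = (((2 * π)⁻¹ : ℝ) : ℂ) := by push_cast; rfl
  rw [Complex.ofReal_re, e, Complex.re_ofReal_mul] at h
  rw [h]
  congr 1
  have hi : IntervalIntegrable (fun θ : ℝ => exp (t * Real.sin θ * I) * cs θ ^ (-((0 : ℕ) : ℤ)))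
    volume 0 (2 * π) := (continuous_besselIntegrand _ t).intervalIntegrable _ _
  rw [← Complex.reCLM_apply, ← Complex.reCLM.intervalIntegral_comp_comm hi]
  refine intervalIntegral.integral_congr fun θ _ => ?_
  simp only [Nat.cast_zero, neg_zero, zpow_zero, mul_one, Complex.reCLM_apply]
  rw [← Complex.ofReal_mul, Complex.exp_ofReal_mul_I_re]

lemma continuous_besselJ_zero : Continuous (besselJ 0) := by
  have h : besselJ 0 = fun t => (2 * π)⁻¹ * ∫ θ in (0 : ℝ)..2 * π, Real.cos (t * Real.sin θ) :=
    funext besselJ_zero_eq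
  rw [h]
  refine continuous_const.mul ?_
  exact intervalIntegral.continuous_parametric_intervalIntegral_of_continuous' (by fun_prop) _ _

lemma integral_cos_mul (x s : ℝ) : ∫ t in (0 : ℝ)..x, Real.cos (t * s) = x * Real.sinc (x * s) := by
  rcases eq_or_ne s 0 with rfl | hs
  · simp
  · rw [x_sinc_eq hs, intervalIntegral.integral_comp_mul_right (fun t => Real.cos t) hs,
      integral_cos]
    simp only [zero_mul, Real.sin_zero, sub_zero, smul_eq_mul]
    field_simp

/-- Exchange the integration in `t` with the mean over the circle. The symmetries of `sin` reduce
the full period to four copies of a quarter. -/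
lemma integral_besselJ_zero (x : ℝ) : ∫ t in (0 : ℝ)..x, besselJ 0 t =
    (2 / π) * ∫ β in (0 : ℝ)..π / 2, x * Real.sinc (x * Real.sin β) := by
  set f : ℝ → ℝ := fun β => x * Real.sinc (x * Real.sin β) with hf
  have hc : Continuous f := (continuous_x_sinc x).comp Real.continuous_sin
  have hi : ∀ a c, IntervalIntegrable f volume a c := fun a c => hc.intervalIntegrable a c
  have h1 : ∫ t in (0 : ℝ)..x, besselJ 0 t = (2 * π)⁻¹ * ∫ β in (0 : ℝ)..2 * π, f β := by
    simp only [besselJ_zero_eq, intervalIntegral.integral_const_mul]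
    congr 1
    rw [intervalIntegral_intervalIntegral_swap]
    · simp only [integral_cos_mul, hf]
    · have hF : Continuous (Function.uncurry fun t θ : ℝ => Real.cos (t * Real.sin θ)) := by
        fun_prop
      exact (hF.continuousOn.integrableOn_compact (isCompact_uIcc.prod isCompact_uIcc)).mono_set
        (prod_mono uIoc_subset_uIcc uIoc_subset_uIcc)
  have h2 : ∫ β in (0 : ℝ)..2 * π, f β = 2 * ∫ β in (0 : ℝ)..π, f β := by
    rw [← intervalIntegral.integral_add_adjacent_intervals (hi 0 π) (hi π (2 * π))]
    have : ∫ β in π..2 * π, f β = ∫ β in (0 : ℝ)..π, f (β + π) := by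
      rw [intervalIntegral.integral_comp_add_right]; congr 1 <;> ring
    rw [this, two_mul]
    congr 1
    refine intervalIntegral.integral_congr fun β _ => ?_
    simp only [hf, Real.sin_add_pi, mul_neg, Real.sinc_neg]
  have h3 : ∫ β in (0 : ℝ)..π, f β = 2 * ∫ β in (0 : ℝ)..π / 2, f β := by
    rw [← intervalIntegral.integral_add_adjacent_intervals (hi 0 (π / 2)) (hi (π / 2) π)]
    have : ∫ β in π / 2..π, f β = ∫ β in (0 : ℝ)..π / 2, f (π - β) := by
      rw [intervalIntegral.integral_comp_sub_left]; congr 1 <;> ring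
    rw [this, two_mul]
    congr 1
    refine intervalIntegral.integral_congr fun β _ => ?_
    simp only [hf, Real.sin_pi_sub]
  rw [h1, h2, h3]
  field_simp

lemma tendsto_integral_besselJ_zero :
    Tendsto (fun x => ∫ t in (0 : ℝ)..x, besselJ 0 t) atTop (𝓝 1) := by
  have h := tendsto_integral_sinc_sin.const_mul (2 / π)
  have e : 2 / π * (π / 2) = 1 := by field_simp
  rw [e] at h
  exact h.congr fun x => (integral_besselJ_zero x).symm

/-- The improper integral of a product of two Bessel functions. -/
lemma tendsto_integral_besselJ_mul {b : ℝ} (hb : b ∈ Ioo (0 : ℝ) 1) (n : ℕ) :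
    Tendsto (fun R : ℝ => ((∫ t in (0 : ℝ)..R, besselJ n (b * t) * besselJ n t : ℝ) : ℂ)) atTop
      (𝓝 (Bn b n)) := by
  set J : ℝ → ℝ := fun x => ∫ t in (0 : ℝ)..x, besselJ 0 t with hJ
  have hJc : Continuous J := intervalIntegral.continuous_primitive
    (fun a c => continuous_besselJ_zero.intervalIntegrable a c) 0
  have hr : ∀ φ, 0 < ‖cs φ - b‖ := norm_cs_sub_pos hb
  -- Integrating Neumann's formula in `t` first and rescaling by `r = |σ-b|` gives `J(Rr)/r`, where
  -- `J` is the primitive of `J_0`. As `J → 1`, only `1/r` survives in the limit.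
  have e : ∀ R : ℝ, ((∫ t in (0 : ℝ)..R, besselJ n (b * t) * besselJ n t : ℝ) : ℂ) =
      (2 * π : ℂ)⁻¹ * ∫ φ in (0 : ℝ)..2 * π,
        (J (R * ‖cs φ - b‖) : ℂ) * (cs φ ^ (-(n : ℤ)) / ‖cs φ - b‖) := by
    intro R
    rw [← intervalIntegral.integral_ofReal]
    push_cast
    simp only [besselJ_mul, intervalIntegral.integral_const_mul]
    congr 1
    rw [intervalIntegral_intervalIntegral_swap]
    · refine intervalIntegral.integral_congr fun φ _ => ?_
      simp only [intervalIntegral.integral_mul_const, intervalIntegral.integral_ofReal]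
      rw [intervalIntegral.integral_comp_mul_right (fun t => besselJ 0 t) (hr φ).ne', zero_mul]
      have : (‖cs φ - b‖ : ℂ) ≠ 0 := by exact_mod_cast (hr φ).ne'
      simp only [smul_eq_mul, hJ]
      push_cast
      field_simp
    · have h1 := continuous_cs_zpow (-(n : ℤ))
      have h2 := continuous_norm_cs_sub b
      have h3 := continuous_besselJ_zero
      have hF : Continuous (Function.uncurry fun t φ : ℝ =>
          (besselJ 0 (t * ‖cs φ - b‖) : ℂ) * cs φ ^ (-(n : ℤ))) :=
        (Complex.continuous_ofReal.comp (h3.comp (continuous_fst.mul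
          (h2.comp continuous_snd)))).mul (h1.comp continuous_snd)
      exact (hF.continuousOn.integrableOn_compact (isCompact_uIcc.prod isCompact_uIcc)).mono_set
        (prod_mono uIoc_subset_uIcc uIoc_subset_uIcc)
  simp only [e]
  rw [← Bn_neg, Bn]
  refine Tendsto.const_mul _ ?_
  have hK := continuous_Bn_integrand hb (-(n : ℤ))
  have hlim := tendsto_integral_besselJ_zero
  have hev : ∀ᶠ x in atTop, |J x| ≤ 2 := by
    filter_upwards [hlim.eventually (Metric.ball_mem_nhds 1 one_pos)] with x hx
    change dist (J x) 1 < 1 at hx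
    rw [Real.dist_eq] at hx
    have := abs_sub_lt_iff.1 hx
    exact abs_le.2 ⟨by linarith [this.1, this.2], by linarith [this.1, this.2]⟩
  obtain ⟨x₀, hx₀⟩ := eventually_atTop.1 hev
  refine intervalIntegral.tendsto_integral_filter_of_dominated_convergence
    (fun φ => 2 * ‖cs φ ^ (-(n : ℤ)) / (‖cs φ - b‖ : ℂ)‖) ?_ ?_ ?_ ?_
  · refine Eventually.of_forall fun R => Continuous.aestronglyMeasurable ?_
    exact (Complex.continuous_ofReal.comp (hJc.comp (continuous_const.mul
      (continuous_norm_cs_sub b)))).mul hK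
  -- Since `r ≥ 1 - b`, this choice puts `Rr` beyond `x₀` for all angles at once. The maximum with
  -- `0` ensures `R ≥ 0`.
  · filter_upwards [eventually_ge_atTop (max x₀ 0 / (1 - b))] with R hR
    refine Eventually.of_forall fun φ _ => ?_
    rw [norm_mul, Complex.norm_real]
    refine mul_le_mul_of_nonneg_right (hx₀ _ ?_) (norm_nonneg _)
    have h1b : 0 < 1 - b := sub_pos.2 hb.2
    rw [div_le_iff₀ h1b] at hR
    have hR0 : 0 ≤ R := by
      by_contra hneg
      nlinarith [le_max_right x₀ 0]
    calc x₀ ≤ R * (1 - b) := (le_max_left _ _).trans hR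
      _ ≤ R * ‖cs φ - b‖ := by gcongr; exact one_sub_le_norm hb φ
  · exact (continuous_const.mul hK.norm).intervalIntegrable _ _
  · refine Eventually.of_forall fun φ _ => ?_
    have h1 : Tendsto (fun R : ℝ => J (R * ‖cs φ - b‖)) atTop (𝓝 1) :=
      hlim.comp (tendsto_id.atTop_mul_const (hr φ))
    have h2 := ((Complex.continuous_ofReal.tendsto 1).comp h1).mul_const
      (cs φ ^ (-(n : ℤ)) / (‖cs φ - b‖ : ℂ))
    simpa using h2

/-- It is a limit of real integrals. -/
lemma Bn_im {b : ℝ} (hb : b ∈ Ioo (0 : ℝ) 1) (n : ℕ) : Bn b n = ((Bn b n).re : ℂ) := by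
  have h := (Complex.continuous_im.tendsto _).comp (tendsto_integral_besselJ_mul hb n)
  have h0 : (Bn b n).im = 0 := by
    refine tendsto_nhds_unique h ?_
    simp only [Function.comp_def, Complex.ofReal_im]
    exact tendsto_const_nhds
  exact Complex.ext rfl (by simp [h0])

lemma tendsto_integral_besselJ_mul_re {b : ℝ} (hb : b ∈ Ioo (0 : ℝ) 1) (n : ℕ) :
    Tendsto (fun R : ℝ => ∫ t in (0 : ℝ)..R, besselJ n (b * t) * besselJ n t) atTop
      (𝓝 (Bn b n).re) := by
  have h := (Complex.continuous_re.tendsto _).comp (tendsto_integral_besselJ_mul hb n)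
  simpa [Function.comp_def] using h

lemma Lam_eq {b : ℝ} (hb : b ∈ Ioo (0 : ℝ) 1) (n : ℕ) : Lam n b = (1 / b) * (Bn b n).re := by
  rw [Lam, (tendsto_integral_besselJ_mul_re hb n).limUnder_eq]

lemma b_mul_Lam {b : ℝ} (hb : b ∈ Ioo (0 : ℝ) 1) (n : ℕ) : (b : ℂ) * (Lam n b : ℂ) = Bn b n := by
  have h0 : (b : ℂ) ≠ 0 := by exact_mod_cast hb.1.ne'
  rw [Lam_eq hb, Bn_im hb]
  push_cast
  field_simp
  simp

lemma tendsto_Lam {b : ℝ} (hb : b ∈ Ioo (0 : ℝ) 1) (n : ℕ) :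
    Tendsto (fun R : ℝ => (1 / b) * ∫ t in (0 : ℝ)..R, besselJ n (b * t) * besselJ n t)
      atTop (𝓝 (Lam n b)) := by
  rw [Lam_eq hb]
  exact (tendsto_integral_besselJ_mul_re hb n).const_mul _

/-! ### Laurent series on rotation invariant domains -/

/-- Open sets that do not contain the origin. -/
structure IsPunctured (U : Set ℂ) : Prop where
  isOpen : IsOpen U
  ne_zero : ∀ z ∈ U, z ≠ 0

lemma isPunctured_extDom {ε : ℝ} (hε : 0 < ε) : IsPunctured (extDom ε) where
  isOpen := isOpen_extDom ε
  ne_zero _ hz := norm_pos_iff.1 (hε.trans hz)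

lemma isPunctured_annulus {ε : ℝ} (hε : 0 < ε) : IsPunctured (annulus ε) where
  isOpen := isOpen_annulus ε
  ne_zero _ hz := norm_pos_iff.1 (hε.trans hz.1)

/-- The function `u` is the sum of the Laurent series with coefficients `c` on `U`. -/
def Laurent (U : Set ℂ) (c : ℤ → ℂ) (u : ℂ → ℂ) : Prop :=
  ∀ z ∈ U, HasSum (fun n => c n * z ^ n) (u z)

/-- The coefficients of the derivative of a Laurent series. -/
def dcoef (c : ℤ → ℂ) (n : ℤ) : ℂ := (n + 1) * c (n + 1)

lemma dcoef_iterate (k : ℕ) (c : ℤ → ℂ) (n : ℤ) :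
    dcoef^[k] c n = (∏ j ∈ Finset.range k, (n + 1 + j : ℂ)) * c (n + k) := by
  induction k generalizing n with
  | zero => simp
  | succ k ih =>
    rw [Function.iterate_succ_apply', dcoef, ih, Finset.prod_range_succ']
    have e : n + 1 + (k : ℤ) = n + ((k + 1 : ℕ) : ℤ) := by push_cast; ring
    have e2 : ∀ j : ℕ, ((n + 1 : ℤ) : ℂ) + 1 + j = n + 1 + ((j + 1 : ℕ) : ℂ) := fun j => by
      push_cast; ring
    simp only [e, e2]
    push_cast
    ring

lemma norm_zpow_le_add {r s : ℝ} {w : ℂ} (hr : 0 < r) (h1 : r ≤ ‖w‖) (h2 : ‖w‖ ≤ s) (n : ℤ) :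
    ‖w ^ n‖ ≤ r ^ n + s ^ n := by
  have hw := hr.trans_le h1
  have hs := hw.trans_le h2
  rw [norm_zpow]
  rcases le_total 0 n with hn | hn
  · have := zpow_le_zpow_left₀ hn hw.le h2
    have := zpow_nonneg hr.le n
    linarith
  · obtain ⟨m, rfl⟩ := Int.exists_eq_neg_ofNat hn
    have h3 : ‖w‖ ^ (-(m : ℤ)) ≤ r ^ (-(m : ℤ)) := by
      simp only [zpow_neg, zpow_natCast]
      gcongr
    have := zpow_nonneg hs.le (-(m : ℤ))
    linarith

section Laurent

variable {U : Set ℂ} {c : ℤ → ℂ} {u : ℂ → ℂ}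

lemma Laurent.summable_norm (h : Laurent U c u) {z : ℂ} (hz : z ∈ U) :
    Summable fun n => ‖c n * z ^ n‖ := (h z hz).summable.norm

/-- Near `z` each power is dominated by the sum of its moduli at `(1-t)z` and `(1+t)z`, two points
of `U` where the series converges absolutely. This gives local normal convergence and hence termwise
differentiation, without any assumption on the shape of `U`. -/
lemma Laurent.exists_bound (hU : IsPunctured U) (h : Laurent U c u) {z : ℂ} (hz : z ∈ U) :
    ∃ V ⊆ U, IsOpen V ∧ z ∈ V ∧ ∃ B : ℤ → ℝ, Summable B ∧ ∀ n, ∀ w ∈ V, ‖c n * w ^ n‖ ≤ B n := by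
  have hz0 := norm_pos_iff.2 (hU.ne_zero z hz)
  have hcont : Continuous fun t : ℝ => (1 + t : ℂ) * z := by fun_prop
  have h0 : ∀ᶠ t : ℝ in 𝓝 0, (1 + t : ℂ) * z ∈ U :=
    hcont.continuousAt.eventually_mem (hU.isOpen.mem_nhds (by simpa using hz))
  obtain ⟨δ, hδ, hball⟩ := Metric.eventually_nhds_iff.1 h0
  set t : ℝ := min (δ / 2) (1 / 2) with ht
  have ht0 : 0 < t := by positivity
  have htδ : t < δ := (min_le_left _ _).trans_lt (by linarith)
  have ht1 : t ≤ 1 / 2 := min_le_right _ _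
  have h1 : (1 + ((-t : ℝ) : ℂ)) * z ∈ U := hball (by simpa [abs_of_pos ht0] using htδ)
  have h2 : (1 + (t : ℂ)) * z ∈ U := hball (by simpa [abs_of_pos ht0] using htδ)
  have n1 : ‖(1 + ((-t : ℝ) : ℂ)) * z‖ = (1 - t) * ‖z‖ := by
    have : (1 + ((-t : ℝ) : ℂ)) = ((1 - t : ℝ) : ℂ) := by push_cast; ring
    rw [norm_mul, this, Complex.norm_real, Real.norm_of_nonneg (by linarith)]
  have n2 : ‖(1 + (t : ℂ)) * z‖ = (1 + t) * ‖z‖ := by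
    have : (1 + (t : ℂ)) = ((1 + t : ℝ) : ℂ) := by push_cast; ring
    rw [norm_mul, this, Complex.norm_real, Real.norm_of_nonneg (by linarith)]
  have hlt1 : (1 - t) * ‖z‖ < ‖z‖ := by nlinarith
  have hlt2 : ‖z‖ < (1 + t) * ‖z‖ := by nlinarith
  have hpos : 0 < (1 - t) * ‖z‖ := mul_pos (by linarith) hz0
  refine ⟨U ∩ {w | (1 - t) * ‖z‖ < ‖w‖ ∧ ‖w‖ < (1 + t) * ‖z‖}, inter_subset_left,
    hU.isOpen.inter ((isOpen_lt continuous_const continuous_norm).inter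
      (isOpen_lt continuous_norm continuous_const)), ⟨hz, hlt1, hlt2⟩, _,
    (h.summable_norm h1).add (h.summable_norm h2), fun n w hw => ?_⟩
  have := norm_zpow_le_add hpos hw.2.1.le hw.2.2.le n
  rw [norm_mul, norm_mul, norm_mul, norm_zpow _ n, norm_zpow _ n, norm_zpow _ n, n1, n2,
    ← mul_add]
  rw [norm_zpow] at this
  gcongr

lemma Laurent.eventuallyEq (hU : IsPunctured U) (h : Laurent U c u) {z : ℂ} (hz : z ∈ U) :
    u =ᶠ[𝓝 z] fun w => ∑' n, c n * w ^ n := by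
  filter_upwards [hU.isOpen.mem_nhds hz] with w hw using (h w hw).tsum_eq.symm

lemma differentiableOn_term (hU : IsPunctured U) (c : ℤ → ℂ) (n : ℤ) {V : Set ℂ} (hV : V ⊆ U) :
    DifferentiableOn ℂ (fun w : ℂ => c n * w ^ n) V := fun w hw =>
  ((differentiableAt_zpow.2 (Or.inl (hU.ne_zero w (hV hw)))).const_mul _).differentiableWithinAt

lemma Laurent.differentiableOn (hU : IsPunctured U) (h : Laurent U c u) :
    DifferentiableOn ℂ u U := by
  intro z hz
  obtain ⟨V, hVU, hV, hzV, B, hB, hb⟩ := h.exists_bound hU hz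
  have := (differentiableOn_tsum_of_summable_norm hB (fun n => differentiableOn_term hU c n hVU)
    hV hb).differentiableAt (hV.mem_nhds hzV)
  exact (this.congr_of_eventuallyEq (h.eventuallyEq hU hz)).differentiableWithinAt

lemma Laurent.hasSum_deriv (hU : IsPunctured U) (h : Laurent U c u) {z : ℂ} (hz : z ∈ U) :
    HasSum (fun n : ℤ => c n * (n * z ^ (n - 1))) (deriv u z) := by
  obtain ⟨V, hVU, hV, hzV, B, hB, hb⟩ := h.exists_bound hU hz
  have := hasSum_deriv_of_summable_norm hB (fun n => differentiableOn_term hU c n hVU) hV hb hzV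
  rw [(h.eventuallyEq hU hz).deriv_eq]
  refine this.congr_fun fun n => ?_
  rw [deriv_const_mul _ (differentiableAt_zpow.2 (Or.inl (hU.ne_zero z hz))), deriv_zpow]

lemma Laurent.hasSum_mul_deriv (hU : IsPunctured U) (h : Laurent U c u) {z : ℂ} (hz : z ∈ U) :
    HasSum (fun n : ℤ => n * c n * z ^ n) (z * deriv u z) := by
  refine ((h.hasSum_deriv hU hz).mul_left z).congr_fun fun n => ?_
  rw [zpow_sub_one₀ (hU.ne_zero z hz)]
  have := hU.ne_zero z hz
  field_simp

lemma Laurent.deriv (hU : IsPunctured U) (h : Laurent U c u) : Laurent U (dcoef c) (deriv u) := by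
  intro z hz
  have := (Equiv.addRight (1 : ℤ)).hasSum_iff.2 (h.hasSum_deriv hU hz)
  refine this.congr_fun fun n => ?_
  simp only [Function.comp_apply, Equiv.coe_addRight, add_sub_cancel_right, dcoef]
  push_cast
  ring

lemma Laurent.iteratedDeriv (hU : IsPunctured U) (h : Laurent U c u) (k : ℕ) :
    Laurent U (dcoef^[k] c) (iteratedDeriv k u) := by
  induction k with
  | zero => simpa using h
  | succ k ih =>
    rw [Function.iterate_succ_apply', iteratedDeriv_succ]
    exact ih.deriv hU

lemma Laurent.hasSum_circle (h : Laurent U c u) {r : ℝ} (hr : r ∈ radii U) {ω : ℂ}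
    (hω : ‖ω‖ = 1) : HasSum (fun n => (c n * (r : ℂ) ^ n) * ω ^ n) (u (r * ω)) := by
  refine (h _ (hr.2 ω hω)).congr_fun fun n => ?_
  rw [mul_zpow, mul_assoc]

lemma Laurent.summable_circle (h : Laurent U c u) {r : ℝ} (hr : r ∈ radii U) :
    Summable fun n => ‖c n * (r : ℂ) ^ n‖ := by
  have := h.summable_norm (hr.2 1 norm_one)
  simpa using this

lemma Laurent.summable_circle_mul (hU : IsPunctured U) (h : Laurent U c u) {r : ℝ}
    (hr : r ∈ radii U) : Summable fun n : ℤ => ‖c n * (r : ℂ) ^ n‖ * |(n : ℝ)| := by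
  have := (h.hasSum_mul_deriv hU (hr.2 1 norm_one)).summable.norm
  refine this.congr fun n => ?_
  rw [mul_one, mul_assoc, norm_mul, mul_comm, ← Complex.ofReal_intCast, Complex.norm_real,
    Real.norm_eq_abs]

end Laurent

/-! ### Parseval's identity and the logarithmic multiplier -/

section Parseval

variable {d : ℤ → ℂ}

lemma continuous_cs_comp (hd : Summable fun n => ‖d n‖) {v : ℂ → ℂ}
    (h : ∀ ω, ‖ω‖ = 1 → HasSum (fun n => d n * ω ^ n) (v ω)) :
    Continuous fun θ => v (cs θ) := by
  have e : (fun θ => v (cs θ)) = fun θ => ∑' n, d n * cs θ ^ n :=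
    funext fun θ => (h _ (norm_cm θ)).tsum_eq.symm
  rw [e]
  refine continuous_tsum (fun n => continuous_const.mul (continuous_cs_zpow n)) hd fun n θ => ?_
  rw [norm_mul, norm_cs_zpow, mul_one]

lemma summable_sq_of_summable_norm {ι : Type*} {f : ι → ℂ} (hf : Summable fun n => ‖f n‖) :
    Summable fun n => ‖f n‖ ^ 2 := by
  have h := hf.tendsto_cofinite_zero
  refine Summable.of_norm_bounded_eventually hf ?_
  filter_upwards [h.eventually_lt_const one_pos] with n hn
  rw [Real.norm_of_nonneg (by positivity)]
  nlinarith [norm_nonneg (f n)]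

/-- `|v|²` is a double series with exponents `p.1 - p.2`; its zeroth Fourier coefficient collects
the diagonal. -/
lemma integral_norm_sq (hd : Summable fun n => ‖d n‖) {v : ℂ → ℂ}
    (h : ∀ ω, ‖ω‖ = 1 → HasSum (fun n => d n * ω ^ n) (v ω)) :
    ∫ θ in (0 : ℝ)..2 * π, ‖v (cs θ)‖ ^ 2 = 2 * π * ∑' n, ‖d n‖ ^ 2 := by
  have h1 : ∀ θ : ℝ, HasSum (fun p : ℤ × ℤ => (d p.1 * conj (d p.2)) * cs θ ^ (p.1 - p.2))
      ((‖v (cs θ)‖ ^ 2 : ℝ) : ℂ) := by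
    intro θ
    have a : HasSum (fun n => d n * cs θ ^ n) (v (cs θ)) := h _ (norm_cm θ)
    have a' : HasSum (fun n => conj (d n * cs θ ^ n)) (conj (v (cs θ))) :=
      a.map (starRingEnd ℂ).toAddMonoidHom Complex.continuous_conj
    have hn : Summable fun n => ‖d n * cs θ ^ n‖ := by
      simpa only [norm_mul, norm_cs_zpow, mul_one] using hd
    have hn' : Summable fun n => ‖conj (d n * cs θ ^ n)‖ := by
      simpa only [RCLike.norm_conj] using hn
    have hp' := hasSum_mul_of_summable_norm a a' hn hn'
    have e : v (cs θ) * conj (v (cs θ)) = ((‖v (cs θ)‖ ^ 2 : ℝ) : ℂ) := by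
      rw [Complex.mul_conj, Complex.normSq_eq_norm_sq]
    rw [e] at hp'
    refine hp'.congr_fun fun p => ?_
    rw [map_mul, map_zpow₀, conj_cs, zpow_sub₀ (cs_ne_zero θ), inv_zpow]
    ring
  have hs : Summable fun p : ℤ × ℤ => ‖d p.1 * conj (d p.2)‖ := by
    refine (hd.mul_of_nonneg hd (fun _ => norm_nonneg _) fun _ => norm_nonneg _).congr fun p => ?_
    rw [norm_mul, RCLike.norm_conj]
  have h2 := hasSum_fourierCoeff hs (fun p => p.1 - p.2) h1 0
  have hinj : Function.Injective fun n : ℤ => (n, n) := fun a b hab => (Prod.ext_iff.1 hab).1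
  have h3 := (hinj.hasSum_iff (f := fun p : ℤ × ℤ =>
      if p.1 - p.2 = 0 then d p.1 * conj (d p.2) else 0) ?_).2 h2
  swap
  · intro p hp
    refine if_neg fun h0 => hp ⟨p.1, ?_⟩
    exact Prod.ext rfl (sub_eq_zero.1 h0)
  have h4 := Complex.hasSum_ofReal.2 (summable_sq_of_summable_norm hd).hasSum
  have h5 : HasSum (fun n => ((‖d n‖ ^ 2 : ℝ) : ℂ))
      ((2 * π : ℂ)⁻¹ * ∫ θ in (0 : ℝ)..2 * π, ((‖v (cs θ)‖ ^ 2 : ℝ) : ℂ) * cs θ ^ (-(0 : ℤ))) := by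
    refine h3.congr_fun fun n => ?_
    rw [Function.comp_apply, if_pos (sub_self _), Complex.mul_conj, Complex.normSq_eq_norm_sq]
  have h6 := h4.unique h5
  simp only [neg_zero, zpow_zero, mul_one, intervalIntegral.integral_ofReal] at h6
  have hpi : (π : ℂ) ≠ 0 := by exact_mod_cast Real.pi_ne_zero
  have h7 : ((2 * π * ∑' n, ‖d n‖ ^ 2 : ℝ) : ℂ) =
      ((∫ θ in (0 : ℝ)..2 * π, ‖v (cs θ)‖ ^ 2 : ℝ) : ℂ) := by
    push_cast
    push_cast at h6
    rw [h6]
    field_simp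
  exact_mod_cast h7.symm

lemma eL2_eq (hd : Summable fun n => ‖d n‖) {v : ℂ → ℂ}
    (h : ∀ ω, ‖ω‖ = 1 → HasSum (fun n => d n * ω ^ n) (v ω)) :
    eL2 v = ENNReal.ofReal (√(2 * π * ∑' n, ‖d n‖ ^ 2)) := by
  have hc := continuous_cs_comp hd h
  have hm : MemLp (fun θ => v (cs θ)) 2 (volume.restrict (Ioc 0 (2 * π))) := by
    refine MemLp.of_bound hc.aestronglyMeasurable (∑' n, ‖d n‖) (Eventually.of_forall fun θ => ?_)
    refine (h _ (norm_cm θ)).norm_le_of_bounded hd.hasSum fun n => ?_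
    rw [norm_mul, norm_cs_zpow, mul_one]
  rw [eL2, hm.eLpNorm_eq_integral_rpow_norm (by norm_num) (by norm_num)]
  congr 1
  rw [← integral_norm_sq hd h, intervalIntegral.integral_of_le Real.two_pi_pos.le,
    Real.sqrt_eq_rpow]
  norm_num

/-- Rotating the variable makes the kernel `1/|σ-1|` independent of `ω`, so `z^n` is multiplied by
`sing n`. The factor `I` comes from `dτ/τ = i dθ`. -/
lemma Laurent.logOp {U : Set ℂ} {c : ℤ → ℂ} {u : ℂ → ℂ} (hU : IsPunctured U) (h : Laurent U c u)
    {r : ℝ} (hr : r ∈ radii U) {ω : ℂ} (hω : ‖ω‖ = 1) :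
    HasSum (fun n => (c n * (r : ℂ) ^ n * (I * sing n)) * ω ^ n) (logOp u r ω) := by
  obtain ⟨φ, rfl⟩ : ∃ φ : ℝ, ω = cs φ := ⟨ω.arg, by
    rw [cs_eq]; simpa [hω] using (Complex.norm_mul_exp_arg_mul_I ω).symm⟩
  have hadd : ∀ θ, cs (θ + φ) = cs θ * cs φ := fun θ => by
    simp only [cs_eq, ← Complex.exp_add]; push_cast; ring_nf
  set g : ℝ → ℂ := fun θ => (u (r * cs θ) - u (r * cs φ)) / (‖cs θ - cs φ‖ : ℂ) with hg
  have e1 : VStates.logOp u r (cs φ) = I * ∫ θ in (0 : ℝ)..2 * π, g (θ + φ) := by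
    rw [integral_shift (fun θ => by simp only [hg, cs_add_two_pi]), VStates.logOp, circleIntegral,
      ← intervalIntegral.integral_const_mul]
    refine intervalIntegral.integral_congr fun θ _ => ?_
    simp only [deriv_circleMap, hg, smul_eq_mul]
    have := cs_ne_zero θ
    field_simp
  rw [e1]
  have e2 : ∀ θ, HasSum (fun n => (c n * (r : ℂ) ^ n * cs φ ^ n) * singKer n θ) (g (θ + φ)) := by
    intro θ
    have h1 := (h.hasSum_circle hr (norm_cm (θ + φ))).sub (h.hasSum_circle hr (norm_cm φ))
    have h2 := h1.div_const (‖cs (θ + φ) - cs φ‖ : ℂ)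
    refine h2.congr_fun fun n => ?_
    have h3 : ‖cs (θ + φ) - cs φ‖ = ‖cs θ - 1‖ := by
      rw [hadd, ← sub_one_mul, norm_mul, norm_cm, mul_one]
    change _ = (c n * (r : ℂ) ^ n * cs (θ + φ) ^ n - c n * (r : ℂ) ^ n * cs φ ^ n) / _
    rw [h3, hadd, mul_zpow, singKer]
    ring
  have h3 := hasSum_integral_of_bound (x := 0) (y := 2 * π) (h.summable_circle_mul hU hr)
    (F := fun n θ => (c n * (r : ℂ) ^ n * cs φ ^ n) * singKer n θ)
    (fun n => (measurable_singKer n).const_mul _) (fun n θ _ => by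
      rw [norm_mul, norm_mul, norm_cs_zpow, mul_one]
      gcongr
      exact norm_singKer_le n θ) (fun θ _ => e2 θ)
  refine (h3.mul_left I).congr_fun fun n => ?_
  rw [intervalIntegral.integral_const_mul, sing]
  ring

lemma norm_sing_le (n : ℤ) : ‖sing n‖ ≤ 2 * π * |(n : ℝ)| := by
  refine (intervalIntegral.norm_integral_le_of_norm_le_const
    (fun θ _ => norm_singKer_le n θ)).trans_eq ?_
  rw [sub_zero, abs_of_pos Real.two_pi_pos, mul_comm]

end Parseval

lemma HasSum.congr_both {ι E : Type*} [AddCommMonoid E] [TopologicalSpace E] {f g : ι → E}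
    {a b : E} (h : HasSum f a) (hf : ∀ n, g n = f n) (hab : b = a) : HasSum g b := by
  rw [hab]
  exact h.congr_fun hf

/-! ### Fourier coefficients of the elements of `X` -/

/-- The Fourier coefficients of a function on the unit circle. -/
def cf (u : ℂ → ℂ) (m : ℤ) : ℂ := (2 * π : ℂ)⁻¹ * ∫ θ in (0 : ℝ)..2 * π, u (cs θ) * cs θ ^ (-m)

/-- On a domain containing the unit circle the coefficients are determined by the function there.
This makes `cf` a canonical choice, from which linearity follows. -/
lemma Laurent.coef_eq {U : Set ℂ} {c : ℤ → ℂ} {u : ℂ → ℂ} (h : Laurent U c u)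
    (hU : (1 : ℝ) ∈ radii U) : c = cf u := by
  funext m
  have h1 := h.summable_circle hU
  simp only [Complex.ofReal_one, one_zpow, mul_one] at h1
  have h2 : ∀ θ, HasSum (fun n => c n * cs θ ^ n) (u (cs θ)) := fun θ => by
    have := h.hasSum_circle hU (norm_cm θ)
    simpa only [Complex.ofReal_one, one_zpow, mul_one, one_mul] using this
  have h3 := hasSum_fourierCoeff h1 (fun n => n) h2 m
  have h4 := hasSum_ite_eq m (c m)
  refine (h4.congr_fun fun n => ?_).unique h3
  split_ifs with h
  · rw [h]
  · rfl

lemma mem_radii_extDom {ε r : ℝ} (hε : 0 < ε) (hr : ε < r) : r ∈ radii (extDom ε) := by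
  refine ⟨(hε.trans hr).le, fun ω hω => ?_⟩
  change ε < ‖_‖
  rwa [norm_mul, hω, mul_one, Complex.norm_real, Real.norm_of_nonneg (hε.trans hr).le]

section X

variable {ε : ℝ} {k : ℕ}


lemma exists_laurent (f : X ε k) : ∃ c : ℤ → ℂ, Laurent (extDom ε) c f ∧
    (∀ n, conj (c n) = c n) ∧ ∀ n, 0 ≤ n → c n = 0 := by
  obtain ⟨a, ha⟩ := f.2.1.2.2
  have hinj : Function.Injective fun n : ℕ+ => -((n : ℕ) : ℤ) := fun m n h => by
    simpa using h
  set c : ℤ → ℂ := Function.extend (fun n : ℕ+ => -((n : ℕ) : ℤ)) (fun n => (a n : ℂ)) 0 with hc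
  have hc1 : ∀ n : ℕ+, c (-((n : ℕ) : ℤ)) = a n := fun n => hinj.extend_apply _ _ _
  have hc2 : ∀ n, n ∉ range (fun n : ℕ+ => -((n : ℕ) : ℤ)) → c n = 0 := fun n hn =>
    Function.extend_apply' _ _ _ hn
  refine ⟨c, fun z hz => ?_, fun n => ?_, fun n hn => hc2 n ?_⟩
  · refine (hinj.hasSum_iff fun n hn => ?_).1 ((ha z hz).congr_fun fun n => ?_)
    · rw [hc2 n hn, zero_mul]
    · rw [Function.comp_apply, hc1, zpow_neg, zpow_natCast]
  · by_cases hn : n ∈ range (fun n : ℕ+ => -((n : ℕ) : ℤ))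
    · obtain ⟨m, rfl⟩ := hn
      rw [hc1, Complex.conj_ofReal]
    · rw [hc2 n hn, map_zero]
  · rintro ⟨m, rfl⟩
    have := m.pos
    simp only at hn
    omega

lemma laurent_cf (hε : ε ∈ Ioo (0 : ℝ) 1) (f : X ε k) : Laurent (extDom ε) (cf f) f := by
  obtain ⟨c, h, -⟩ := exists_laurent f
  rwa [← h.coef_eq (mem_radii_extDom hε.1 hε.2)]

lemma conj_cf (hε : ε ∈ Ioo (0 : ℝ) 1) (f : X ε k) (n : ℤ) : conj (cf f n) = cf f n := by
  obtain ⟨c, h, h1, -⟩ := exists_laurent f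
  rw [← h.coef_eq (mem_radii_extDom hε.1 hε.2)]
  exact h1 n

lemma cf_eq_zero (hε : ε ∈ Ioo (0 : ℝ) 1) (f : X ε k) {n : ℤ} (hn : 0 ≤ n) : cf f n = 0 := by
  obtain ⟨c, h, -, h1⟩ := exists_laurent f
  rw [← h.coef_eq (mem_radii_extDom hε.1 hε.2)]
  exact h1 n hn

lemma cf_add (hε : ε ∈ Ioo (0 : ℝ) 1) (f g : X ε k) : cf (f + g : X ε k) = cf f + cf g := by
  have h : Laurent (extDom ε) (cf f + cf g) (f + g : X ε k) := fun z hz => by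
    refine (((laurent_cf hε f) z hz).add (laurent_cf hε g z hz)).congr_fun fun n => ?_
    rw [Pi.add_apply, add_mul]
  exact (h.coef_eq (mem_radii_extDom hε.1 hε.2)).symm

lemma cf_smul (hε : ε ∈ Ioo (0 : ℝ) 1) (t : ℝ) (f : X ε k) : cf (t • f : X ε k) = (t : ℂ) • cf f := by
  have h : Laurent (extDom ε) ((t : ℂ) • cf f) (t • f : X ε k) := fun z hz => by
    have h1 := ((laurent_cf hε f) z hz).mul_left (t : ℂ)
    have e : (t • f : X ε k) z = (t : ℂ) * f z := Complex.real_smul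
    rw [e]
    refine h1.congr_fun fun n => ?_
    rw [Pi.smul_apply, smul_eq_mul, mul_assoc]
  exact (h.coef_eq (mem_radii_extDom hε.1 hε.2)).symm

lemma hasSum_cf (hε : ε ∈ Ioo (0 : ℝ) 1) (f : X ε k) {ω : ℂ} (hω : ‖ω‖ = 1) : HasSum (fun n => cf f n * ω ^ n) (f ω) :=
  laurent_cf hε f ω (by change ε < ‖ω‖; rw [hω]; exact hε.2)

lemma hasSum_mul_cf (hε : ε ∈ Ioo (0 : ℝ) 1) (f : X ε k) {ω : ℂ} (hω : ‖ω‖ = 1) :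
    HasSum (fun n : ℤ => n * cf f n * ω ^ n) (ω * deriv f ω) :=
  (laurent_cf hε f).hasSum_mul_deriv (isPunctured_extDom hε.1)
    (by change ε < ‖ω‖; rw [hω]; exact hε.2)

lemma ofReal_norm_X (f : X ε k) : ENNReal.ofReal ‖f‖ = XeNorm ε k f :=
  ENNReal.ofReal_toReal f.2.2.ne

/-- Parseval on the circle of radius `r`, restricted to finitely many terms so that `r` can
afterwards tend to `ε`. Only the logarithmic part of the norm of `X` is used. -/
lemma sum_logOp_le (hε : ε ∈ Ioo (0 : ℝ) 1) (f : X ε k) (F : Finset ℤ) {r : ℝ} (hr : ε < r) :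
    ∑ n ∈ F, ‖dcoef^[k] (cf f) n * (r : ℂ) ^ n * sing n‖ ^ 2 ≤ ‖f‖ ^ 2 := by
  have hU := isPunctured_extDom hε.1
  have hr' := mem_radii_extDom hε.1 hr
  have hL := (laurent_cf hε f).iteratedDeriv hU k
  have hs : Summable fun n => ‖dcoef^[k] (cf f) n * (r : ℂ) ^ n * (I * sing n)‖ := by
    refine Summable.of_nonneg_of_le (fun _ => norm_nonneg _) (fun n => ?_)
      ((hL.summable_circle_mul hU hr').mul_left (2 * π))
    rw [norm_mul, norm_mul I, Complex.norm_I, one_mul]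
    have := mul_le_mul_of_nonneg_left (norm_sing_le n)
      (norm_nonneg (dcoef^[k] (cf f) n * (r : ℂ) ^ n))
    linarith
  have h1 := eL2_eq hs fun ω hω => hL.logOp hU hr' hω
  have h2 : eL2 (logOp (iteratedDeriv k f) r) ≤ ENNReal.ofReal ‖f‖ := by
    rw [ofReal_norm_X, XeNorm]
    exact (le_iSup₂ (f := fun r (_ : r ∈ radii (extDom ε)) =>
      eL2 (logOp (iteratedDeriv k f) r)) r hr').trans le_add_self
  rw [h1, ENNReal.ofReal_le_ofReal_iff (norm_nonneg _), Real.sqrt_le_left (norm_nonneg _)] at h2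
  have h3 := (summable_sq_of_summable_norm hs).sum_le_tsum F fun _ _ => sq_nonneg _
  have h4 : 1 ≤ 2 * π := by linarith [Real.two_le_pi]
  have h5 : 0 ≤ ∑' n, ‖dcoef^[k] (cf f) n * (r : ℂ) ^ n * (I * sing n)‖ ^ 2 :=
    tsum_nonneg fun _ => sq_nonneg _
  have h6 : ∀ n, ‖dcoef^[k] (cf f) n * (r : ℂ) ^ n * (I * sing n)‖ =
      ‖dcoef^[k] (cf f) n * (r : ℂ) ^ n * sing n‖ := fun n => by
    rw [norm_mul, norm_mul I, Complex.norm_I, one_mul, ← norm_mul]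
  simp only [h6] at h2 h3 h5
  nlinarith

/-- A finite sum is continuous in `r`, so the bound passes to the boundary circle. -/
lemma sum_boundary_le (hε : ε ∈ Ioo (0 : ℝ) 1) (f : X ε k) (F : Finset ℤ) :
    ∑ n ∈ F, ‖dcoef^[k] (cf f) n * (ε : ℂ) ^ n * sing n‖ ^ 2 ≤ ‖f‖ ^ 2 := by
  have hc : ContinuousAt (fun r : ℝ => ∑ n ∈ F,
      ‖dcoef^[k] (cf f) n * (r : ℂ) ^ n * sing n‖ ^ 2) ε := by
    refine tendsto_finsetSum _ fun n _ => ?_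
    have h0 : (ε : ℂ) ≠ 0 := by exact_mod_cast hε.1.ne'
    have h1 : ContinuousAt (fun r : ℝ => (r : ℂ) ^ n) ε :=
      (continuousAt_zpow₀ (ε : ℂ) n (Or.inl h0)).comp Complex.continuous_ofReal.continuousAt
    exact ((continuousAt_const.mul h1).mul continuousAt_const).norm.pow 2
  refine le_of_tendsto (hc.tendsto.mono_left (nhdsWithin_le_nhds (s := Ioi ε))) ?_
  filter_upwards [self_mem_nhdsWithin] with r hr using sum_logOp_le hε f F hr

lemma norm_prod_ge (m : ℕ) : (m : ℝ) ^ k ≤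
    ‖∏ j ∈ Finset.range k, (((-(m : ℤ) - k : ℤ) : ℂ) + 1 + j)‖ := by
  rw [norm_prod]
  have h : ∏ j ∈ Finset.range k, (m : ℝ) = (m : ℝ) ^ k := by simp
  rw [← h]
  refine Finset.prod_le_prod (fun _ _ => Nat.cast_nonneg m) fun j hj => ?_
  have hj' := Finset.mem_range.1 hj
  have e : (((-(m : ℤ) - k : ℤ) : ℂ) + 1 + j) = -((m + (k - 1 - j) : ℕ) : ℂ) := by
    have h1 : ((k - 1 - j : ℕ) : ℂ) = k - 1 - j := by
      rw [Nat.cast_sub (by omega), Nat.cast_sub (by omega)]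
      simp
    rw [Nat.cast_add, h1]
    push_cast
    ring
  rw [e, norm_neg, Complex.norm_natCast]
  push_cast
  linarith [(Nat.cast_nonneg (k - 1 - j) : (0 : ℝ) ≤ ((k - 1 - j : ℕ) : ℝ))]

/-- Only negative indices `n = -m` matter. There the `k`-fold derivative contributes at least `m^k`
and `sing` contributes `lam (m + k) ≥ 2 log(1+m)`. Because `m ≥ 1`, the constant in `1 + log(1+m)`
is absorbed, so the last part of the norm alone controls the whole weight. -/
lemma norm_vt_mul_cf_le (hε : ε ∈ Ioo (0 : ℝ) 1) (hk : 1 ≤ k) (f : X ε k) (n : ℤ) :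
    ‖(vt (k - 1) ε⁻¹ n : ℂ) * cf f n‖ ≤
      2 ^ (k + 1) * ‖dcoef^[k] (cf f) (n - k) * (ε : ℂ) ^ (n - k) * sing (n - k)‖ := by
  rcases le_or_gt 0 n with hn | hn
  · rw [cf_eq_zero hε f hn, mul_zero, norm_zero]
    positivity
  obtain ⟨m, rfl⟩ := Int.exists_eq_neg_ofNat hn.le
  have hm : 1 ≤ m := by omega
  have hm' : (1 : ℝ) ≤ m := by exact_mod_cast hm
  have h1ε : 1 < ε⁻¹ := (one_lt_inv₀ hε.1).2 hε.2
  have e1 : (-(m : ℤ) - k : ℤ) + k = -(m : ℤ) := by ring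
  have e2 : ‖sing (-(m : ℤ) - k)‖ = lam (m + k) := by
    have h := sing_neg_natCast (m + k)
    have e : (-((m + k : ℕ) : ℤ)) = -(m : ℤ) - k := by push_cast; ring
    rw [e] at h
    rw [h, norm_neg, Complex.norm_real, Real.norm_of_nonneg]
    unfold lam
    positivity
  have e3 : ‖(ε : ℂ) ^ (-(m : ℤ) - k)‖ = ε⁻¹ ^ m * ε⁻¹ ^ k := by
    rw [norm_zpow, Complex.norm_real, Real.norm_of_nonneg hε.1.le, zpow_sub₀ hε.1.ne', zpow_neg,
      zpow_natCast, zpow_natCast, inv_pow, inv_pow, div_eq_mul_inv]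
  have e4 : vt (k - 1) ε⁻¹ (-(m : ℤ)) = (1 + m) ^ k * (1 + Real.log (1 + m)) * ε⁻¹ ^ m := by
    unfold vt wt
    have : |((-(m : ℤ) : ℤ) : ℝ)| = m := by push_cast; rw [abs_neg, Nat.abs_cast]
    rw [this, Int.natAbs_neg, Int.natAbs_natCast]
    obtain ⟨l, rfl⟩ : ∃ l, k = l + 1 := ⟨k - 1, by omega⟩
    rw [Nat.add_sub_cancel]
    ring
  rw [dcoef_iterate, e1, norm_mul, norm_mul, norm_mul, norm_mul, e2, e3, Complex.norm_real,
    Real.norm_of_nonneg (vt_pos _ h1ε _).le, e4]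
  have hL := two_log_le_lam (m + k)
  have hlog : Real.log (1 + m) ≤ Real.log (((m + k : ℕ) : ℝ) + 1) := by
    refine Real.log_le_log (by positivity) ?_
    push_cast
    linarith [(Nat.cast_nonneg k : (0 : ℝ) ≤ k)]
  have hlog2 : 1 / 2 ≤ Real.log (1 + m) := by
    have := Real.log_le_log two_pos (by linarith : (2 : ℝ) ≤ 1 + m)
    linarith [Real.log_two_gt_d9]
  have a1 : 1 + Real.log (1 + m) ≤ 2 * lam (m + k) := by linarith
  have a2 : (1 + (m : ℝ)) ^ k ≤ 2 ^ k * (m : ℝ) ^ k := by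
    rw [← mul_pow]; gcongr; linarith
  have a3 : ε⁻¹ ^ m ≤ ε⁻¹ ^ m * ε⁻¹ ^ k :=
    le_mul_of_one_le_right (by positivity) (one_le_pow₀ h1ε.le)
  have a4 := norm_prod_ge (k := k) m
  have a5 : 0 ≤ 1 + Real.log (1 + m) := by linarith
  calc (1 + (m : ℝ)) ^ k * (1 + Real.log (1 + m)) * ε⁻¹ ^ m * ‖cf f (-(m : ℤ))‖
      ≤ (2 ^ k * (m : ℝ) ^ k) * (2 * lam (m + k)) * (ε⁻¹ ^ m * ε⁻¹ ^ k) * ‖cf f (-(m : ℤ))‖ := by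
        have := a5.trans a1
        gcongr
    _ ≤ (2 ^ k * ‖∏ j ∈ Finset.range k, (((-(m : ℤ) - k : ℤ) : ℂ) + 1 + j)‖) *
        (2 * lam (m + k)) * (ε⁻¹ ^ m * ε⁻¹ ^ k) * ‖cf f (-(m : ℤ))‖ := by
        gcongr
        linarith
    _ = _ := by rw [pow_succ]; ring

lemma summable_boundary (hε : ε ∈ Ioo (0 : ℝ) 1) (f : X ε k) :
    Summable fun n => ‖dcoef^[k] (cf f) n * (ε : ℂ) ^ n * sing n‖ ^ 2 :=
  summable_of_sum_le (fun _ => sq_nonneg _) (sum_boundary_le hε f)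

lemma summable_boundary_shift (hε : ε ∈ Ioo (0 : ℝ) 1) (f : X ε k) : Summable fun n : ℤ => (2 ^ (k + 1) : ℝ) ^ 2 *
    ‖dcoef^[k] (cf f) (n - k) * (ε : ℂ) ^ (n - k) * sing (n - k)‖ ^ 2 :=
  ((Equiv.subRight (k : ℤ)).summable_iff.2 (summable_boundary hε f)).mul_left _

lemma norm_vt_mul_cf_sq_le (hε : ε ∈ Ioo (0 : ℝ) 1) (hk : 1 ≤ k) (f : X ε k) (n : ℤ) :
    ‖(vt (k - 1) ε⁻¹ n : ℂ) * cf f n‖ ^ 2 ≤ (2 ^ (k + 1) : ℝ) ^ 2 *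
      ‖dcoef^[k] (cf f) (n - k) * (ε : ℂ) ^ (n - k) * sing (n - k)‖ ^ 2 := by
  rw [← mul_pow]
  exact pow_le_pow_left₀ (norm_nonneg _) (norm_vt_mul_cf_le hε hk f n) 2

lemma memℓp_cf (hε : ε ∈ Ioo (0 : ℝ) 1) (hk : 1 ≤ k) (f : X ε k) : Memℓp (fun n => (vt (k - 1) ε⁻¹ n : ℂ) * cf f n) 2 :=
  memℓp_two (Summable.of_nonneg_of_le (fun _ => sq_nonneg _) (norm_vt_mul_cf_sq_le hε hk f)
    (summable_boundary_shift hε f))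

/-- The weighted Fourier coefficients of the elements of `X`. -/
def coefX (hε : ε ∈ Ioo (0 : ℝ) 1) (hk : 1 ≤ k) : X ε k →L[ℝ] L2 ℂ :=
  LinearMap.mkContinuous
    { toFun := fun f => ⟨fun n => (vt (k - 1) ε⁻¹ n : ℂ) * cf f n, memℓp_cf hε hk f⟩
      map_add' := fun f g => lp.ext <| funext fun n => by
        simp only [lp.coeFn_add, Pi.add_apply, cf_add hε f g]
        ring
      map_smul' := fun t f => lp.ext <| funext fun n => by
        simp only [lp.coeFn_smul, Pi.smul_apply, cf_smul hε t f, RingHom.id_apply, smul_eq_mul,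
          Complex.real_smul]
        ring }
    (2 ^ (k + 1)) fun f => by
      refine L2.norm_le _ (by positivity) ?_
      refine ((Summable.of_nonneg_of_le (fun _ => sq_nonneg _) (norm_vt_mul_cf_sq_le hε hk f)
        (summable_boundary_shift hε f)).tsum_le_tsum (norm_vt_mul_cf_sq_le hε hk f)
        (summable_boundary_shift hε f)).trans ?_
      rw [tsum_mul_left, mul_pow]
      refine mul_le_mul_of_nonneg_left ?_ (by positivity)
      refine ((Equiv.subRight (k : ℤ)).tsum_eq fun n =>
        ‖dcoef^[k] (cf f) n * (ε : ℂ) ^ n * sing n‖ ^ 2).trans_le ?_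
      exact (summable_boundary hε f).tsum_le_of_sum_le (sum_boundary_le hε f)

lemma coefX_div (hε : ε ∈ Ioo (0 : ℝ) 1) (hk : 1 ≤ k) (f : X ε k) (n : ℤ) :
    coefX hε hk f n / (vt (k - 1) ε⁻¹ n : ℂ) = cf f n := by
  have h := vt_pos (k - 1) ((one_lt_inv₀ hε.1).2 hε.2) n
  have h' : (vt (k - 1) ε⁻¹ n : ℂ) ≠ 0 := by exact_mod_cast h.ne'
  exact mul_div_cancel_left₀ _ h'

end X

/-! ### Elements of `Y` with prescribed Fourier coefficients -/

section Y

variable {ε : ℝ} {s : ℕ}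

lemma mem_annulus_iff {z : ℂ} : z ∈ annulus ε ↔ ε < ‖z‖ ∧ ‖z‖ < ε⁻¹ := Iff.rfl

lemma circle_mem_annulus (hε : ε ∈ Ioo (0 : ℝ) 1) {ω : ℂ} (hω : ‖ω‖ = 1) : ω ∈ annulus ε := by
  rw [mem_annulus_iff, hω]
  exact ⟨hε.2, (one_lt_inv₀ hε.1).2 hε.2⟩

lemma norm_zpow_le_natAbs (hε : ε ∈ Ioo (0 : ℝ) 1) {z : ℂ} (hz : z ∈ annulus ε) (n : ℤ) :
    ‖z ^ n‖ ≤ ε⁻¹ ^ n.natAbs := by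
  obtain ⟨h1, h2⟩ := mem_annulus_iff.1 hz
  rw [norm_zpow]
  obtain ⟨m, rfl | rfl⟩ := n.eq_nat_or_neg
  · rw [zpow_natCast, Int.natAbs_natCast]
    gcongr
  · rw [zpow_neg, zpow_natCast, Int.natAbs_neg, Int.natAbs_natCast, inv_pow]
    have := hε.1
    gcongr

/-- The coefficients of the odd part. -/
def coefY (s : ℕ) (ε : ℝ) (x : L2 ℂ) (n : ℤ) : ℝ :=
  -(1 / 2) * (((x n).re - (x (-n)).re) / wt s ε⁻¹ n)

lemma coefY_neg (x : L2 ℂ) (n : ℤ) : coefY s ε x (-n) = -coefY s ε x n := by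
  rw [coefY, coefY, neg_neg, wt_neg]
  ring

lemma wt_mul_coefY_sq_le (hε : ε ∈ Ioo (0 : ℝ) 1) (x : L2 ℂ) (n : ℤ) :
    (wt s ε⁻¹ n * |coefY s ε x n|) ^ 2 ≤ (1 / 2) * (‖x n‖ ^ 2 + ‖x (-n)‖ ^ 2) := by
  have hw := wt_pos s ((one_lt_inv₀ hε.1).2 hε.2) n
  have e : wt s ε⁻¹ n * coefY s ε x n = -(1 / 2) * ((x n).re - (x (-n)).re) := by
    rw [coefY]
    generalize wt s ε⁻¹ n = w at hw ⊢
    field_simp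
  have e2 : (wt s ε⁻¹ n * |coefY s ε x n|) ^ 2 = (1 / 4) * ((x n).re - (x (-n)).re) ^ 2 := by
    rw [mul_pow, sq_abs, ← mul_pow, e]; ring
  have h1 : (x n).re ^ 2 ≤ ‖x n‖ ^ 2 := by
    rw [← sq_abs]; exact pow_le_pow_left₀ (abs_nonneg _) (Complex.abs_re_le_norm _) 2
  have h2 : (x (-n)).re ^ 2 ≤ ‖x (-n)‖ ^ 2 := by
    rw [← sq_abs]; exact pow_le_pow_left₀ (abs_nonneg _) (Complex.abs_re_le_norm _) 2
  rw [e2]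
  nlinarith [sq_nonneg ((x n).re + (x (-n)).re)]

lemma hasSum_sq_symm (x : L2 ℂ) :
    HasSum (fun n => (1 / 2) * (‖x n‖ ^ 2 + ‖x (-n)‖ ^ 2)) (‖x‖ ^ 2) := by
  have h1 := L2.hasSum_sq x
  have h2 := (Equiv.neg ℤ).hasSum_iff.2 h1
  have h3 := (h1.add h2).mul_left (1 / 2)
  have e : (1 / 2 : ℝ) * (‖x‖ ^ 2 + ‖x‖ ^ 2) = ‖x‖ ^ 2 := by ring
  rw [e] at h3
  exact h3

lemma summable_wt_mul_coefY_sq (hε : ε ∈ Ioo (0 : ℝ) 1) (x : L2 ℂ) :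
    Summable fun n => (wt s ε⁻¹ n * |coefY s ε x n|) ^ 2 :=
  Summable.of_nonneg_of_le (fun _ => sq_nonneg _) (wt_mul_coefY_sq_le hε x)
    (hasSum_sq_symm x).summable

lemma tsum_wt_mul_coefY_sq (hε : ε ∈ Ioo (0 : ℝ) 1) (x : L2 ℂ) :
    ∑' n, (wt s ε⁻¹ n * |coefY s ε x n|) ^ 2 ≤ ‖x‖ ^ 2 :=
  (summable_wt_mul_coefY_sq hε x).tsum_le_of_sum_le fun F => by
    refine (Finset.sum_le_sum fun n _ => wt_mul_coefY_sq_le hε x n).trans ?_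
    exact sum_le_hasSum F (fun _ _ => by positivity) (hasSum_sq_symm x)

lemma summable_coefY (hs : 1 ≤ s) (hε : ε ∈ Ioo (0 : ℝ) 1) (x : L2 ℂ) :
    Summable fun n : ℤ => |coefY s ε x n| * ε⁻¹ ^ n.natAbs := by
  refine Summable.of_nonneg_of_le (fun n => ?_) (fun n => ?_)
    (summable_mul_of_sq (summable_wt_mul_coefY_sq (s := s) hε x) summable_inv_sq_int)
  · have := hε.1
    positivity
  · have h1 : (1 : ℝ) ≤ 1 + |(n : ℝ)| := by simp
    have h2 : 1 + |(n : ℝ)| ≤ (1 + |(n : ℝ)|) ^ s := le_self_pow₀ h1 (by omega)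
    have h3 := inv_pos.2 hε.1
    have h4 : 1 ≤ (1 + |(n : ℝ)|) ^ s * (1 + |(n : ℝ)|)⁻¹ := by
      rw [← div_eq_mul_inv, one_le_div (by positivity)]
      exact h2
    calc |coefY s ε x n| * ε⁻¹ ^ n.natAbs = |coefY s ε x n| * ε⁻¹ ^ n.natAbs * 1 := (mul_one _).symm
      _ ≤ |coefY s ε x n| * ε⁻¹ ^ n.natAbs * ((1 + |(n : ℝ)|) ^ s * (1 + |(n : ℝ)|)⁻¹) := by gcongr
      _ = _ := by rw [wt]; ring

open Classical in
/-- The odd part of a sequence, as a function on the annulus. -/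
def funY (s : ℕ) (ε : ℝ) (x : L2 ℂ) (z : ℂ) : ℂ :=
  if z ∈ annulus ε then ∑' n : ℤ, (I * coefY s ε x n) * z ^ n else 0

lemma laurent_funY (hs : 1 ≤ s) (hε : ε ∈ Ioo (0 : ℝ) 1) (x : L2 ℂ) :
    Laurent (annulus ε) (fun n => I * coefY s ε x n) (funY s ε x) := fun z hz => by
  have h : Summable fun n : ℤ => (I * coefY s ε x n) * z ^ n :=
    Summable.of_norm_bounded (summable_coefY hs hε x) fun n => by
      rw [norm_mul, norm_mul, Complex.norm_I, one_mul, Complex.norm_real, Real.norm_eq_abs]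
      gcongr
      exact norm_zpow_le_natAbs hε hz n
  rw [funY, if_pos hz]
  exact h.hasSum

lemma funY_mem_Ahat (hs : 1 ≤ s) (hε : ε ∈ Ioo (0 : ℝ) 1) (x : L2 ℂ) : funY s ε x ∈ Ahat ε := by
  have hL := laurent_funY hs hε x
  refine ⟨fun z hz => if_neg hz, hL.differentiableOn (isPunctured_annulus hε.1),
    fun n => coefY s ε x (n : ℕ), fun z hz => ?_⟩
  have h1 := (hL z hz).nat_add_neg
  have h0 : coefY s ε x 0 = 0 := by simp [coefY]
  -- The coefficients are odd, so pairing `n` with `-n` gives `z^n - z^(-n)`, and the zeroth term,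
  -- counted twice by the pairing, vanishes.
  have h2 := (hasSum_nat_add_iff' 1).2 h1
  simp only [Finset.sum_range_one] at h2
  rw [← Equiv.pnatEquivNat.symm.hasSum_iff]
  refine HasSum.congr_both h2 (fun n => ?_) ?_
  · have e : ((Equiv.pnatEquivNat.symm n : ℕ+) : ℕ) = n + 1 := rfl
    simp only [Function.comp_apply, e, coefY_neg]
    rw [zpow_neg, zpow_natCast]
    push_cast
    ring
  · simp [h0]

lemma norm_prod_le (l : ℕ) (p : ℤ) :
    ‖∏ j ∈ Finset.range l, (((p - l : ℤ) : ℂ) + 1 + j)‖ ≤ ((1 + l) * (1 + |(p : ℝ)|)) ^ l := by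
  rw [norm_prod]
  have h : ∏ _j ∈ Finset.range l, ((1 + l) * (1 + |(p : ℝ)|)) = ((1 + l) * (1 + |(p : ℝ)|)) ^ l := by
    simp
  rw [← h]
  refine Finset.prod_le_prod (fun _ _ => norm_nonneg _) fun j hj => ?_
  have hj' := Finset.mem_range.1 hj
  have e : (((p - l : ℤ) : ℂ) + 1 + j) = (((p - ((l - 1 - j : ℕ) : ℤ) : ℤ) : ℝ) : ℂ) := by
    have h1 : ((l - 1 - j : ℕ) : ℂ) = l - 1 - j := by
      rw [Nat.cast_sub (by omega), Nat.cast_sub (by omega)]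
      simp
    push_cast
    rw [h1]
    ring
  rw [e, Complex.norm_real, Real.norm_eq_abs]
  push_cast
  have h2 := abs_sub (p : ℝ) ((l - 1 - j : ℕ) : ℝ)
  rw [Nat.abs_cast] at h2
  have h3 : ((l - 1 - j : ℕ) : ℝ) ≤ l := by exact_mod_cast (by omega)
  nlinarith [mul_nonneg (Nat.cast_nonneg (α := ℝ) l) (abs_nonneg (p : ℝ))]

/-- By Parseval a square summable majorant of the coefficients that is uniform over the circles
bounds the supremum of the `L²` norms. -/
lemma hardy_le {U : Set ℂ} {c : ℤ → ℂ} {u : ℂ → ℂ} (h : Laurent U c u) {C : ℝ}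
    (hC : 0 ≤ C) {q : ℤ → ℝ} (hq : Summable fun n => q n ^ 2) (hqC : ∑' n, q n ^ 2 ≤ C ^ 2)
    (hb : ∀ r ∈ radii U, ∀ n, ‖c n * (r : ℂ) ^ n‖ ≤ q n) :
    hardy U u ≤ ENNReal.ofReal (√(2 * π) * C) := by
  refine iSup₂_le fun r hr => ?_
  rw [eL2_eq (h.summable_circle hr) fun ω hω => h.hasSum_circle hr hω]
  refine ENNReal.ofReal_le_ofReal ?_
  rw [Real.sqrt_mul Real.two_pi_pos.le]
  gcongr
  rw [Real.sqrt_le_left hC]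
  refine le_trans ?_ hqC
  exact (summable_sq_of_summable_norm (h.summable_circle hr)).tsum_le_tsum
    (fun n => pow_le_pow_left₀ (norm_nonneg _) (hb r hr n) 2) hq

lemma norm_coefY_mul_le (hε : ε ∈ Ioo (0 : ℝ) 1) (x : L2 ℂ) {r : ℝ}
    (hr : r ∈ radii (annulus ε)) (n : ℤ) :
    ‖(I * coefY s ε x n) * (r : ℂ) ^ n‖ ≤ wt s ε⁻¹ n * |coefY s ε x n| := by
  have h1 := norm_zpow_le_natAbs hε (hr.2 1 norm_one) n
  have h3 := inv_pos.2 hε.1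
  rw [mul_one] at h1
  rw [norm_mul, norm_mul, Complex.norm_I, one_mul, Complex.norm_real, Real.norm_eq_abs, wt]
  have h2 : (1 : ℝ) ≤ (1 + |(n : ℝ)|) ^ s := one_le_pow₀ (by simp)
  calc |coefY s ε x n| * ‖(r : ℂ) ^ n‖ ≤ |coefY s ε x n| * (1 * ε⁻¹ ^ n.natAbs) := by
        rw [one_mul]; gcongr
    _ ≤ |coefY s ε x n| * ((1 + |(n : ℝ)|) ^ s * ε⁻¹ ^ n.natAbs) := by gcongr
    _ = _ := by ring

/-- Differentiating `s` times shifts the index by `s` and multiplies by a product of `s` factors of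
linear size. The polynomial weight absorbs the product; the shift costs `ε^(-s)`. -/
lemma norm_dcoef_coefY_mul_le (hε : ε ∈ Ioo (0 : ℝ) 1) (x : L2 ℂ) {r : ℝ}
    (hr : r ∈ radii (annulus ε)) (n : ℤ) :
    ‖dcoef^[s] (fun n => I * coefY s ε x n) n * (r : ℂ) ^ n‖ ≤
      ((1 + s) * ε⁻¹) ^ s * (wt s ε⁻¹ (n + s) * |coefY s ε x (n + s)|) := by
  have h1 := norm_zpow_le_natAbs hε (hr.2 1 norm_one) n
  have h3 := inv_pos.2 hε.1
  have h4 := (one_lt_inv₀ hε.1).2 hε.2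
  rw [mul_one] at h1
  have h2 := norm_prod_le s (n + s)
  rw [add_sub_cancel_right] at h2
  rw [dcoef_iterate, norm_mul, norm_mul, norm_mul, Complex.norm_I, one_mul, Complex.norm_real,
    Real.norm_eq_abs]
  have h5 : ε⁻¹ ^ n.natAbs ≤ ε⁻¹ ^ (n + s).natAbs * ε⁻¹ ^ s := by
    rw [← pow_add]
    exact pow_le_pow_right₀ h4.le (by omega)
  calc _ ≤ ((1 + s) * (1 + |((n + s : ℤ) : ℝ)|)) ^ s * |coefY s ε x (n + s)| *
        (ε⁻¹ ^ (n + s).natAbs * ε⁻¹ ^ s) := by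
        gcongr
        exact h1.trans h5
    _ = _ := by rw [wt]; simp only [mul_pow]; ring

/-- The constant in the bound for `projY`. -/
def projBound (s : ℕ) (ε : ℝ) : ℝ := √(2 * π) * (1 + ((1 + s) * ε⁻¹) ^ s)

lemma YeNorm_funY_le (hs : 1 ≤ s) (hε : ε ∈ Ioo (0 : ℝ) 1) (x : L2 ℂ) :
    YeNorm ε s (funY s ε x) ≤ ENNReal.ofReal (projBound s ε * ‖x‖) := by
  have hU := isPunctured_annulus hε.1
  have hL := laurent_funY hs hε x
  have h3 := inv_pos.2 hε.1
  have h1 := hardy_le hL (norm_nonneg x) (summable_wt_mul_coefY_sq (s := s) hε x)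
    (tsum_wt_mul_coefY_sq hε x) fun r hr => norm_coefY_mul_le hε x hr
  have h4 : Summable fun n : ℤ => (wt s ε⁻¹ (n + s) * |coefY s ε x (n + s)|) ^ 2 :=
    (Equiv.addRight (s : ℤ)).summable_iff.2 (summable_wt_mul_coefY_sq (s := s) hε x)
  have h5 : ∑' n : ℤ, (wt s ε⁻¹ (n + s) * |coefY s ε x (n + s)|) ^ 2 ≤ ‖x‖ ^ 2 :=
    ((Equiv.addRight (s : ℤ)).tsum_eq fun n =>
      (wt s ε⁻¹ n * |coefY s ε x n|) ^ 2).trans_le (tsum_wt_mul_coefY_sq hε x)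
  have h2 := hardy_le (hL.iteratedDeriv hU s) (C := ((1 + s) * ε⁻¹) ^ s * ‖x‖) (by positivity)
    (q := fun n => ((1 + s) * ε⁻¹) ^ s * (wt s ε⁻¹ (n + s) * |coefY s ε x (n + s)|))
    (by simp only [mul_pow _ (_ * _) 2]; exact h4.mul_left _)
    (by
      simp only [mul_pow _ (wt _ _ _ * _) 2, mul_pow _ ‖x‖ 2]
      rw [tsum_mul_left]
      gcongr)
    fun r hr => norm_dcoef_coefY_mul_le hε x hr
  rw [YeNorm]
  refine (add_le_add h1 h2).trans_eq ?_
  rw [← ENNReal.ofReal_add (by positivity) (by positivity), projBound]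
  congr 1
  ring

lemma coefY_add (x y : L2 ℂ) (n : ℤ) : coefY s ε (x + y) n = coefY s ε x n + coefY s ε y n := by
  simp only [coefY, lp.coeFn_add, Pi.add_apply, Complex.add_re]
  ring

lemma coefY_smul (t : ℝ) (x : L2 ℂ) (n : ℤ) : coefY s ε (t • x) n = t * coefY s ε x n := by
  simp only [coefY, lp.coeFn_smul, Pi.smul_apply, Complex.smul_re, smul_eq_mul]
  ring

/-- The odd part of a sequence, as an element of `Y`. -/
def projY (hs : 1 ≤ s) (hε : ε ∈ Ioo (0 : ℝ) 1) : L2 ℂ →L[ℝ] Y ε s :=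
  LinearMap.mkContinuous
    { toFun := fun x => ⟨funY s ε x, funY_mem_Ahat hs hε x,
        (YeNorm_funY_le hs hε x).trans_lt ENNReal.ofReal_lt_top⟩
      map_add' := fun x y => Subtype.ext <| funext fun z => by
        change funY s ε (x + y) z = funY s ε x z + funY s ε y z
        by_cases hz : z ∈ annulus ε
        · refine (laurent_funY hs hε (x + y) z hz).unique ?_
          refine ((laurent_funY hs hε x z hz).add (laurent_funY hs hε y z hz)).congr_fun fun n => ?_
          beta_reduce
          rw [coefY_add]
          push_cast
          ring
        · simp only [funY, if_neg hz, add_zero]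
      map_smul' := fun t x => Subtype.ext <| funext fun z => by
        change funY s ε (t • x) z = t • funY s ε x z
        by_cases hz : z ∈ annulus ε
        · refine (laurent_funY hs hε (t • x) z hz).unique ?_
          rw [Complex.real_smul]
          refine ((laurent_funY hs hε x z hz).mul_left (t : ℂ)).congr_fun fun n => ?_
          beta_reduce
          rw [coefY_smul]
          push_cast
          ring
        · simp only [funY, if_neg hz, smul_zero] }
    (projBound s ε) fun x => by
      have h3 := inv_pos.2 hε.1
      refine ENNReal.toReal_le_of_le_ofReal ?_ (YeNorm_funY_le hs hε x)
      unfold projBound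
      positivity

lemma projY_apply (hs : 1 ≤ s) (hε : ε ∈ Ioo (0 : ℝ) 1) (x : L2 ℂ) (z : ℂ) :
    projY hs hε x z = funY s ε x z := rfl

/-- For one coefficient `c` the odd part of `Im (c ω^n)` under conjugation is `Re c · Im ω^n = Re c
(ω^n - ω^(-n))/(2i)`, which explains the formula for `coefY`. -/
lemma projY_circle (hs : 1 ≤ s) (hε : ε ∈ Ioo (0 : ℝ) 1) (x : L2 ℂ) {ω : ℂ} (hω : ‖ω‖ = 1)
    (hω' : ‖conj ω‖ = 1) : projY hs hε x ω =
      (((ev (sobolev hs ((one_lt_inv₀ hε.1).2 hε.2)) hω x).im -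
        (ev (sobolev hs ((one_lt_inv₀ hε.1).2 hε.2)) hω' x).im) / 2 : ℝ) := by
  set W := sobolev hs ((one_lt_inv₀ hε.1).2 hε.2) with hW
  have hconj : conj ω = ω⁻¹ := by
    rw [Complex.inv_def, Complex.normSq_eq_norm_sq, hω]; simp
  have h1 := (laurent_funY hs hε x) ω (circle_mem_annulus hε hω)
  -- The two series agree only after combining the terms `n` and `-n`, so both are symmetrised.
  have h2 := (Equiv.neg ℤ).hasSum_iff.2 h1
  have h3 := ((h1.add h2).mul_left (1 / 2))
  have a1 := (hasSum_ev W hω x).mapL Complex.imCLM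
  have a2 := (hasSum_ev W hω' x).mapL Complex.imCLM
  have a3 := (a1.sub a2).div_const 2
  have a4 := (Equiv.neg ℤ).hasSum_iff.2 a3
  have a5 := Complex.hasSum_ofReal.2 ((a3.add a4).mul_left (1 / 2))
  have e1 : (1 / 2 : ℂ) * (funY s ε x ω + funY s ε x ω) = projY hs hε x ω := by
    rw [projY_apply]; ring
  rw [e1] at h3
  refine (h3.unique ?_)
  refine HasSum.congr_both a5 (fun n => ?_) ?_
  · have hw : W.w n = wt s ε⁻¹ n := rfl
    have hw' : W.w (-n) = wt s ε⁻¹ n := wt_neg s ε⁻¹ n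
    have hz : (ω ^ n)⁻¹ = conj (ω ^ n) := by rw [map_zpow₀, hconj, inv_zpow]
    have hn : ω ^ (-n) = conj (ω ^ n) := by rw [zpow_neg, hz]
    have hc : conj ω ^ n = conj (ω ^ n) := (map_zpow₀ _ _ _).symm
    have hc' : conj ω ^ (-n) = ω ^ n := by rw [hconj, inv_zpow, zpow_neg, inv_inv]
    simp only [Function.comp_apply, Equiv.neg_apply, coefY_neg, hn, hw, hw', hc, hc', smul_eq_mul,
      Complex.imCLM_apply]
    generalize ω ^ n = t
    rw [coefY]
    have hwp := (wt_pos s ((one_lt_inv₀ hε.1).2 hε.2) n).ne'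
    apply Complex.ext
    · simp
      field_simp
      ring
    · simp
  · congr 1
    simp only [Complex.imCLM_apply]
    ring

end Y

/-! ### Elements of `Y` are determined by their values on the unit circle -/

/-- Convergence at one radius `r > 1` suffices, since there `r^n - r^(-n) ≥ r - r⁻¹`. -/
lemma summable_of_hasSum_sub_inv {r : ℝ} (hr : 1 < r) {d : ℕ+ → ℝ} {S : ℂ}
    (h : HasSum (fun n : ℕ+ => I * ((d n : ℂ) * ((r : ℂ) ^ (n : ℕ) - ((r : ℂ) ^ (n : ℕ))⁻¹))) S) :
    Summable fun n => |d n| := by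
  have hδ : 0 < r - r⁻¹ := by
    have := inv_lt_one_of_one_lt₀ hr
    linarith
  refine Summable.of_nonneg_of_le (fun _ => abs_nonneg _) (fun n => ?_)
    (h.summable.norm.mul_left (r - r⁻¹)⁻¹)
  have e : (r : ℂ) ^ (n : ℕ) - ((r : ℂ) ^ (n : ℕ))⁻¹ = ((r ^ (n : ℕ) - (r ^ (n : ℕ))⁻¹ : ℝ) : ℂ) := by
    push_cast; rfl
  have h1 : r ≤ r ^ (n : ℕ) := le_self_pow₀ hr.le n.ne_zero
  have h2 : (r ^ (n : ℕ))⁻¹ ≤ r⁻¹ := by gcongr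
  rw [e, norm_mul, norm_mul, Complex.norm_I, one_mul, Complex.norm_real, Complex.norm_real,
    Real.norm_eq_abs, Real.norm_eq_abs, abs_of_nonneg (by linarith : 0 ≤ r ^ (n : ℕ) - (r ^ (n : ℕ))⁻¹),
    inv_mul_eq_div, le_div_iff₀ hδ]
  gcongr

lemma coef_eq_zero_of_circle {d : ℕ+ → ℝ} (hd : Summable fun n => |d n|)
    (h : ∀ ω : ℂ, ‖ω‖ = 1 →
      HasSum (fun n : ℕ+ => I * ((d n : ℂ) * (ω ^ (n : ℕ) - (ω ^ (n : ℕ))⁻¹))) 0) (m : ℕ+) :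
    d m = 0 := by
  have e : ∀ (n : ℕ+) (θ : ℝ), I * ((d n : ℂ) * (cs θ ^ (n : ℕ) - (cs θ ^ (n : ℕ))⁻¹)) *
      cs θ ^ (-(m : ℤ)) = I * d n * cs θ ^ ((n : ℤ) - m) - I * d n * cs θ ^ (-(n : ℤ) - m) := by
    intro n θ
    have h0 := cs_ne_zero θ
    rw [zpow_sub₀ h0, zpow_sub₀ h0, zpow_neg, zpow_neg, zpow_natCast, zpow_natCast]
    ring
  have h1 := hasSum_integral_of_bound (x := 0) (y := 2 * π) (f := fun _ => 0)
    (F := fun (n : ℕ+) θ => I * d n * cs θ ^ ((n : ℤ) - m) - I * d n * cs θ ^ (-(n : ℤ) - m))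
    (hd.mul_left 2) (fun n => by
      have a1 := continuous_cs_zpow ((n : ℤ) - m)
      have a2 := continuous_cs_zpow (-(n : ℤ) - m)
      exact ((continuous_const.mul a1).sub (continuous_const.mul a2)).measurable)
    (fun n θ _ => by
      refine (norm_sub_le _ _).trans_eq ?_
      simp only [norm_mul, norm_cs_zpow, Complex.norm_I, one_mul, mul_one, Complex.norm_real,
        Real.norm_eq_abs]
      ring)
    (fun θ _ => by
      have := (h _ (norm_cm θ)).mul_right (cs θ ^ (-(m : ℤ)))
      rw [zero_mul] at this
      exact this.congr_fun fun n => (e n θ).symm)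
  rw [intervalIntegral.integral_zero] at h1
  have h2 : HasSum (fun n : ℕ+ => if n = m then I * d m * (2 * π) else 0) 0 := by
    refine h1.congr_fun fun n => ?_
    have b : ∀ l : ℤ, IntervalIntegrable (fun θ => I * d n * cs θ ^ l) volume 0 (2 * π) := fun l =>
      (continuous_const.mul (continuous_cs_zpow l)).intervalIntegrable _ _
    rw [intervalIntegral.integral_sub (b _) (b _), intervalIntegral.integral_const_mul,
      intervalIntegral.integral_const_mul, integral_cs_zpow, integral_cs_zpow]
    have hn := n.pos
    have hm := m.pos
    rw [if_neg (by omega : ¬(-(n : ℤ) - m = 0)), mul_zero, sub_zero]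
    split_ifs with h3 h4 h4
    · rw [h3]
    · exact absurd (by rw [h3, sub_self]) h4
    · exact absurd (PNat.coe_inj.1 (by omega)) h3
    · simp
  have h3 := (hasSum_ite_eq m (I * d m * (2 * π) : ℂ)).unique h2
  have hpi : (π : ℂ) ≠ 0 := by exact_mod_cast Real.pi_ne_zero
  simpa [hpi] using h3

/-- The coefficients of the difference are absolutely summable, by convergence outside the unit
circle, and they are recovered from the values on the circle by integration. -/
lemma Y_ext {ε : ℝ} (hε : ε ∈ Ioo (0 : ℝ) 1) {s : ℕ} {g g' : Y ε s}
    (h : ∀ ω : ℂ, ‖ω‖ = 1 → g ω = g' ω) : g = g' := by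
  obtain ⟨a, ha⟩ := g.2.1.2.2
  obtain ⟨a', ha'⟩ := g'.2.1.2.2
  have hs : ∀ z ∈ annulus ε, HasSum (fun n : ℕ+ => I * (((a n - a' n : ℝ) : ℂ) *
      (z ^ (n : ℕ) - (z ^ (n : ℕ))⁻¹))) (g z - g' z) := fun z hz => by
    refine ((ha z hz).sub (ha' z hz)).congr_fun fun n => ?_
    push_cast
    ring
  have h1ε := (one_lt_inv₀ hε.1).2 hε.2
  obtain ⟨r, hr1, hr2⟩ := exists_between h1ε
  have hr : (r : ℂ) ∈ annulus ε := by
    rw [mem_annulus_iff, Complex.norm_real, Real.norm_of_nonneg (by linarith)]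
    exact ⟨hε.2.trans hr1, hr2⟩
  have hd := summable_of_hasSum_sub_inv hr1 (hs r hr)
  have h0 := coef_eq_zero_of_circle hd fun ω hω => by
    have := hs ω (circle_mem_annulus hε hω)
    rwa [h ω hω, sub_self] at this
  refine Subtype.ext (funext fun z => ?_)
  by_cases hz : z ∈ annulus ε
  · have h2 := hs z hz
    simp only [h0, Complex.ofReal_zero, zero_mul, mul_zero] at h2
    exact sub_eq_zero.1 (h2.unique hasSum_zero)
  · exact (g.2.1.1 z hz).trans (g'.2.1.1 z hz).symm

/-! ### The kernels of the operator `S` -/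

/-- In the right half plane the principal power commutes with conjugation, and the square of
`z^(-1/2)` is `z⁻¹`. -/
lemma cpow_neg_half_mul_conj {z : ℂ} (hz : 0 < z.re) :
    z ^ (-1 / 2 : ℂ) * (conj z) ^ (-1 / 2 : ℂ) = ((‖z‖⁻¹ : ℝ) : ℂ) := by
  have h0 : z ≠ 0 := by rintro rfl; simp at hz
  have harg : z.arg ≠ π := fun h => by
    have := (Complex.arg_eq_pi_iff.1 h).1
    linarith
  have h1 := Complex.cpow_conj z (-1 / 2 : ℂ) harg
  have e : conj (-1 / 2 : ℂ) = -1 / 2 := by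
    have : (-1 / 2 : ℂ) = ((-1 / 2 : ℝ) : ℂ) := by push_cast; rfl
    rw [this, Complex.conj_ofReal]
  rw [e] at h1
  have h3 : (conj z) ^ (-1 / 2 : ℂ) = conj (z ^ (-1 / 2 : ℂ)) := by rw [h1, Complex.conj_conj]
  have h4 : z ^ (-1 / 2 : ℂ) * z ^ (-1 / 2 : ℂ) = z⁻¹ := by
    rw [← Complex.cpow_add _ _ h0, ← Complex.cpow_neg_one]
    norm_num
  rw [h3, Complex.mul_conj, Complex.normSq_eq_norm_sq, sq, ← norm_mul, h4, norm_inv]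

/-- The value of `(Φ_i(ωσ) - Φ_j(ω)) / ω` for the annulus, with `σ = e^{iθ}`. -/
def Rk (b : ℝ) (i j : Fin 2) (θ : ℝ) : ℂ := (b : ℂ) ^ (i : ℕ) * cs θ - (b : ℂ) ^ (j : ℕ)

lemma continuous_Rk (b : ℝ) (i j : Fin 2) : Continuous (Rk b i j) :=
  (continuous_const.mul continuous_cs).sub continuous_const

/-- The phase of `Rk`. -/
def sgnR (b : ℝ) (i j : Fin 2) (θ : ℝ) : ℂ := Rk b i j θ / (‖Rk b i j θ‖ : ℂ)

lemma measurable_sgnR (b : ℝ) (i j : Fin 2) : Measurable (sgnR b i j) :=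
  (continuous_Rk b i j).measurable.div
    (Complex.continuous_ofReal.comp (continuous_Rk b i j).norm).measurable

lemma norm_sgnR_le (b : ℝ) (i j : Fin 2) (θ : ℝ) : ‖sgnR b i j θ‖ ≤ 1 := by
  rw [sgnR, norm_div, Complex.norm_real, norm_norm]
  exact div_self_le_one _

lemma intervalIntegrable_sgnR_mul (b : ℝ) (i j : Fin 2) (φ : Ang) :
    IntervalIntegrable (fun θ => sgnR b i j θ * φ θ) volume 0 (2 * π) :=
  intervalIntegrable_of_norm_le ((measurable_sgnR b i j).mul φ.continuous.measurable)
    (C := 1 * ‖φ‖) (fun θ => by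
      change ‖sgnR b i j θ * φ θ‖ ≤ _
      rw [norm_mul]
      exact mul_le_mul (norm_sgnR_le b i j θ) (φ.norm_coe_le_norm θ) (norm_nonneg _) zero_le_one)
    _ _

lemma inv_two_pi_le_one : ‖(2 * π : ℂ)⁻¹‖ ≤ 1 := by
  have e : (2 * π : ℂ) = ((2 * π : ℝ) : ℂ) := by push_cast; rfl
  rw [e, norm_inv, Complex.norm_real, Real.norm_of_nonneg Real.two_pi_pos.le]
  exact inv_le_one_of_one_le₀ (by linarith [Real.two_le_pi])

/-- The functional `φ ↦ Lk (a φ)` sees only the `L¹` norm of `a`. The numerator of `S` is treated as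
a functional precisely in order to exploit this. -/
lemma norm_integral_sgnR_le (b : ℝ) (i j : Fin 2) (a φ : Ang) :
    ‖(2 * π : ℂ)⁻¹ * ∫ θ in (0 : ℝ)..2 * π, sgnR b i j θ * (a θ * φ θ)‖ ≤
      (∫ θ in (0 : ℝ)..2 * π, ‖a θ‖) * ‖φ‖ := by
  rw [norm_mul]
  refine (mul_le_of_le_one_left (norm_nonneg _) inv_two_pi_le_one).trans ?_
  rw [← intervalIntegral.integral_mul_const]
  refine intervalIntegral.norm_integral_le_of_norm_le Real.two_pi_pos.le
    (Eventually.of_forall fun θ _ => ?_)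
    ((a.continuous.norm.mul continuous_const).intervalIntegrable _ _)
  rw [norm_mul, norm_mul]
  refine (mul_le_of_le_one_left (by positivity) (norm_sgnR_le b i j θ)).trans ?_
  exact mul_le_mul_of_nonneg_left (φ.norm_coe_le_norm θ) (norm_nonneg _)

/-- The mean value against the phase of `Rk`. -/
def Lk (b : ℝ) (i j : Fin 2) : Ang →L[ℂ] ℂ :=
  LinearMap.mkContinuous
    { toFun := fun φ => (2 * π : ℂ)⁻¹ * ∫ θ in (0 : ℝ)..2 * π, sgnR b i j θ * φ θ
      map_add' := fun φ ψ => by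
        rw [← mul_add, ← intervalIntegral.integral_add (intervalIntegrable_sgnR_mul b i j φ)
          (intervalIntegrable_sgnR_mul b i j ψ)]
        simp only [BoundedContinuousFunction.coe_add, Pi.add_apply, mul_add]
      map_smul' := fun c φ => by
        have e : ∀ θ, sgnR b i j θ * (c • φ) θ = c * (sgnR b i j θ * φ θ) := fun θ => by
          change sgnR b i j θ * (c * φ θ) = _
          ring
        simp only [e, intervalIntegral.integral_const_mul, RingHom.id_apply, smul_eq_mul]
        ring }
    (∫ _ in (0 : ℝ)..2 * π, ‖(1 : ℂ)‖) fun φ => by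
      have := norm_integral_sgnR_le b i j 1 φ
      simp only [BoundedContinuousFunction.coe_one, Pi.one_apply, one_mul] at this
      exact this

lemma Lk_apply (b : ℝ) (i j : Fin 2) (φ : Ang) :
    Lk b i j φ = (2 * π : ℂ)⁻¹ * ∫ θ in (0 : ℝ)..2 * π, sgnR b i j θ * φ θ := rfl

/-- The functional `φ ↦ Lk (a φ)`. -/
def LkMul (b : ℝ) (i j : Fin 2) (a : Ang) : Ang →L[ℂ] ℂ :=
  (Lk b i j).comp (ContinuousLinearMap.mul ℂ Ang a)

lemma LkMul_apply (b : ℝ) (i j : Fin 2) (a φ : Ang) : LkMul b i j a φ = Lk b i j (a * φ) := rfl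

lemma norm_LkMul_le (b : ℝ) (i j : Fin 2) (a : Ang) :
    ‖LkMul b i j a‖ ≤ ∫ θ in (0 : ℝ)..2 * π, ‖a θ‖ := by
  refine ContinuousLinearMap.opNorm_le_bound _ ?_ fun φ => ?_
  · exact intervalIntegral.integral_nonneg Real.two_pi_pos.le fun _ _ => norm_nonneg _
  · exact norm_integral_sgnR_le b i j a φ

/-- Bounded functions representing the quotients `(a σ^m - c) / Rk`. -/
structure Kern (b : ℝ) (i j : Fin 2) where
  α : ℤ → Ang
  β : ℤ → Ang
  C : ℝ
  norm_α : ∀ m, ‖α m‖ ≤ C * (1 + |(m : ℝ)|)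
  norm_β : ∀ m, ‖β m‖ ≤ C * (1 + |(m : ℝ)|)
  int_α : ∀ m, ∫ θ in (0 : ℝ)..2 * π, ‖α m θ‖ ≤ C * (1 + Real.log (1 + |(m : ℝ)|))
  int_β : ∀ m, ∫ θ in (0 : ℝ)..2 * π, ‖β m θ‖ ≤ C * (1 + Real.log (1 + |(m : ℝ)|))
  Rk_ne : ∀ θ ∈ Ioo (0 : ℝ) (2 * π), Rk b i j θ ≠ 0
  -- The coefficients are a function of the component, so for `i = j` they coincide and the right
  -- side vanishes at `σ = 1`, where `Rk` does.
  eq : ∀ m, ∀ θ ∈ Ioo (0 : ℝ) (2 * π), ∀ x : Fin 2 → ℂ,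
    (x i * α m θ + x j * β m θ) * Rk b i j θ = x i * cs θ ^ m - x j

/-! ### Weight inequalities behind the diagonal maps -/

section Weights

variable {s : ℕ} {ρ : ℝ}

lemma wt_mul_le_vt (hρ : 1 < ρ) (m : ℤ) : wt s ρ m * (1 + |(m : ℝ)|) ≤ vt s ρ m := by
  have h1 := wt_pos s hρ m
  have h2 := log_one_add_abs_nonneg m
  have h3 : 1 ≤ 1 + Real.log (1 + |(m : ℝ)|) := by linarith
  calc _ = (1 + |(m : ℝ)|) * 1 * wt s ρ m := by ring
    _ ≤ (1 + |(m : ℝ)|) * (1 + Real.log (1 + |(m : ℝ)|)) * wt s ρ m := by gcongr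
    _ = _ := rfl

/-- The shift comes from dividing by `ω` and costs a constant by submultiplicativity of the weight.
The linear growth of the sup norm is covered by the quotient of `vt` and `wt`. -/
lemma wt_mul_norm_shift_le (hρ : 1 < ρ) {a : ℤ → Ang} {C : ℝ}
    (h : ∀ m, ‖a m‖ ≤ C * (1 + |(m : ℝ)|)) (n : ℤ) :
    wt s ρ n * ‖a (Equiv.addRight (1 : ℤ) n)‖ ≤ wt s ρ 1 * C * vt s ρ (Equiv.addRight (1 : ℤ) n) := by
  have h0 : 0 ≤ C := by simpa using (norm_nonneg _).trans (h 0)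
  rw [Equiv.coe_addRight]
  have h1 := wt_add_le s hρ (n + 1) (-1)
  rw [add_neg_cancel_right, wt_neg] at h1
  have h2 := wt_pos s hρ (n + 1)
  have h3 := wt_pos s hρ 1
  have h4 := wt_pos s hρ n
  calc wt s ρ n * ‖a (n + 1)‖ ≤ (wt s ρ (n + 1) * wt s ρ 1) * (C * (1 + |((n + 1 : ℤ) : ℝ)|)) := by
        gcongr
        exact h _
    _ = wt s ρ 1 * C * (wt s ρ (n + 1) * (1 + |((n + 1 : ℤ) : ℝ)|)) := by ring
    _ ≤ _ := by
        gcongr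
        exact wt_mul_le_vt hρ _

lemma wt_mul_norm_refl_le (hρ : 1 < ρ) {a : ℤ → Ang} {C : ℝ}
    (h : ∀ m, ‖a m‖ ≤ C * (1 + |(m : ℝ)|)) (n : ℤ) :
    wt s ρ n * ‖star (a (Equiv.subLeft (1 : ℤ) n))‖ ≤
      wt s ρ 1 * C * vt s ρ (Equiv.subLeft (1 : ℤ) n) := by
  have h0 := wt_mul_norm_shift_le (s := s) hρ h (-n)
  rw [Equiv.coe_addRight, wt_neg] at h0
  have e : Equiv.subLeft (1 : ℤ) n = -n + 1 := by rw [Equiv.subLeft_apply]; ring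
  rwa [e, norm_star]

/-- The factor `n` from the derivative times the logarithm from the `L¹` norm is exactly the
quotient of `vt` and `wt`. No derivative beyond those of `X` is spent. -/
lemma wt_mul_norm_LkMul_le (hρ : 1 < ρ) (b : ℝ) (i j : Fin 2) {a : ℤ → Ang} {C : ℝ}
    (h : ∀ m, ∫ θ in (0 : ℝ)..2 * π, ‖a m θ‖ ≤ C * (1 + Real.log (1 + |(m : ℝ)|))) (n : ℤ) :
    wt s ρ n * ‖(n : ℂ) • LkMul b i j (a n)‖ ≤ C * vt s ρ (Equiv.refl ℤ n) := by
  have h1 := (norm_LkMul_le b i j (a n)).trans (h n)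
  have h2 := wt_pos s hρ n
  have h3 := (norm_nonneg _).trans h1
  rw [norm_smul, ← Complex.ofReal_intCast, Complex.norm_real, Real.norm_eq_abs, Equiv.refl_apply]
  calc wt s ρ n * (|(n : ℝ)| * ‖LkMul b i j (a n)‖)
      ≤ wt s ρ n * ((1 + |(n : ℝ)|) * (C * (1 + Real.log (1 + |(n : ℝ)|)))) := by
        gcongr
        linarith
    _ = _ := by rw [vt]; ring

/-- Here `s ≥ 2`, that is `k ≥ 3`, enters: one factor `(1+|m|)⁻¹` must remain for Cauchy–Schwarz
after two powers have been given away. -/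
lemma summable_div_vt (hs : 2 ≤ s) (hρ : 1 < ρ) (x : L2 ℂ) :
    Summable fun m : ℤ => ‖x m / (vt s ρ m : ℂ)‖ * (1 + |(m : ℝ)|) ^ 2 := by
  refine Summable.of_nonneg_of_le (fun _ => by positivity) (fun m => ?_)
    (summable_mul_of_sq (L2.hasSum_sq x).summable summable_inv_sq_int)
  have h1 := vt_pos s hρ m
  rw [norm_div, Complex.norm_real, Real.norm_of_nonneg h1.le, div_mul_eq_mul_div, mul_div_assoc]
  refine mul_le_mul_of_nonneg_left ?_ (norm_nonneg _)
  rw [div_le_iff₀ h1, ← div_eq_inv_mul, le_div_iff₀ (by positivity)]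
  have h2 : (1 : ℝ) ≤ 1 + |(m : ℝ)| := by simp
  have h3 : (1 + |(m : ℝ)|) ^ 2 ≤ wt s ρ m := by
    calc (1 + |(m : ℝ)|) ^ 2 ≤ (1 + |(m : ℝ)|) ^ s := pow_le_pow_right₀ h2 hs
      _ = (1 + |(m : ℝ)|) ^ s * 1 := (mul_one _).symm
      _ ≤ _ := by
        unfold wt
        gcongr
        exact one_le_pow₀ hρ.le
  calc _ ≤ wt s ρ m * (1 + |(m : ℝ)|) := by gcongr
    _ ≤ _ := wt_mul_le_vt hρ m

end Weights

/-! ### The operator `S` on sequences -/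

section Sop

variable {s : ℕ} (hs : 1 ≤ s) {ρ : ℝ} (hρ : 1 < ρ) {b : ℝ} {i j : Fin 2} (K : Kern b i j)

/-- The projections of pairs of sequences. -/
abbrev prj (i : Fin 2) : (Fin 2 → L2 ℂ) →L[ℂ] L2 ℂ := ContinuousLinearMap.proj i

/-- The sequence of `(Φ_i(ωσ) - Φ_j(ω)) / (ω Rk) - 1`. -/
def D1 : (Fin 2 → L2 ℂ) →L[ℂ] L2 Ang :=
  (diag (sobolev hs hρ) (vt_pos s hρ) (Equiv.addRight (1 : ℤ))
    (wt_mul_norm_shift_le hρ K.norm_α)).comp (prj i) +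
  (diag (sobolev hs hρ) (vt_pos s hρ) (Equiv.addRight (1 : ℤ))
    (wt_mul_norm_shift_le hρ K.norm_β)).comp (prj j)

/-- The sequence of the complex conjugate of the function represented by `D1`. -/
def D2 : (Fin 2 → L2 ℂ) →L[ℂ] L2 Ang :=
  (diag (sobolev hs hρ) (vt_pos s hρ) (Equiv.subLeft (1 : ℤ))
    (wt_mul_norm_refl_le hρ K.norm_α)).comp (prj i) +
  (diag (sobolev hs hρ) (vt_pos s hρ) (Equiv.subLeft (1 : ℤ))
    (wt_mul_norm_refl_le hρ K.norm_β)).comp (prj j)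

/-- The linear part of the sequence of functionals given by the numerator of `S`. -/
def Ul : (Fin 2 → L2 ℂ) →L[ℂ] L2 (Ang →L[ℂ] ℂ) :=
  (diag (sobolev hs hρ) (vt_pos s hρ) (Equiv.refl ℤ)
    (wt_mul_norm_LkMul_le hρ b i j K.int_α)).comp (prj i) +
  (diag (sobolev hs hρ) (vt_pos s hρ) (Equiv.refl ℤ)
    (wt_mul_norm_LkMul_le hρ b i j K.int_β)).comp (prj j)

/-- The combination of the coefficients of the kernel. -/
def comb (x : Fin 2 → L2 ℂ) (m : ℤ) : Ang :=
  (x i m / (vt s ρ m : ℂ)) • K.α m + (x j m / (vt s ρ m : ℂ)) • K.β m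

/-- The operator `S` on sequences. -/
def Sop (x : Fin 2 → L2 ℂ) : L2 ℂ :=
  conv (sobolev hs hρ) (ContinuousLinearMap.id ℂ (Ang →L[ℂ] ℂ))
    (mono (sobolev hs hρ) 1 (Lk b i j) + Ul hs hρ K x)
    (cmul (sobolev hs hρ) (invSqrt (sobolev hs hρ) (D1 hs hρ K x))
      (invSqrt (sobolev hs hρ) (D2 hs hρ K x)))

variable {ω : ℂ} (hω : ‖ω‖ = 1)

lemma hasSum_D1 (x : Fin 2 → L2 ℂ) : HasSum (fun m => ω ^ (m - 1) • comb (ρ := ρ) (s := s) K x m)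
    (ev (sobolev hs hρ) hω (D1 hs hρ K x)) := by
  have h1 := hasSum_ev_diag (sobolev hs hρ) (vt_pos s hρ) (Equiv.addRight (1 : ℤ))
    (wt_mul_norm_shift_le hρ K.norm_α) hω (x i)
  have h2 := hasSum_ev_diag (sobolev hs hρ) (vt_pos s hρ) (Equiv.addRight (1 : ℤ))
    (wt_mul_norm_shift_le hρ K.norm_β) hω (x j)
  have h3 := (Equiv.subRight (1 : ℤ)).hasSum_iff.2 (h1.add h2)
  refine HasSum.congr_both h3 (fun m => ?_) ?_
  · simp only [Function.comp_apply, Equiv.subRight_apply, Equiv.coe_addRight, sub_add_cancel, comb,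
      smul_add, smul_smul]
  · rw [D1, add_apply, map_add]; rfl

lemma hasSum_D2 (x : Fin 2 → L2 ℂ) : HasSum (fun m => ω ^ (1 - m) •
    ((x i m / (vt s ρ m : ℂ)) • star (K.α m) + (x j m / (vt s ρ m : ℂ)) • star (K.β m)))
    (ev (sobolev hs hρ) hω (D2 hs hρ K x)) := by
  have h1 := hasSum_ev_diag (sobolev hs hρ) (vt_pos s hρ) (Equiv.subLeft (1 : ℤ))
    (wt_mul_norm_refl_le hρ K.norm_α) hω (x i)
  have h2 := hasSum_ev_diag (sobolev hs hρ) (vt_pos s hρ) (Equiv.subLeft (1 : ℤ))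
    (wt_mul_norm_refl_le hρ K.norm_β) hω (x j)
  have h3 := (Equiv.subLeft (1 : ℤ)).hasSum_iff.2 (h1.add h2)
  refine HasSum.congr_both h3 (fun m => ?_) ?_
  · simp only [Function.comp_apply, Equiv.subLeft_apply, sub_sub_cancel, smul_add, smul_smul]
  · rw [D2, add_apply, map_add]; rfl

lemma hasSum_Ul (x : Fin 2 → L2 ℂ) (φ : Ang) :
    HasSum (fun m : ℤ => m * ω ^ m * Lk b i j (comb (ρ := ρ) (s := s) K x m * φ))
    (ev (sobolev hs hρ) hω (Ul hs hρ K x) φ) := by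
  have h1 := hasSum_ev_diag (E := Ang →L[ℂ] ℂ) (sobolev hs hρ) (vt_pos s hρ) (Equiv.refl ℤ)
    (wt_mul_norm_LkMul_le hρ b i j K.int_α) hω (x i)
  have h2 := hasSum_ev_diag (E := Ang →L[ℂ] ℂ) (sobolev hs hρ) (vt_pos s hρ) (Equiv.refl ℤ)
    (wt_mul_norm_LkMul_le hρ b i j K.int_β) hω (x j)
  have h3 := (h1.add h2).mapL (ContinuousLinearMap.apply ℂ ℂ φ)
  refine HasSum.congr_both h3 (fun m => ?_) ?_
  · simp only [ContinuousLinearMap.apply_apply, Equiv.refl_apply, LkMul_apply, comb, add_mul, smul_mul_assoc,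
      map_add, map_smul, smul_eq_mul]
    ring
  · rw [Ul, add_apply, map_add]; rfl

lemma ev_Sop (x : Fin 2 → L2 ℂ) : ev (sobolev hs hρ) hω (Sop hs hρ K x) =
    ω * Lk b i j (ev (sobolev hs hρ) hω (invSqrt (sobolev hs hρ) (D1 hs hρ K x)) *
      ev (sobolev hs hρ) hω (invSqrt (sobolev hs hρ) (D2 hs hρ K x))) +
    ev (sobolev hs hρ) hω (Ul hs hρ K x)
      (ev (sobolev hs hρ) hω (invSqrt (sobolev hs hρ) (D1 hs hρ K x)) *
      ev (sobolev hs hρ) hω (invSqrt (sobolev hs hρ) (D2 hs hρ K x))) := by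
  rw [Sop, ev_conv, ev_conv, map_add, ev_mono, zpow_one]
  rfl

/-- For real coefficients, conjugation on the circle only reflects the exponents and conjugates the
kernels. `D2` does this to the kernels and exponents alone and therefore stays complex linear. -/
lemma ev_D2 (x : Fin 2 → L2 ℂ) (hx : ∀ l m, conj (x l m) = x l m) :
    ev (sobolev hs hρ) hω (D2 hs hρ K x) = star (ev (sobolev hs hρ) hω (D1 hs hρ K x)) := by
  refine (hasSum_D2 hs hρ K hω x).unique ?_
  refine (hasSum_D1 hs hρ K hω x).star.congr_fun fun m => ?_
  have hconj : star ω = ω⁻¹ := by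
    rw [Complex.inv_def, Complex.normSq_eq_norm_sq, hω]; simp
  have h1 : star (ω ^ (m - 1)) = ω ^ (1 - m) := by
    rw [star_zpow₀, hconj, inv_zpow, ← zpow_neg, neg_sub]
  have h2 : ∀ l, star (x l m / (vt s ρ m : ℂ)) = x l m / (vt s ρ m : ℂ) := fun l => by
    change conj _ = _
    rw [map_div₀, hx, Complex.conj_ofReal]
  rw [star_smul, h1, comb, star_add, star_smul, star_smul, h2, h2]

end Sop

/-! ### The operator on sequences represents `S` -/

/-- The norm bound of the evaluation maps. -/
def evBound (W : ConvWeight) : ℝ := √(∑' n, (W.w n)⁻¹ ^ 2)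

lemma norm_ev_le {E : Type*} [NormedAddCommGroup E] [NormedSpace ℂ E] [CompleteSpace E]
    (W : ConvWeight) {ω : ℂ} (hω : ‖ω‖ = 1) (x : L2 E) : ‖ev W hω x‖ ≤ evBound W * ‖x‖ :=
  ContinuousLinearMap.le_of_opNorm_le _ (LinearMap.mkContinuous_norm_le _ (Real.sqrt_nonneg _) _) x

section Sop

variable {s : ℕ} (hs : 1 ≤ s) {ρ : ℝ} (hρ : 1 < ρ) {b : ℝ} {i j : Fin 2} (K : Kern b i j)

/-- The smallness condition under which `Sop` represents `S`. -/
def IsSmall (x : Fin 2 → L2 ℂ) : Prop :=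
  (sobolev hs hρ).K * ‖D1 hs hρ K x‖ < 1 / 4 ∧ (sobolev hs hρ).K * ‖D2 hs hρ K x‖ < 1 / 4 ∧
    evBound (sobolev hs hρ) * ‖D1 hs hρ K x‖ < 1

lemma eventually_isSmall : ∀ᶠ x in 𝓝 0, IsSmall hs hρ K x := by
  have h : ∀ (c d : ℝ) (T : (Fin 2 → L2 ℂ) →L[ℂ] L2 Ang), 0 < d →
      ∀ᶠ x in 𝓝 0, c * ‖T x‖ < d := fun c d T hd => by
    have hc : Continuous fun x => c * ‖T x‖ := continuous_const.mul T.continuous.norm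
    exact hc.continuousAt.eventually_lt continuousAt_const (by simpa using hd)
  exact (h _ _ _ (by norm_num)).and ((h _ _ _ (by norm_num)).and (h _ _ _ one_pos))

variable {ω : ℂ} (hω : ‖ω‖ = 1)

/-- The product of the inverse square roots. -/
def invAbs (x : Fin 2 → L2 ℂ) : Ang :=
  ev (sobolev hs hρ) hω (invSqrt (sobolev hs hρ) (D1 hs hρ K x)) *
    ev (sobolev hs hρ) hω (invSqrt (sobolev hs hρ) (D2 hs hρ K x))

lemma invAbs_apply {x : Fin 2 → L2 ℂ} (hx : ∀ l m, conj (x l m) = x l m)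
    (hsm : IsSmall hs hρ K x) (θ : ℝ) : invAbs hs hρ K hω x θ =
      ((‖1 + ev (sobolev hs hρ) hω (D1 hs hρ K x) θ‖⁻¹ : ℝ) : ℂ) := by
  obtain ⟨h1, h2, h3⟩ := hsm
  set d := ev (sobolev hs hρ) hω (D1 hs hρ K x) with hd
  have hd1 : ‖d θ‖ < 1 :=
    ((d.norm_coe_le_norm θ).trans (norm_ev_le _ hω _)).trans_lt h3
  have e2 : ev (sobolev hs hρ) hω (D2 hs hρ K x) θ = conj (d θ) := by
    rw [ev_D2 hs hρ K hω x hx]; rfl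
  have hd2 : ‖ev (sobolev hs hρ) hω (D2 hs hρ K x) θ‖ < 1 := by
    rwa [e2, RCLike.norm_conj]
  have e3 : invAbs hs hρ K hω x θ =
      ev (sobolev hs hρ) hω (invSqrt (sobolev hs hρ) (D1 hs hρ K x)) θ *
      ev (sobolev hs hρ) hω (invSqrt (sobolev hs hρ) (D2 hs hρ K x)) θ := rfl
  rw [e3, ev_invSqrt _ hω h1.le θ hd1, ev_invSqrt _ hω h2.le θ hd2, e2]
  have e4 : 1 + conj (d θ) = conj (1 + d θ) := by rw [map_add, map_one]
  rw [e4]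
  refine cpow_neg_half_mul_conj ?_
  have := (abs_lt.1 ((Complex.abs_re_le_norm (d θ)).trans_lt hd1)).1
  rw [Complex.add_re, Complex.one_re]
  linarith

lemma norm_comb_le (x : Fin 2 → L2 ℂ) (m : ℤ) : ‖comb (s := s) (ρ := ρ) K x m‖ ≤
    K.C * ((‖x i m / (vt s ρ m : ℂ)‖ + ‖x j m / (vt s ρ m : ℂ)‖) * (1 + |(m : ℝ)|)) := by
  refine (norm_add_le _ _).trans ?_
  rw [norm_smul, norm_smul]
  have h1 := mul_le_mul_of_nonneg_left (K.norm_α m) (norm_nonneg (x i m / (vt s ρ m : ℂ)))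
  have h2 := mul_le_mul_of_nonneg_left (K.norm_β m) (norm_nonneg (x j m / (vt s ρ m : ℂ)))
  linarith

lemma summable_mul_comb (hs2 : 2 ≤ s) (hρ : 1 < ρ) (hω : ‖ω‖ = 1) (x : Fin 2 → L2 ℂ) :
    Summable fun m : ℤ => (m * ω ^ m : ℂ) • comb (s := s) (ρ := ρ) K x m := by
  have h := ((summable_div_vt hs2 hρ (x i)).add (summable_div_vt hs2 hρ (x j))).mul_left K.C
  refine Summable.of_norm_bounded h fun m => ?_
  rw [norm_smul, norm_mul, norm_zpow, hω, one_zpow, mul_one, ← Complex.ofReal_intCast,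
    Complex.norm_real, Real.norm_eq_abs]
  have h1 := norm_comb_le (s := s) (ρ := ρ) K x m
  have h0 := (norm_nonneg _).trans h1
  calc |(m : ℝ)| * ‖comb (s := s) (ρ := ρ) K x m‖
      ≤ (1 + |(m : ℝ)|) * (K.C * ((‖x i m / (vt s ρ m : ℂ)‖ + ‖x j m / (vt s ρ m : ℂ)‖) *
          (1 + |(m : ℝ)|))) := by
        gcongr
        linarith
    _ = _ := by ring

/-- For `s ≥ 2` the differentiated series converges in the sup norm, so the series of functionals is
one integral against an honest function. -/
lemma ev_Sop_eq_integral (hs2 : 2 ≤ s) (x : Fin 2 → L2 ℂ) :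
    ev (sobolev hs hρ) hω (Sop hs hρ K x) = (2 * π : ℂ)⁻¹ * ∫ θ in (0 : ℝ)..2 * π,
      sgnR b i j θ * ((ω + (∑' m : ℤ, (m * ω ^ m : ℂ) • comb (s := s) (ρ := ρ) K x m) θ) *
        invAbs hs hρ K hω x θ) := by
  have h1 := (summable_mul_comb K hs2 hρ hω x).hasSum
  have h2 := h1.mapL ((Lk b i j).comp ((ContinuousLinearMap.mul ℂ Ang).flip (invAbs hs hρ K hω x)))
  have h3 := hasSum_Ul hs hρ K hω x (invAbs hs hρ K hω x)
  have h4 := h3.unique (h2.congr_fun fun m => by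
    simp only [ContinuousLinearMap.comp_apply, ContinuousLinearMap.flip_apply,
      ContinuousLinearMap.mul_apply', map_smul, smul_eq_mul])
  rw [ev_Sop]
  change ω * Lk b i j (invAbs hs hρ K hω x) +
    ev (sobolev hs hρ) hω (Ul hs hρ K x) (invAbs hs hρ K hω x) = _
  rw [h4]
  change ω * Lk b i j (invAbs hs hρ K hω x) + Lk b i j (_ * invAbs hs hρ K hω x) = _
  rw [← smul_eq_mul, ← map_smul, ← map_add, Lk_apply]
  congr 1
  refine intervalIntegral.integral_congr fun θ _ => ?_
  simp only [BoundedContinuousFunction.coe_add, BoundedContinuousFunction.coe_smul,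
    BoundedContinuousFunction.coe_mul, Pi.add_apply, Pi.mul_apply, smul_eq_mul]
  ring

lemma S_eq_integral (P Q : ℂ → ℂ) (φ : ℝ) : S P Q (cs φ) = (2 * π : ℂ)⁻¹ *
    ∫ θ in (0 : ℝ)..2 * π, (cs (θ + φ) * deriv P (cs (θ + φ)) - cs φ * deriv Q (cs φ)) /
      (‖P (cs (θ + φ)) - Q (cs φ)‖ : ℂ) := by
  rw [integral_shift (f := fun θ => (cs θ * deriv P (cs θ) - cs φ * deriv Q (cs φ)) /
      (‖P (cs θ) - Q (cs φ)‖ : ℂ)) (fun θ => by simp only [cs_add_two_pi]), S, fint,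
    circleIntegral]
  have e : ∀ θ : ℝ, deriv (circleMap 0 1) θ •
      ((circleMap 0 1 θ * deriv P (circleMap 0 1 θ) - cs φ * deriv Q (cs φ)) /
      (‖P (circleMap 0 1 θ) - Q (cs φ)‖ : ℂ) / circleMap 0 1 θ) =
      I * ((cs θ * deriv P (cs θ) - cs φ * deriv Q (cs φ)) / (‖P (cs θ) - Q (cs φ)‖ : ℂ)) := by
    intro θ
    rw [deriv_circleMap, smul_eq_mul]
    change cs θ * I * (_ / _ / cs θ) = _
    have := cs_ne_zero θ
    field_simp
  simp only [e, intervalIntegral.integral_const_mul]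
  rw [← mul_assoc]
  congr 1
  have hpi : (π : ℂ) ≠ 0 := by exact_mod_cast Real.pi_ne_zero
  field_simp

lemma cs_add (θ φ : ℝ) : cs (θ + φ) = cs φ * cs θ := by
  simp only [cs_eq, ← Complex.exp_add]; push_cast; ring_nf

lemma exists_cs_eq {ω : ℂ} (hω : ‖ω‖ = 1) : ∃ φ : ℝ, ω = cs φ := ⟨ω.arg, by
  rw [cs_eq]; simpa [hω] using (Complex.norm_mul_exp_arg_mul_I ω).symm⟩

/-- The sequences `x` are the weighted Laurent coefficients of the functions `f`. -/
structure IsCoef (s : ℕ) (ρ : ℝ) (f : Fin 2 → ℂ → ℂ) (x : Fin 2 → L2 ℂ) : Prop where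
  real : ∀ l m, conj (x l m) = x l m
  hasSum : ∀ l (ω : ℂ), ‖ω‖ = 1 → HasSum (fun m => x l m / (vt s ρ m : ℂ) * ω ^ m) (f l ω)
  hasSum_deriv : ∀ l (ω : ℂ), ‖ω‖ = 1 →
    HasSum (fun m : ℤ => m * (x l m / (vt s ρ m : ℂ)) * ω ^ m) (ω * deriv (f l) ω)
  differentiableAt : ∀ l (ω : ℂ), ‖ω‖ = 1 → DifferentiableAt ℂ (f l) ω

lemma IsCoef.mul_deriv_Phi {f : Fin 2 → ℂ → ℂ} {x : Fin 2 → L2 ℂ} (h : IsCoef s ρ f x) (b : ℝ)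
    (l : Fin 2) {ω : ℂ} (hω : ‖ω‖ = 1) :
    ω * deriv (Phi b f l) ω = (b : ℂ) ^ (l : ℕ) * ω + ω * deriv (f l) ω := by
  have h1 : HasDerivAt (Phi b f l) ((b : ℂ) ^ (l : ℕ) * 1 + deriv (f l) ω) ω :=
    ((hasDerivAt_id ω).const_mul _).add (h.differentiableAt l ω hω).hasDerivAt
  rw [h1.deriv]
  ring

lemma comb_mul_Rk (x : Fin 2 → L2 ℂ) (m : ℤ) {θ : ℝ} (hθ : θ ∈ Ioo 0 (2 * π)) :
    comb (s := s) (ρ := ρ) K x m θ * Rk b i j θ =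
      x i m / (vt s ρ m : ℂ) * cs θ ^ m - x j m / (vt s ρ m : ℂ) :=
  K.eq m θ hθ fun l => x l m / (vt s ρ m : ℂ)

/-- `Rk` divides both the increment `Φ_i(ωσ) - Φ_j(ω)` and the numerator of `S`. The quotients are
`ω(1+d)` and `ω+T`, and the leftover `Rk/|Rk|` is the phase in `Lk`; the endpoints of the period,
where `Rk` may vanish, do not matter. -/
lemma S_eq_ev {f : Fin 2 → ℂ → ℂ} {x : Fin 2 → L2 ℂ} (h : IsCoef s ρ f x) (hs2 : 2 ≤ s)
    (hsm : IsSmall hs hρ K x) :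
    S (Phi b f i) (Phi b f j) ω = ev (sobolev hs hρ) hω (Sop hs hρ K x) := by
  obtain ⟨φ, rfl⟩ := exists_cs_eq hω
  rw [S_eq_integral, ev_Sop_eq_integral hs hρ K hω hs2]
  congr 1
  refine integral_congr_Ioo Real.two_pi_pos.le fun θ hθ => ?_
  have hφ := cs_ne_zero φ
  set R := Rk b i j θ with hR
  have hR0 : R ≠ 0 := K.Rk_ne θ hθ
  set d := ev (sobolev hs hρ) hω (D1 hs hρ K x) θ with hd
  set T := (∑' m : ℤ, (m * cs φ ^ m : ℂ) • comb (s := s) (ρ := ρ) K x m) θ with hT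
  have hRe : R = (b : ℂ) ^ (i : ℕ) * cs θ - (b : ℂ) ^ (j : ℕ) := rfl
  have hd1 := (hasSum_D1 hs hρ K hω x).mapL (BoundedContinuousFunction.evalCLM ℂ θ)
  have hT1 := (summable_mul_comb K hs2 hρ hω x).hasSum.mapL (BoundedContinuousFunction.evalCLM ℂ θ)
  have hn : ‖cs φ * cs θ‖ = 1 := by rw [norm_mul, norm_cm, norm_cm, one_mul]
  have e1 : f i (cs φ * cs θ) - f j (cs φ) = cs φ * R * d := by
    refine ((h.hasSum i _ hn).sub (h.hasSum j _ hω)).unique ?_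
    refine (hd1.mul_left (cs φ * R)).congr_fun fun m => ?_
    change _ = cs φ * R * (cs φ ^ (m - 1) * comb (s := s) (ρ := ρ) K x m θ)
    have hc := comb_mul_Rk (s := s) (ρ := ρ) K x m hθ
    have hinv : cs φ * (cs φ)⁻¹ = 1 := mul_inv_cancel₀ hφ
    rw [zpow_sub_one₀ hφ, mul_zpow]
    linear_combination -(cs φ ^ m) * hc -
      cs φ ^ m * R * comb (s := s) (ρ := ρ) K x m θ * hinv
  have e2 : cs φ * cs θ * deriv (f i) (cs φ * cs θ) - cs φ * deriv (f j) (cs φ) = R * T := by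
    refine ((h.hasSum_deriv i _ hn).sub (h.hasSum_deriv j _ hω)).unique ?_
    refine (hT1.mul_left R).congr_fun fun m => ?_
    change _ = R * (m * cs φ ^ m * comb (s := s) (ρ := ρ) K x m θ)
    have hc := comb_mul_Rk (s := s) (ρ := ρ) K x m hθ
    rw [mul_zpow]
    linear_combination -(m * cs φ ^ m) * hc
  have e3 : Phi b f i (cs (θ + φ)) - Phi b f j (cs φ) = cs φ * R * (1 + d) := by
    rw [cs_add, Phi, Phi, hRe]
    rw [hRe] at e1
    linear_combination e1
  have e4 : cs (θ + φ) * deriv (Phi b f i) (cs (θ + φ)) - cs φ * deriv (Phi b f j) (cs φ) =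
      R * (cs φ + T) := by
    rw [cs_add, h.mul_deriv_Phi b i hn, h.mul_deriv_Phi b j hω, hRe]
    rw [hRe] at e2
    linear_combination e2
  rw [e3, e4, invAbs_apply hs hρ K hω h.real hsm θ, ← hd, norm_mul, norm_mul, norm_cm, one_mul,
    sgnR, ← hR]
  push_cast
  rw [div_eq_mul_inv, mul_inv]
  ring

/-! ### The derivative of the operator on sequences -/

lemma Sop_zero : Sop hs hρ K 0 = conv (sobolev hs hρ) (ContinuousLinearMap.id ℂ (Ang →L[ℂ] ℂ))
    (mono (sobolev hs hρ) 1 (Lk b i j))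
    (cmul (sobolev hs hρ) (mono (sobolev hs hρ) 0 1) (mono (sobolev hs hρ) 0 1)) := by
  simp only [Sop, map_zero, add_zero, invSqrt_zero]

lemma ev_Sop_zero : ev (sobolev hs hρ) hω (Sop hs hρ K 0) = ω * Lk b i j 1 := by
  rw [Sop_zero, ev_conv, ev_conv, ev_mono, ev_mono, zpow_one, zpow_zero, one_smul,
    ContinuousLinearMap.mul_apply', mul_one]
  rfl

lemma exists_hasFDerivAt_bilinear {E F G H : Type*} [NormedAddCommGroup E] [NormedSpace ℂ E]
    [NormedAddCommGroup F] [NormedSpace ℂ F] [NormedAddCommGroup G] [NormedSpace ℂ G]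
    [NormedAddCommGroup H] [NormedSpace ℂ H] (B : E →L[ℂ] F →L[ℂ] G) {f : H → E} {g : H → F}
    {f' : H →L[ℂ] E} {g' : H →L[ℂ] F} {x : H} (hf : HasFDerivAt f f' x) (hg : HasFDerivAt g g' x) :
    ∃ D : H →L[ℂ] G, HasFDerivAt (fun y => B (f y) (g y)) D x ∧
      ∀ h, D h = B (f x) (g' h) + B (f' h) (g x) :=
  ⟨_, B.hasFDerivAt_of_bilinear hf hg, fun _ => rfl⟩

/-- The product rule at `0`, where both inverse square roots are the unit: each contributes `-1/2`
times its argument, paired with the constant functional `ω Lk`. -/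
lemma exists_hasFDerivAt_Sop : ∃ D : (Fin 2 → L2 ℂ) →L[ℂ] L2 ℂ, HasFDerivAt (Sop hs hρ K) D 0 ∧
    ∀ (ω : ℂ) (hω : ‖ω‖ = 1) (h : Fin 2 → L2 ℂ), ev (sobolev hs hρ) hω (D h) =
      ev (sobolev hs hρ) hω (Ul hs hρ K h) 1 -
        1 / 2 * (ω * Lk b i j (ev (sobolev hs hρ) hω (D1 hs hρ K h))) -
        1 / 2 * (ω * Lk b i j (ev (sobolev hs hρ) hω (D2 hs hρ K h))) := by
  have hinv : ∀ T : (Fin 2 → L2 ℂ) →L[ℂ] L2 Ang,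
      HasFDerivAt (fun x => invSqrt (sobolev hs hρ) (T x)) ((-1 / 2 : ℂ) • T) 0 := by
    intro T
    have h1 : HasFDerivAt (invSqrt (sobolev hs hρ))
        ((-1 / 2 : ℂ) • ContinuousLinearMap.id ℂ (L2 Ang)) (T 0) := by
      rw [map_zero]; exact hasFDerivAt_invSqrt _
    exact h1.comp 0 T.hasFDerivAt
  have hU : HasFDerivAt (fun x => mono (sobolev hs hρ) 1 (Lk b i j) + Ul hs hρ K x)
      (Ul hs hρ K) 0 := (Ul hs hρ K).hasFDerivAt.const_add _
  obtain ⟨Dm, hm, hm'⟩ := exists_hasFDerivAt_bilinear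
    (conv (sobolev hs hρ) (ContinuousLinearMap.mul ℂ Ang)) (hinv (D1 hs hρ K)) (hinv (D2 hs hρ K))
  let B : L2 (Ang →L[ℂ] ℂ) →L[ℂ] L2 Ang →L[ℂ] L2 ℂ :=
    conv (sobolev hs hρ) (ContinuousLinearMap.id ℂ (Ang →L[ℂ] ℂ))
  have hB : ∀ (ω : ℂ) (hω : ‖ω‖ = 1) (x : L2 (Ang →L[ℂ] ℂ)) (y : L2 Ang),
      ev (sobolev hs hρ) hω (B x y) = ev (sobolev hs hρ) hω x (ev (sobolev hs hρ) hω y) :=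
    fun ω hω x y => ev_conv _ _ hω x y
  obtain ⟨D, hS, hS'⟩ := exists_hasFDerivAt_bilinear B hU hm
  refine ⟨D, hS, fun ω hω h => ?_⟩
  simp only [hS', hm', map_zero, add_zero, invSqrt_zero, map_add, hB, ev_conv, ev_mono, zpow_one,
    zpow_zero, one_smul, ContinuousLinearMap.mul_apply', mul_one, one_mul, smul_apply, map_smul,
    smul_eq_mul]
  ring

/-- The mean values of the first kind in the derivative of `S`. -/
def Em (s : ℕ) (ρ : ℝ) (h : Fin 2 → L2 ℂ) (m : ℤ) : ℂ := Lk b i j (comb (s := s) (ρ := ρ) K h m)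

/-- The mean values of the second kind in the derivative of `S`. -/
def Fm (s : ℕ) (ρ : ℝ) (h : Fin 2 → L2 ℂ) (m : ℤ) : ℂ :=
  Lk b i j ((h i m / (vt s ρ m : ℂ)) • star (K.α m) + (h j m / (vt s ρ m : ℂ)) • star (K.β m))

/-- `D1` carries `ω^(m-1)`, so its term has the same power as `Ul` and turns the factor `m` into `m
- 1/2`. `D2` produces the reflected power. -/
lemma hasSum_ev_deriv (h : Fin 2 → L2 ℂ) :
    HasSum (fun m : ℤ => (m - 1 / 2) * ω ^ m * Em K s ρ h m - 1 / 2 * (ω ^ (2 - m) * Fm K s ρ h m))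
      (ev (sobolev hs hρ) hω (Ul hs hρ K h) 1 -
        1 / 2 * (ω * Lk b i j (ev (sobolev hs hρ) hω (D1 hs hρ K h))) -
        1 / 2 * (ω * Lk b i j (ev (sobolev hs hρ) hω (D2 hs hρ K h)))) := by
  have hω0 : ω ≠ 0 := by rintro rfl; simp at hω
  have h1 := hasSum_Ul hs hρ K hω h 1
  have h2 := (((hasSum_D1 hs hρ K hω h).mapL (Lk b i j)).mul_left ω).mul_left (1 / 2)
  have h3 := (((hasSum_D2 hs hρ K hω h).mapL (Lk b i j)).mul_left ω).mul_left (1 / 2)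
  refine ((h1.sub h2).sub h3).congr_fun fun m => ?_
  have e : ω ^ (2 - m) = ω * ω ^ (1 - m) := by
    rw [← zpow_one_add₀ hω0]; congr 1; ring
  simp only [map_smul, smul_eq_mul, mul_one, zpow_sub_one₀ hω0, e, Em, Fm]
  field_simp

end Sop

/-! ### The kernel of a boundary component with itself -/

/-- The quotient `(σ^m - 1) / (σ - 1)` at `σ = e^{iθ}`. -/
def geoFun (m : ℤ) (θ : ℝ) : ℂ :=
  if 0 ≤ m then ∑ l ∈ Finset.range m.natAbs, cs θ ^ l
  else -(cs θ ^ m * ∑ l ∈ Finset.range m.natAbs, cs θ ^ l)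

lemma continuous_geoFun (m : ℤ) : Continuous (geoFun m) := by
  have h1 : Continuous fun θ => ∑ l ∈ Finset.range m.natAbs, cs θ ^ l :=
    continuous_finsetSum _ fun l _ => continuous_cs.pow l
  unfold geoFun
  split_ifs
  · exact h1
  · exact ((continuous_cs_zpow m).mul h1).neg

lemma norm_geoFun_le (m : ℤ) (θ : ℝ) : ‖geoFun m θ‖ ≤ |(m : ℝ)| := by
  have h1 : ‖∑ l ∈ Finset.range m.natAbs, cs θ ^ l‖ ≤ |(m : ℝ)| := by
    refine (norm_sum_le _ _).trans_eq ?_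
    simp only [norm_pow, norm_cm, one_pow, Finset.sum_const, Finset.card_range, nsmul_eq_mul,
      mul_one]
    rw [Nat.cast_natAbs, Int.cast_abs]
  unfold geoFun
  split_ifs
  · exact h1
  · rwa [norm_neg, norm_mul, norm_cs_zpow, one_mul]

lemma geoFun_mul (m : ℤ) (θ : ℝ) : geoFun m θ * (cs θ - 1) = cs θ ^ m - 1 := by
  have h0 := cs_ne_zero θ
  unfold geoFun
  split_ifs with h
  · obtain ⟨n, rfl⟩ := Int.eq_ofNat_of_zero_le h
    rw [Int.natAbs_natCast, geom_sum_mul, zpow_natCast]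
  · obtain ⟨n, rfl⟩ := Int.exists_eq_neg_ofNat (le_of_not_ge h)
    rw [Int.natAbs_neg, Int.natAbs_natCast, neg_mul, mul_assoc, geom_sum_mul, zpow_neg,
      zpow_natCast]
    have := pow_ne_zero n h0
    field_simp
    ring

/-- `geoFun` as a bounded continuous function. -/
def geo (m : ℤ) : Ang :=
  BoundedContinuousFunction.ofNormedAddCommGroup (geoFun m) (continuous_geoFun m) |(m : ℝ)|
    (norm_geoFun_le m)

lemma norm_geo_le (m : ℤ) : ‖geo m‖ ≤ |(m : ℝ)| :=
  BoundedContinuousFunction.norm_ofNormedAddCommGroup_le _ (abs_nonneg _) _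

lemma integral_norm_geo_le (m : ℤ) :
    ∫ θ in (0 : ℝ)..2 * π, ‖geo m θ‖ ≤ 100 * (1 + Real.log (1 + |(m : ℝ)|)) := by
  refine (le_of_eq ?_).trans (integral_norm_singKer_le m)
  rw [intervalIntegral.integral_of_le Real.two_pi_pos.le,
    intervalIntegral.integral_of_le Real.two_pi_pos.le, integral_Ioc_eq_integral_Ioo,
    integral_Ioc_eq_integral_Ioo]
  refine setIntegral_congr_fun measurableSet_Ioo fun θ hθ => ?_
  have h1 := (norm_cs_sub_one_pos hθ).ne'
  change ‖geoFun m θ‖ = ‖singKer m θ‖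
  rw [singKer, ← geoFun_mul, norm_div, norm_mul, Complex.norm_real, norm_norm]
  field_simp

lemma Rk_self (b : ℝ) (i : Fin 2) (θ : ℝ) : Rk b i i θ = (b : ℂ) ^ (i : ℕ) * (cs θ - 1) := by
  rw [Rk]; ring

/-- The kernel of a boundary component with itself. -/
def kernSelf {b : ℝ} (hb : b ∈ Ioo (0 : ℝ) 1) (i : Fin 2) : Kern b i i where
  α m := ((b : ℂ) ^ (i : ℕ))⁻¹ • geo m
  β _ := 0
  C := (b ^ (i : ℕ))⁻¹ * 100
  norm_α m := by
    have h0 := hb.1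
    rw [norm_smul, norm_inv, norm_pow, Complex.norm_real, Real.norm_of_nonneg h0.le, mul_assoc]
    gcongr
    have := norm_geo_le m
    linarith [abs_nonneg (m : ℝ)]
  norm_β m := by
    have h0 := hb.1
    rw [norm_zero]
    positivity
  int_α m := by
    have h0 := hb.1
    have e : ∀ θ, ‖(((b : ℂ) ^ (i : ℕ))⁻¹ • geo m) θ‖ = (b ^ (i : ℕ))⁻¹ * ‖geo m θ‖ := fun θ => by
      rw [BoundedContinuousFunction.smul_apply, norm_smul, norm_inv, norm_pow, Complex.norm_real,
        Real.norm_of_nonneg h0.le]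
    simp only [e, intervalIntegral.integral_const_mul]
    rw [mul_assoc]
    gcongr
    exact integral_norm_geo_le m
  int_β m := by
    have h0 := hb.1
    have := log_one_add_abs_nonneg m
    simp only [BoundedContinuousFunction.coe_zero, Pi.zero_apply, norm_zero,
      intervalIntegral.integral_zero]
    positivity
  Rk_ne θ hθ := by
    have h0 : (b : ℂ) ≠ 0 := by exact_mod_cast hb.1.ne'
    rw [Rk_self]
    exact mul_ne_zero (pow_ne_zero _ h0) (norm_pos_iff.1 (norm_cs_sub_one_pos hθ))
  eq m θ hθ x := by
    have h0 : (b : ℂ) ≠ 0 := by exact_mod_cast hb.1.ne'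
    have h1 := pow_ne_zero (i : ℕ) h0
    have h2 := geoFun_mul m θ
    rw [Rk_self]
    change (x i * (((b : ℂ) ^ (i : ℕ))⁻¹ * geoFun m θ) + x i * 0) * _ = _
    field_simp
    linear_combination x i * h2

/-! ### The kernel of two different boundary components -/

lemma one_sub_le_norm_Rk {b : ℝ} (hb : b ∈ Ioo (0 : ℝ) 1) {i j : Fin 2} (hij : i ≠ j) (θ : ℝ) :
    1 - b ≤ ‖Rk b i j θ‖ := by
  have h := one_sub_le_norm hb θ
  fin_cases i <;> fin_cases j
  · exact absurd rfl hij
  · simpa [Rk] using h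
  · have := norm_mul_cs_sub_one b θ
    rw [← this] at h
    simpa [Rk] using h
  · exact absurd rfl hij

lemma Rk_ne_zero {b : ℝ} (hb : b ∈ Ioo (0 : ℝ) 1) {i j : Fin 2} (hij : i ≠ j) (θ : ℝ) :
    Rk b i j θ ≠ 0 :=
  norm_pos_iff.1 ((sub_pos.2 hb.2).trans_le (one_sub_le_norm_Rk hb hij θ))

/-- The quotient `σ^m / Rk` as a bounded continuous function. -/
def quo {b : ℝ} (hb : b ∈ Ioo (0 : ℝ) 1) {i j : Fin 2} (hij : i ≠ j) (m : ℤ) : Ang :=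
  BoundedContinuousFunction.ofNormedAddCommGroup (fun θ => cs θ ^ m / Rk b i j θ)
    ((continuous_cs_zpow m).div (continuous_Rk b i j) (Rk_ne_zero hb hij)) (1 - b)⁻¹ fun θ => by
      rw [norm_div, norm_cs_zpow, one_div]
      exact inv_anti₀ (sub_pos.2 hb.2) (one_sub_le_norm_Rk hb hij θ)

lemma norm_quo_le {b : ℝ} (hb : b ∈ Ioo (0 : ℝ) 1) {i j : Fin 2} (hij : i ≠ j) (m : ℤ) :
    ‖quo hb hij m‖ ≤ (1 - b)⁻¹ :=
  BoundedContinuousFunction.norm_ofNormedAddCommGroup_le _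
    (inv_nonneg.2 (sub_pos.2 hb.2).le) _

lemma integral_norm_le {a : Ang} {C : ℝ} (ha : ‖a‖ ≤ C) :
    ∫ θ in (0 : ℝ)..2 * π, ‖a θ‖ ≤ C * 7 := by
  have h0 := (norm_nonneg a).trans ha
  have h1 : ∫ θ in (0 : ℝ)..2 * π, ‖a θ‖ ≤ ∫ _ in (0 : ℝ)..2 * π, C :=
    intervalIntegral.integral_mono_on Real.two_pi_pos.le
      (a.continuous.norm.intervalIntegrable _ _) intervalIntegrable_const
      fun θ _ => (a.norm_coe_le_norm θ).trans ha
  rw [intervalIntegral.integral_const, sub_zero, smul_eq_mul] at h1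
  nlinarith [Real.pi_lt_d2]

lemma le_mul_one_add {C x : ℝ} (hC : 0 ≤ C) (hx : 0 ≤ x) : C ≤ C * (1 + x) := by
  nlinarith [mul_nonneg hC hx]

/-- The kernel of two different boundary components. -/
def kernCross {b : ℝ} (hb : b ∈ Ioo (0 : ℝ) 1) {i j : Fin 2} (hij : i ≠ j) : Kern b i j where
  α m := quo hb hij m
  β _ := -quo hb hij 0
  C := (1 - b)⁻¹ * 7
  norm_α m := by
    have h0 := inv_pos.2 (sub_pos.2 hb.2)
    refine ((norm_quo_le hb hij m).trans ?_).trans (le_mul_one_add (by positivity) (abs_nonneg _))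
    linarith
  norm_β m := by
    have h0 := inv_pos.2 (sub_pos.2 hb.2)
    rw [norm_neg]
    refine ((norm_quo_le hb hij 0).trans ?_).trans (le_mul_one_add (by positivity) (abs_nonneg _))
    linarith
  int_α m := by
    have h0 := inv_pos.2 (sub_pos.2 hb.2)
    exact (integral_norm_le (norm_quo_le hb hij m)).trans
      (le_mul_one_add (by positivity) (log_one_add_abs_nonneg m))
  int_β m := by
    have h0 := inv_pos.2 (sub_pos.2 hb.2)
    exact (integral_norm_le (by rw [norm_neg]; exact norm_quo_le hb hij 0)).trans
      (le_mul_one_add (by positivity) (log_one_add_abs_nonneg m))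
  Rk_ne θ _ := Rk_ne_zero hb hij θ
  eq m θ _ x := by
    have h1 := Rk_ne_zero hb hij θ
    change (x i * (cs θ ^ m / Rk b i j θ) + x j * -(cs θ ^ (0 : ℤ) / Rk b i j θ)) * _ = _
    rw [zpow_zero]
    field_simp
    ring

/-- The kernel of two boundary components. -/
def kern {b : ℝ} (hb : b ∈ Ioo (0 : ℝ) 1) (i j : Fin 2) : Kern b i j :=
  -- The transport along `i = j` never has to be unfolded: the mean values below are computed for an
  -- arbitrary `Kern`.
  if h : i = j then h ▸ kernSelf hb i else kernCross hb h

/-! ### The mean values in the derivative of `S` -/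

section Mean

open Finset in
-- `lam` contains the term `j = 0`, which `Sn` omits; it accounts for `2/π`.
lemma Sn_succ (n : ℕ) : Sn (n + 1) = lam (n + 1) / (2 * π) - 2 / π := by
  have hpi := Real.pi_ne_zero
  have h : lam (n + 1) = 4 * (1 + ∑ k ∈ Ico 1 (n + 1), 1 / (2 * (k : ℝ) + 1)) := by
    rw [lam, range_eq_Ico, ← Finset.sum_Ico_consecutive _ (Nat.zero_le 1) (by omega : 1 ≤ n + 1)]
    simp
  rw [h, Sn]
  field_simp
  ring

variable {s : ℕ} {ρ : ℝ} {b : ℝ} {i j : Fin 2} (K : Kern b i j)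

lemma Em_eq (h : Fin 2 → L2 ℂ) (m : ℤ) : Em K s ρ h m = (2 * π : ℂ)⁻¹ *
    ∫ θ in (0 : ℝ)..2 * π, (h i m / (vt s ρ m : ℂ) * cs θ ^ m - h j m / (vt s ρ m : ℂ)) /
      (‖Rk b i j θ‖ : ℂ) := by
  rw [Em, Lk_apply]
  congr 1
  refine integral_congr_Ioo Real.two_pi_pos.le fun θ hθ => ?_
  rw [← comb_mul_Rk (s := s) (ρ := ρ) K h m hθ, sgnR]
  ring

/-- With real coefficients the conjugated quotient is the conjugated numerator over `conj Rk`.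
Multiplying by the phase gives `Rk²/|Rk|³`. -/
lemma Fm_eq (h : Fin 2 → L2 ℂ) (hh : ∀ l m, conj (h l m) = h l m) (m : ℤ) :
    Fm K s ρ h m = (2 * π : ℂ)⁻¹ * ∫ θ in (0 : ℝ)..2 * π,
      (h i m / (vt s ρ m : ℂ) * cs θ ^ (-m) - h j m / (vt s ρ m : ℂ)) * Rk b i j θ ^ 2 /
      (‖Rk b i j θ‖ : ℂ) ^ 3 := by
  rw [Fm, Lk_apply]
  congr 1
  refine integral_congr_Ioo Real.two_pi_pos.le fun θ hθ => ?_
  have h1 := congrArg conj (comb_mul_Rk (s := s) (ρ := ρ) K h m hθ)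
  have h2 : ∀ l, conj (h l m / (vt s ρ m : ℂ)) = h l m / (vt s ρ m : ℂ) := fun l => by
    rw [map_div₀, hh, Complex.conj_ofReal]
  have h3 : conj (comb (s := s) (ρ := ρ) K h m θ) =
      ((h i m / (vt s ρ m : ℂ)) • star (K.α m) + (h j m / (vt s ρ m : ℂ)) • star (K.β m)) θ := by
    change conj (h i m / (vt s ρ m : ℂ) * K.α m θ + h j m / (vt s ρ m : ℂ) * K.β m θ) = _
    rw [map_add, map_mul, map_mul, h2, h2]
    rfl
  rw [map_mul, map_sub, map_mul, h2, h2, h3, map_zpow₀, conj_cs, inv_zpow, ← zpow_neg] at h1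
  have hR := K.Rk_ne θ hθ
  have hn : (‖Rk b i j θ‖ : ℂ) ≠ 0 := by exact_mod_cast (norm_pos_iff.2 hR).ne'
  have hR2 : Rk b i j θ * conj (Rk b i j θ) = (‖Rk b i j θ‖ : ℂ) ^ 2 := by
    rw [Complex.mul_conj, Complex.normSq_eq_norm_sq]; push_cast; rfl
  rw [← h1, sgnR]
  generalize ((h i m / (vt s ρ m : ℂ)) • star (K.α m) + (h j m / (vt s ρ m : ℂ)) • star (K.β m)) θ = t
  rw [div_mul_eq_mul_div, div_eq_div_iff hn (pow_ne_zero 3 hn)]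
  linear_combination -(Rk b i j θ * t * (‖Rk b i j θ‖ : ℂ)) * hR2

lemma Lk_one (b : ℝ) (i j : Fin 2) : Lk b i j 1 =
    (2 * π : ℂ)⁻¹ * ∫ θ in (0 : ℝ)..2 * π, Rk b i j θ / (‖Rk b i j θ‖ : ℂ) := by
  rw [Lk_apply]
  simp only [BoundedContinuousFunction.coe_one, Pi.one_apply, mul_one, sgnR]

lemma Em_self {b : ℝ} (hb : b ∈ Ioo (0 : ℝ) 1) {i : Fin 2} (K : Kern b i i) (h : Fin 2 → L2 ℂ)
    (m : ℤ) : (b : ℂ) ^ (i : ℕ) * Em K s ρ h m =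
      h i m / (vt s ρ m : ℂ) * ((2 * π : ℂ)⁻¹ * sing m) := by
  have h0 : (b : ℂ) ≠ 0 := by exact_mod_cast hb.1.ne'
  have h1 := pow_ne_zero (i : ℕ) h0
  have e : ∀ θ, (h i m / (vt s ρ m : ℂ) * cs θ ^ m - h i m / (vt s ρ m : ℂ)) /
      (‖Rk b i i θ‖ : ℂ) = ((b : ℂ) ^ (i : ℕ))⁻¹ * (h i m / (vt s ρ m : ℂ)) * singKer m θ := by
    intro θ
    rw [Rk_self, norm_mul, norm_pow, Complex.norm_real, Real.norm_of_nonneg hb.1.le, singKer]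
    push_cast
    rw [div_eq_mul_inv, mul_inv]
    ring
  rw [Em_eq]
  simp only [e, intervalIntegral.integral_const_mul]
  rw [sing]
  field_simp

/-- On the circle `(σ-1)² = -σ|σ-1|²`, so the third power cancels and only a shift of the exponent
by one remains. -/
lemma Fm_self {b : ℝ} (hb : b ∈ Ioo (0 : ℝ) 1) {i : Fin 2} (K : Kern b i i) (h : Fin 2 → L2 ℂ)
    (hh : ∀ l m, conj (h l m) = h l m) (m : ℤ) : (b : ℂ) ^ (i : ℕ) * Fm K s ρ h m =
      -(h i m / (vt s ρ m : ℂ) * ((2 * π : ℂ)⁻¹ * (sing (1 - m) - sing 1))) := by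
  have h0 : (b : ℂ) ≠ 0 := by exact_mod_cast hb.1.ne'
  have h1 := pow_ne_zero (i : ℕ) h0
  have e : ∀ θ ∈ Ioo (0 : ℝ) (2 * π), (h i m / (vt s ρ m : ℂ) * cs θ ^ (-m) -
      h i m / (vt s ρ m : ℂ)) * Rk b i i θ ^ 2 / (‖Rk b i i θ‖ : ℂ) ^ 3 =
      -(((b : ℂ) ^ (i : ℕ))⁻¹ * (h i m / (vt s ρ m : ℂ))) *
        (singKer (1 - m) θ - singKer 1 θ) := by
    intro θ hθ
    have hc := cs_ne_zero θ
    have hn : (‖cs θ - 1‖ : ℂ) ≠ 0 := by exact_mod_cast (norm_cs_sub_one_pos hθ).ne'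
    have h2 : (‖cs θ - 1‖ : ℂ) ^ 2 = (cs θ - 1) * ((cs θ)⁻¹ - 1) := by
      have := sq_norm_cs_sub' 1 θ
      simpa using this
    have h3 : (cs θ - 1) ^ 2 = -cs θ * (‖cs θ - 1‖ : ℂ) ^ 2 := by
      rw [h2]; field_simp; ring
    rw [Rk_self, norm_mul, norm_pow, Complex.norm_real, Real.norm_of_nonneg hb.1.le, singKer,
      singKer, mul_pow, h3, zpow_one, sub_eq_add_neg 1 m, zpow_add₀ hc, zpow_one]
    push_cast
    generalize h i m / (vt s ρ m : ℂ) = y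
    generalize (b : ℂ) ^ (i : ℕ) = q at h1 ⊢
    field_simp
    ring
  rw [Fm_eq K h hh, integral_congr_Ioo Real.two_pi_pos.le e, intervalIntegral.integral_const_mul,
    intervalIntegral.integral_sub (intervalIntegrable_singKer _ _ _)
      (intervalIntegrable_singKer _ _ _), sing, sing]
  field_simp

lemma Lk_one_self {b : ℝ} (hb : b ∈ Ioo (0 : ℝ) 1) (i : Fin 2) :
    Lk b i i 1 = (2 * π : ℂ)⁻¹ * sing 1 := by
  have h0 : (b : ℂ) ≠ 0 := by exact_mod_cast hb.1.ne'
  have h1 := pow_ne_zero (i : ℕ) h0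
  rw [Lk_one, sing]
  congr 1
  refine intervalIntegral.integral_congr fun θ _ => ?_
  simp only [Rk_self, norm_mul, norm_pow, Complex.norm_real, Real.norm_of_nonneg hb.1.le, singKer,
    zpow_one]
  push_cast
  rw [mul_div_mul_left _ _ h1]

lemma Rk_zero_one (b θ : ℝ) : Rk b 0 1 θ = cs θ - b := by simp [Rk]

lemma Rk_one_zero (b θ : ℝ) : Rk b 1 0 θ = b * cs θ - 1 := by simp [Rk]

lemma integral_sub_div_norm {b : ℝ} (hb : b ∈ Ioo (0 : ℝ) 1) (y y' : ℂ) (m m' : ℤ) :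
    (2 * π : ℂ)⁻¹ * ∫ θ in (0 : ℝ)..2 * π, (y * cs θ ^ m - y' * cs θ ^ m') / (‖cs θ - b‖ : ℂ) =
      y * Bn b m - y' * Bn b m' := by
  have e : ∀ θ, (y * cs θ ^ m - y' * cs θ ^ m') / (‖cs θ - b‖ : ℂ) =
      y * (cs θ ^ m / (‖cs θ - b‖ : ℂ)) - y' * (cs θ ^ m' / (‖cs θ - b‖ : ℂ)) := fun θ => by ring
  have hi : ∀ (y : ℂ) (m : ℤ), IntervalIntegrable (fun θ => y * (cs θ ^ m / (‖cs θ - b‖ : ℂ)))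
      volume 0 (2 * π) := fun y m =>
    (continuous_const.mul (continuous_Bn_integrand hb m)).intervalIntegrable _ _
  simp only [e]
  rw [intervalIntegral.integral_sub (hi _ _) (hi _ _),
    intervalIntegral.integral_const_mul, intervalIntegral.integral_const_mul, Bn, Bn]
  ring

lemma integral_sub_div_cube {b : ℝ} (hb : b ∈ Ioo (0 : ℝ) 1) {g : ℝ → ℂ} (hg : Continuous g)
    (y y' : ℂ) (m : ℤ) :
    (2 * π : ℂ)⁻¹ * ∫ θ in (0 : ℝ)..2 * π, (y * cs θ ^ m - y') * g θ / (‖cs θ - b‖ : ℂ) ^ 3 =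
      y * ((2 * π : ℂ)⁻¹ * ∫ θ in (0 : ℝ)..2 * π, cs θ ^ m * g θ / (‖cs θ - b‖ : ℂ) ^ 3) -
      y' * ((2 * π : ℂ)⁻¹ * ∫ θ in (0 : ℝ)..2 * π, cs θ ^ (0 : ℤ) * g θ / (‖cs θ - b‖ : ℂ) ^ 3) := by
  have e : ∀ θ, (y * cs θ ^ m - y') * g θ / (‖cs θ - b‖ : ℂ) ^ 3 =
      y * (cs θ ^ m * g θ / (‖cs θ - b‖ : ℂ) ^ 3) -
      y' * (cs θ ^ (0 : ℤ) * g θ / (‖cs θ - b‖ : ℂ) ^ 3) := fun θ => by rw [zpow_zero]; ring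
  have hc : ∀ m : ℤ, Continuous fun θ => cs θ ^ m * g θ / (‖cs θ - b‖ : ℂ) ^ 3 := fun m =>
    continuous_div_cube hb ((continuous_cs_zpow m).mul hg)
  have hi : ∀ (y : ℂ) (m : ℤ), IntervalIntegrable
      (fun θ => y * (cs θ ^ m * g θ / (‖cs θ - b‖ : ℂ) ^ 3)) volume 0 (2 * π) := fun y m =>
    (continuous_const.mul (hc m)).intervalIntegrable _ _
  simp only [e]
  rw [intervalIntegral.integral_sub (hi _ _) (hi _ _),
    intervalIntegral.integral_const_mul, intervalIntegral.integral_const_mul]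
  ring

lemma Em_zero_one {b : ℝ} (hb : b ∈ Ioo (0 : ℝ) 1) (K : Kern b 0 1) (h : Fin 2 → L2 ℂ) (m : ℤ) :
    Em K s ρ h m = h 0 m / (vt s ρ m : ℂ) * Bn b m - h 1 m / (vt s ρ m : ℂ) * Bn b 0 := by
  rw [Em_eq, ← integral_sub_div_norm hb]
  simp only [Rk_zero_one, zpow_zero, mul_one]

lemma Em_one_zero {b : ℝ} (hb : b ∈ Ioo (0 : ℝ) 1) (K : Kern b 1 0) (h : Fin 2 → L2 ℂ) (m : ℤ) :
    Em K s ρ h m = h 1 m / (vt s ρ m : ℂ) * Bn b m - h 0 m / (vt s ρ m : ℂ) * Bn b 0 := by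
  rw [Em_eq, ← integral_sub_div_norm hb]
  simp only [Rk_one_zero, zpow_zero, mul_one, norm_mul_cs_sub_one]

lemma Fm_zero_one {b : ℝ} (hb : b ∈ Ioo (0 : ℝ) 1) (K : Kern b 0 1) (h : Fin 2 → L2 ℂ)
    (hh : ∀ l m, conj (h l m) = h l m) (m : ℤ) : b * Fm K s ρ h m =
      h 0 m / (vt s ρ m : ℂ) *
        ((2 * ((-m : ℤ) : ℂ) + 1) * b * Bn b (-m) - 2 * (((-m : ℤ) : ℂ) + 1) * Bn b (-m + 1)) -
      h 1 m / (vt s ρ m : ℂ) * (b * Bn b 0 - 2 * Bn b 1) := by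
  have h1 := integral_Dn hb (-m)
  have h2 := integral_Dn hb 0
  have hg : Continuous fun θ => (cs θ - b) ^ 2 := (continuous_cs.sub continuous_const).pow 2
  rw [Fm_eq K h hh]
  simp only [Rk_zero_one]
  rw [integral_sub_div_cube hb hg]
  rw [Int.cast_zero, zero_add, zero_add] at h2
  linear_combination h 0 m / (vt s ρ m : ℂ) * h1 - h 1 m / (vt s ρ m : ℂ) * h2

lemma Fm_one_zero {b : ℝ} (hb : b ∈ Ioo (0 : ℝ) 1) (K : Kern b 1 0) (h : Fin 2 → L2 ℂ)
    (hh : ∀ l m, conj (h l m) = h l m) (m : ℤ) : Fm K s ρ h m =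
      h 1 m / (vt s ρ m : ℂ) *
        ((2 * ((-m : ℤ) : ℂ) + 1) * Bn b (-m) - 2 * (((-m : ℤ) : ℂ) + 1) * b * Bn b (-m + 1)) -
      h 0 m / (vt s ρ m : ℂ) * (Bn b 0 - 2 * b * Bn b 1) := by
  have h1 := integral_Cn hb (-m)
  have h2 := integral_Cn hb 0
  have hg : Continuous fun θ => (b * cs θ - 1) ^ 2 :=
    ((continuous_const.mul continuous_cs).sub continuous_const).pow 2
  rw [Fm_eq K h hh]
  simp only [Rk_one_zero, norm_mul_cs_sub_one]
  rw [integral_sub_div_cube hb hg]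
  rw [Int.cast_zero, zero_add, zero_add] at h2
  linear_combination h 1 m / (vt s ρ m : ℂ) * h1 - h 0 m / (vt s ρ m : ℂ) * h2

lemma Lk_one_zero_one {b : ℝ} (hb : b ∈ Ioo (0 : ℝ) 1) : Lk b 0 1 1 = Bn b 1 - b * Bn b 0 := by
  have h := integral_sub_div_norm hb 1 b 1 0
  rw [one_mul] at h
  rw [← h, Lk_one]
  simp only [Rk_zero_one, zpow_one, one_mul, zpow_zero, mul_one]

lemma Lk_one_one_zero {b : ℝ} (hb : b ∈ Ioo (0 : ℝ) 1) : Lk b 1 0 1 = b * Bn b 1 - Bn b 0 := by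
  have h := integral_sub_div_norm hb b 1 1 0
  rw [one_mul] at h
  rw [← h, Lk_one]
  simp only [Rk_one_zero, zpow_one, one_mul, zpow_zero, norm_mul_cs_sub_one]

/-- The Fourier multiplier of the linearized functional, before simplification. -/
def gam {b : ℝ} (hb : b ∈ Ioo (0 : ℝ) 1) (Ω : ℝ) (s : ℕ) (ρ : ℝ) (j : Fin 2) (h : Fin 2 → L2 ℂ)
    (m : ℤ) : ℂ :=
  (Ω * b ^ (j : ℕ) - Lk b 0 j 1 + Lk b 1 j 1) * (m * (h j m / (vt s ρ m : ℂ))) +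
    1 / 2 * (b ^ (j : ℕ) * Fm (kern hb 0 j) s ρ h m) -
    1 / 2 * (b ^ (j : ℕ) * Fm (kern hb 1 j) s ρ h m) -
    b ^ (j : ℕ) * (Ω * (h j m / (vt s ρ m : ℂ)) - (m - 1 / 2) * Em (kern hb 0 j) s ρ h m +
      (m - 1 / 2) * Em (kern hb 1 j) s ρ h m)

lemma lam_succ (n : ℕ) : lam (n + 1) = lam n + 4 / (2 * n + 1) := by
  rw [lam, lam, Finset.sum_range_succ]
  ring

lemma sing_one : sing 1 = -4 := by
  have := sing_natCast 1
  rw [lam_succ, lam] at this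
  simpa using this

/-- The contributions of `Bn b n` and `Bn b 0` cancel between the derivative of the numerator, that
of the denominator and the velocity at the annulus. What survives is `B_1` and `B_(n+1)`, that is
`bΛ_1` and `bΛ_(n+1)`, and the values of `sing` combine to `S_(n+1)`. -/
lemma gam_eq {b : ℝ} (hb : b ∈ Ioo (0 : ℝ) 1) (Ω : ℝ) (j : Fin 2) (h : Fin 2 → L2 ℂ)
    (hh : ∀ l m, conj (h l m) = h l m) (n : ℕ) (a c : ℝ)
    (ha : h 0 (-(n : ℤ)) / (vt s ρ (-(n : ℤ)) : ℂ) = a)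
    (hc : h 1 (-(n : ℤ)) / (vt s ρ (-(n : ℤ)) : ℂ) = c) :
    gam hb Ω s ρ j h (-(n : ℤ)) = ((-((n + 1) * (M b Ω (n + 1) *ᵥ ![a, c]) j) : ℝ) : ℂ) := by
  have hpi : (π : ℂ) ≠ 0 := by exact_mod_cast Real.pi_ne_zero
  have hn : (2 * n + 1 : ℂ) ≠ 0 := by exact_mod_cast (by omega : 2 * n + 1 ≠ 0)
  have hB1 : Bn b 1 = b * Lam 1 b := by rw [b_mul_Lam hb 1]; simp
  have hBn : Bn b (-(-(n : ℤ)) + 1) = b * Lam (n + 1) b := by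
    rw [b_mul_Lam hb (n + 1), neg_neg]; simp
  have hs1 : sing (1 - -(n : ℤ)) = -(lam n + 4 / (2 * n + 1) : ℂ) := by
    have := sing_natCast (n + 1)
    rw [lam_succ] at this
    have e : (1 - -(n : ℤ)) = ((n + 1 : ℕ) : ℤ) := by push_cast; ring
    rw [e, this]
    push_cast
    rfl
  have hSn : (Sn (n + 1) : ℂ) = (lam n + 4 / (2 * n + 1)) / (2 * π) - 2 / π := by
    rw [Sn_succ, lam_succ]
    push_cast
    rfl
  have hneg : Bn b (-(-(n : ℤ))) = Bn b (-(n : ℤ)) := Bn_neg b _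
  have key : ∀ j, (M b Ω (n + 1) *ᵥ ![a, c]) j = M b Ω (n + 1) j 0 * a + M b Ω (n + 1) j 1 * c := by
    intro j
    simp [Matrix.mulVec, dotProduct, Fin.sum_univ_two]
  rw [key]
  have hj : j = 0 ∨ j = 1 := by fin_cases j <;> simp
  rcases hj with rfl | rfl
  · have e1 := Em_self (s := s) (ρ := ρ) hb (kern hb 0 0) h (-(n : ℤ))
    have e2 := Fm_self (s := s) (ρ := ρ) hb (kern hb 0 0) h hh (-(n : ℤ))
    simp only [Fin.val_zero, pow_zero, one_mul] at e1 e2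
    rw [gam, Lk_one_self hb, Lk_one_one_zero hb, e1, e2, Em_one_zero hb, Fm_one_zero hb _ h hh]
    simp only [Fin.val_zero, pow_zero, one_mul, hneg, hB1, hBn, hs1, sing_one, sing_neg_natCast, ha,
      hc, M, Matrix.of_apply, Matrix.cons_val', Matrix.cons_val_zero, Matrix.cons_val_one,
      Matrix.cons_val_fin_one]
    push_cast
    rw [hSn]
    generalize Bn b (-(n : ℤ)) = X
    generalize Bn b 0 = Z
    field_simp
    ring
  · have e1 := Em_self (s := s) (ρ := ρ) hb (kern hb 1 1) h (-(n : ℤ))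
    have e2 := Fm_self (s := s) (ρ := ρ) hb (kern hb 1 1) h hh (-(n : ℤ))
    have e3 := Fm_zero_one (s := s) (ρ := ρ) hb (kern hb 0 1) h hh (-(n : ℤ))
    simp only [Fin.val_one, pow_one] at e1 e2
    rw [gam, Lk_one_self hb, Lk_one_zero_one hb, Em_zero_one hb]
    simp only [Fin.val_one, pow_one]
    rw [mul_add (b : ℂ), mul_left_comm (b : ℂ), e1, e2, e3]
    simp only [hneg, hB1, hBn, hs1, sing_one, sing_neg_natCast, ha,
      hc, M, Matrix.of_apply, Matrix.cons_val', Matrix.cons_val_zero, Matrix.cons_val_one,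
      Matrix.cons_val_fin_one]
    push_cast
    rw [hSn]
    generalize Bn b (-(n : ℤ)) = X
    generalize Bn b 0 = Z
    field_simp
    ring

end Mean

/-! ### The functional on sequences -/

section Hop

variable {s : ℕ} (hs : 1 ≤ s) {ρ : ℝ} (hρ : 1 < ρ)

lemma vt_neg (s : ℕ) (ρ : ℝ) (n : ℤ) : vt s ρ (-n) = vt s ρ n := by
  simp [vt, wt_neg]

lemma wt_mul_norm_one_le (hρ : 1 < ρ) (n : ℤ) :
    wt s ρ n * ‖(1 : ℂ)‖ ≤ 1 * vt s ρ (Equiv.refl ℤ n) := by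
  have h1 := wt_mul_le_vt (s := s) hρ n
  have h2 := mul_nonneg (wt_pos s hρ n).le (abs_nonneg (n : ℝ))
  rw [norm_one, Equiv.refl_apply]
  linarith

lemma wt_mul_norm_neg_le (hρ : 1 < ρ) (n : ℤ) :
    wt s ρ n * ‖((-n : ℤ) : ℂ)‖ ≤ 1 * vt s ρ (Equiv.neg ℤ n) := by
  have h1 := wt_mul_le_vt (s := s) hρ n
  have h2 := wt_pos s hρ n
  have e : ‖((-n : ℤ) : ℂ)‖ = |(n : ℝ)| := by
    rw [Int.cast_neg, norm_neg, ← Complex.ofReal_intCast, Complex.norm_real, Real.norm_eq_abs]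
  rw [e, Equiv.neg_apply, vt_neg]
  linarith

/-- The change of weights. -/
def idn : L2 ℂ →L[ℂ] L2 ℂ :=
  diag (sobolev hs hρ) (vt_pos s hρ) (Equiv.refl ℤ) (wt_mul_norm_one_le hρ)

/-- The conjugate of the derivative `z f'(z)` on the unit circle. -/
def cdn : L2 ℂ →L[ℂ] L2 ℂ :=
  diag (sobolev hs hρ) (vt_pos s hρ) (Equiv.neg ℤ) (wt_mul_norm_neg_le hρ)

variable {ω : ℂ} (hω : ‖ω‖ = 1)

lemma hasSum_ev_idn (x : L2 ℂ) :
    HasSum (fun n => x n / (vt s ρ n : ℂ) * ω ^ n) (ev (sobolev hs hρ) hω (idn hs hρ x)) := by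
  refine (hasSum_ev_diag (sobolev hs hρ) (vt_pos s hρ) (Equiv.refl ℤ) (wt_mul_norm_one_le hρ)
    hω x).congr_fun fun n => ?_
  rw [smul_eq_mul, mul_one, Equiv.refl_apply, mul_comm]

lemma hasSum_ev_cdn (x : L2 ℂ) : HasSum (fun n : ℤ => n * (x n / (vt s ρ n : ℂ)) * ω ^ (-n))
    (ev (sobolev hs hρ) hω (cdn hs hρ x)) := by
  refine (Equiv.neg ℤ).hasSum_iff.1 ((hasSum_ev_diag (sobolev hs hρ) (vt_pos s hρ) (Equiv.neg ℤ)
    (wt_mul_norm_neg_le hρ) hω x).congr_fun fun n => ?_)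
  simp only [Function.comp_apply, Equiv.neg_apply, smul_eq_mul, neg_neg]
  ring

variable {b : ℝ} (hb : b ∈ Ioo (0 : ℝ) 1) (Ω : ℝ) (j : Fin 2)

/-- The velocity factor of the functional. -/
def Hleft (x : Fin 2 → L2 ℂ) : L2 ℂ :=
  mono (sobolev hs hρ) 1 (Ω * (b : ℂ) ^ (j : ℕ)) + ((Ω : ℂ) • idn hs hρ (x j) -
    Sop hs hρ (kern hb 0 j) x + Sop hs hρ (kern hb 1 j) x)

/-- The normal factor of the functional. -/
def Hright (b : ℝ) (j : Fin 2) (x : Fin 2 → L2 ℂ) : L2 ℂ :=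
  mono (sobolev hs hρ) (-1) ((b : ℂ) ^ (j : ℕ)) + cdn hs hρ (x j)

/-- The functional `G_j` on sequences, before taking imaginary parts. -/
def Hop (x : Fin 2 → L2 ℂ) : L2 ℂ :=
  conv (sobolev hs hρ) (ContinuousLinearMap.mul ℂ ℂ) (Hleft hs hρ hb Ω j x) (Hright hs hρ b j x)

lemma ev_Hop (x : Fin 2 → L2 ℂ) : ev (sobolev hs hρ) hω (Hop hs hρ hb Ω j x) =
    ev (sobolev hs hρ) hω (Hleft hs hρ hb Ω j x) * ev (sobolev hs hρ) hω (Hright hs hρ b j x) := by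
  rw [Hop, ev_conv]; rfl

lemma ev_Hleft (x : Fin 2 → L2 ℂ) : ev (sobolev hs hρ) hω (Hleft hs hρ hb Ω j x) =
    Ω * ((b : ℂ) ^ (j : ℕ) * ω + ev (sobolev hs hρ) hω (idn hs hρ (x j))) -
      ev (sobolev hs hρ) hω (Sop hs hρ (kern hb 0 j) x) +
      ev (sobolev hs hρ) hω (Sop hs hρ (kern hb 1 j) x) := by
  rw [Hleft, map_add, map_add, map_sub, map_smul, ev_mono, zpow_one, smul_eq_mul, smul_eq_mul]
  ring

lemma ev_Hright (x : Fin 2 → L2 ℂ) : ev (sobolev hs hρ) hω (Hright hs hρ b j x) =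
    (b : ℂ) ^ (j : ℕ) * ω⁻¹ + ev (sobolev hs hρ) hω (cdn hs hρ (x j)) := by
  rw [Hright, map_add, ev_mono, zpow_neg_one, smul_eq_mul, mul_comm]

lemma conj_eq_inv_of_norm {ω : ℂ} (hω : ‖ω‖ = 1) : conj ω = ω⁻¹ := by
  rw [Complex.inv_def, Complex.normSq_eq_norm_sq, hω]; simp

lemma IsCoef.conj_mul_deriv {f : Fin 2 → ℂ → ℂ} {x : Fin 2 → L2 ℂ} (h : IsCoef s ρ f x)
    (l : Fin 2) : conj (ω * deriv (f l) ω) = ev (sobolev hs hρ) hω (cdn hs hρ (x l)) := by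
  refine HasSum.unique ?_ (hasSum_ev_cdn hs hρ hω (x l))
  refine (h.hasSum_deriv l ω hω).star.congr_fun fun m => ?_
  change _ = conj _
  rw [map_mul, map_mul, map_zpow₀, conj_eq_inv_of_norm hω, map_div₀, h.real, Complex.conj_ofReal,
    map_intCast, inv_zpow', zpow_neg]

/-- The normal factor is the conjugate of `ω Φ_j'(ω)`, which on real coefficients is the reflected
series given by `cdn`. -/
lemma Gfun_eq_im {f : Fin 2 → ℂ → ℂ} {x : Fin 2 → L2 ℂ} (h : IsCoef s ρ f x) (hs2 : 2 ≤ s)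
    (h0 : IsSmall hs hρ (kern hb 0 j) x) (h1 : IsSmall hs hρ (kern hb 1 j) x) :
    Gfun b Ω f j ω = (ev (sobolev hs hρ) hω (Hop hs hρ hb Ω j x)).im := by
  have e1 : ev (sobolev hs hρ) hω (idn hs hρ (x j)) = f j ω :=
    (hasSum_ev_idn hs hρ hω (x j)).unique (h.hasSum j ω hω)
  rw [ev_Hop, ev_Hleft, ev_Hright, ← S_eq_ev hs hρ _ hω h hs2 h0, ← S_eq_ev hs hρ _ hω h hs2 h1,
    ← h.conj_mul_deriv hs hρ hω j, e1, Gfun, mul_assoc, ← map_mul, mul_comm (deriv _ ω),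
    h.mul_deriv_Phi b j hω, map_add, map_mul, conj_eq_inv_of_norm hω, map_pow, Complex.conj_ofReal,
    Phi]

/-! ### Reflection symmetry -/

lemma conj_cs_eq (θ : ℝ) : conj (cs θ) = cs (-θ) := by
  rw [cs_eq, cs_eq, ← Complex.exp_conj]
  simp

lemma S_conj {P Q : ℂ → ℂ} (hP : ∀ ω, ‖ω‖ = 1 → P (conj ω) = conj (P ω))
    (hP' : ∀ ω, ‖ω‖ = 1 → conj ω * deriv P (conj ω) = conj (ω * deriv P ω))
    (hQ : ∀ ω, ‖ω‖ = 1 → Q (conj ω) = conj (Q ω))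
    (hQ' : ∀ ω, ‖ω‖ = 1 → conj ω * deriv Q (conj ω) = conj (ω * deriv Q ω))
    {ω : ℂ} (hω : ‖ω‖ = 1) : S P Q (conj ω) = conj (S P Q ω) := by
  obtain ⟨φ, rfl⟩ := exists_cs_eq hω
  rw [conj_cs_eq, S_eq_integral, S_eq_integral, map_mul, conj_integral]
  have e : conj ((2 * π : ℂ)⁻¹) = (2 * π : ℂ)⁻¹ := by
    rw [map_inv₀, map_mul, Complex.conj_ofReal, map_ofNat]
  rw [e]
  congr 1
  rw [← integral_reflect (f := fun θ => (cs (θ + -φ) * deriv P (cs (θ + -φ)) -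
    cs (-φ) * deriv Q (cs (-φ))) / (‖P (cs (θ + -φ)) - Q (cs (-φ))‖ : ℂ)) (fun θ => by
      have : θ + 2 * π + -φ = θ + -φ + 2 * π := by ring
      simp only [this, cs_add_two_pi]) 0]
  refine intervalIntegral.integral_congr fun θ _ => ?_
  have e1 : 0 - θ + -φ = -(θ + φ) := by ring
  simp only [e1, ← conj_cs_eq]
  rw [hP _ (norm_cm _), hP' _ (norm_cm _), hQ _ (norm_cm _), hQ' _ (norm_cm _), ← map_sub,
    ← map_sub, RCLike.norm_conj, map_div₀, Complex.conj_ofReal]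

lemma IsCoef.conj_apply {f : Fin 2 → ℂ → ℂ} {x : Fin 2 → L2 ℂ} (h : IsCoef s ρ f x)
    (l : Fin 2) {ω : ℂ} (hω : ‖ω‖ = 1) : f l (conj ω) = conj (f l ω) := by
  refine (h.hasSum l _ (by rwa [RCLike.norm_conj])).unique
    ((h.hasSum l ω hω).star.congr_fun fun m => ?_)
  change _ = conj _
  rw [map_mul, map_zpow₀, map_div₀, h.real, Complex.conj_ofReal]

lemma IsCoef.mul_deriv_conj {f : Fin 2 → ℂ → ℂ} {x : Fin 2 → L2 ℂ} (h : IsCoef s ρ f x)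
    (l : Fin 2) {ω : ℂ} (hω : ‖ω‖ = 1) :
    conj ω * deriv (f l) (conj ω) = conj (ω * deriv (f l) ω) := by
  refine (h.hasSum_deriv l _ (by rwa [RCLike.norm_conj])).unique
    ((h.hasSum_deriv l ω hω).star.congr_fun fun m => ?_)
  change _ = conj _
  rw [map_mul, map_mul, map_zpow₀, map_div₀, h.real, Complex.conj_ofReal, map_intCast]

lemma IsCoef.Phi_conj {f : Fin 2 → ℂ → ℂ} {x : Fin 2 → L2 ℂ} (h : IsCoef s ρ f x) (b : ℝ)
    (l : Fin 2) (ω : ℂ) (hω : ‖ω‖ = 1) : Phi b f l (conj ω) = conj (Phi b f l ω) := by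
  rw [Phi, Phi, h.conj_apply l hω, map_add, map_mul, map_pow, Complex.conj_ofReal]

lemma IsCoef.mul_deriv_Phi_conj {f : Fin 2 → ℂ → ℂ} {x : Fin 2 → L2 ℂ} (h : IsCoef s ρ f x)
    (b : ℝ) (l : Fin 2) (ω : ℂ) (hω : ‖ω‖ = 1) :
    conj ω * deriv (Phi b f l) (conj ω) = conj (ω * deriv (Phi b f l) ω) := by
  rw [h.mul_deriv_Phi b l hω, h.mul_deriv_Phi b l (by rwa [RCLike.norm_conj]),
    h.mul_deriv_conj l hω]
  simp only [map_add, map_mul, map_pow, Complex.conj_ofReal]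

/-- Real coefficients make the domain symmetric about the real axis, so `Φ_j`, `ωΦ_j'` and `S` all
commute with conjugation, and an imaginary part changes sign. -/
lemma Gfun_conj {f : Fin 2 → ℂ → ℂ} {x : Fin 2 → L2 ℂ} (h : IsCoef s ρ f x) (b : ℝ)
    {ω : ℂ} (hω : ‖ω‖ = 1) : Gfun b Ω f j (conj ω) = -Gfun b Ω f j ω := by
  have hS : ∀ i, S (Phi b f i) (Phi b f j) (conj ω) = conj (S (Phi b f i) (Phi b f j) ω) :=
    fun i => S_conj (h.Phi_conj b i) (h.mul_deriv_Phi_conj b i) (h.Phi_conj b j)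
      (h.mul_deriv_Phi_conj b j) hω
  rw [Gfun, Gfun, mul_assoc, mul_assoc, ← map_mul, ← map_mul, mul_comm (deriv _ _),
    mul_comm (deriv _ _), h.mul_deriv_Phi_conj b j ω hω, hS, hS, h.Phi_conj b j ω hω,
    ← Complex.conj_im]
  congr 1
  simp only [map_mul, map_add, map_sub, Complex.conj_ofReal]

/-! ### The derivative of the functional on sequences -/

/-- The coefficient of `ω^(1-m)` in the linearized functional. -/
def gamA (h : Fin 2 → L2 ℂ) (m : ℤ) : ℂ :=
  (Ω * b ^ (j : ℕ) - Lk b 0 j 1 + Lk b 1 j 1) * (m * (h j m / (vt s ρ m : ℂ))) +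
    1 / 2 * (b ^ (j : ℕ) * Fm (kern hb 0 j) s ρ h m) -
    1 / 2 * (b ^ (j : ℕ) * Fm (kern hb 1 j) s ρ h m)

/-- The coefficient of `ω^(m-1)` in the linearized functional. -/
def gamB (h : Fin 2 → L2 ℂ) (m : ℤ) : ℂ :=
  b ^ (j : ℕ) * (Ω * (h j m / (vt s ρ m : ℂ)) - (m - 1 / 2) * Em (kern hb 0 j) s ρ h m +
      (m - 1 / 2) * Em (kern hb 1 j) s ρ h m)

lemma exists_hasFDerivAt_Hop : ∃ D : (Fin 2 → L2 ℂ) →L[ℂ] L2 ℂ,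
    HasFDerivAt (Hop hs hρ hb Ω j) D 0 ∧ ∀ (ω : ℂ) (hω : ‖ω‖ = 1) (h : Fin 2 → L2 ℂ),
      HasSum (fun m : ℤ => gamA (s := s) (ρ := ρ) hb Ω j h m * ω ^ (1 - m) +
        gamB (s := s) (ρ := ρ) hb Ω j h m * ω ^ (m - 1)) (ev (sobolev hs hρ) hω (D h)) := by
  obtain ⟨D0, hD0, h0⟩ := exists_hasFDerivAt_Sop hs hρ (kern hb 0 j)
  obtain ⟨D1, hD1, h1⟩ := exists_hasFDerivAt_Sop hs hρ (kern hb 1 j)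
  have hi : HasFDerivAt (fun x : Fin 2 → L2 ℂ => (Ω : ℂ) • idn hs hρ (x j))
      ((Ω : ℂ) • (idn hs hρ).comp (prj j)) 0 := ((Ω : ℂ) • (idn hs hρ).comp (prj j)).hasFDerivAt
  have hl : HasFDerivAt (Hleft hs hρ hb Ω j) ((Ω : ℂ) • (idn hs hρ).comp (prj j) - D0 + D1) 0 :=
    ((hi.sub hD0).add hD1).const_add _
  have hr : HasFDerivAt (Hright hs hρ b j) ((cdn hs hρ).comp (prj j)) 0 :=
    ((cdn hs hρ).comp (prj j)).hasFDerivAt.const_add _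
  obtain ⟨D, hD, hD'⟩ := exists_hasFDerivAt_bilinear
    (conv (sobolev hs hρ) (ContinuousLinearMap.mul ℂ ℂ)) hl hr
  refine ⟨D, hD, fun ω hω h => ?_⟩
  have hω0 : ω ≠ 0 := by rintro rfl; simp at hω
  -- The two halves of the product rule: the varied normal against the velocity at the annulus,
  -- which is a multiple of `ω`, then the varied velocity against `b^j ω⁻¹`.
  have s1 := (hasSum_ev_cdn hs hρ hω (h j)).mul_left
    (ω * (Ω * b ^ (j : ℕ) - Lk b 0 j 1 + Lk b 1 j 1))
  have s2 := ((((hasSum_ev_idn hs hρ hω (h j)).mul_left (Ω : ℂ)).sub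
    (hasSum_ev_deriv hs hρ (kern hb 0 j) hω h)).add
    (hasSum_ev_deriv hs hρ (kern hb 1 j) hω h)).mul_right ((b : ℂ) ^ (j : ℕ) * ω⁻¹)
  refine HasSum.congr_both (s1.add s2) (fun m => ?_) ?_
  · have e1 : ω ^ (1 - m) = ω * ω ^ (-m) := by rw [← zpow_one_add₀ hω0]; congr 1
    have e2 : ω ^ (2 - m) * ω⁻¹ = ω * ω ^ (-m) := by
      rw [← zpow_one_add₀ hω0, ← zpow_sub_one₀ hω0]; congr 1; ring
    have e3 : ω ^ (m - 1) = ω ^ m * ω⁻¹ := zpow_sub_one₀ hω0 m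
    rw [gamA, gamB, e1, e3]
    linear_combination (1 / 2 * (b ^ (j : ℕ) * Fm (kern hb 1 j) s ρ h m) -
      1 / 2 * (b ^ (j : ℕ) * Fm (kern hb 0 j) s ρ h m)) * e2
  · rw [hD', map_add, ev_conv, ev_conv, ev_Hleft, ev_Hright, ev_Sop_zero, ev_Sop_zero]
    simp only [Pi.zero_apply, map_zero, add_zero, ContinuousLinearMap.mul_apply',
      ContinuousLinearMap.comp_apply, ContinuousLinearMap.proj_apply, add_apply,
      sub_apply, smul_apply, map_add, map_sub, map_smul, h0, h1, smul_eq_mul]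
    ring

lemma gam_eq_sub (h : Fin 2 → L2 ℂ) (m : ℤ) : gam hb Ω s ρ j h m =
    gamA (s := s) (ρ := ρ) hb Ω j h m - gamB (s := s) (ρ := ρ) hb Ω j h m := rfl

lemma gam_eq_zero (h : Fin 2 → L2 ℂ) (m : ℤ) (hm : ∀ l, h l m / (vt s ρ m : ℂ) = 0) :
    gam hb Ω s ρ j h m = 0 := by
  have hF : ∀ i, Fm (kern hb i j) s ρ h m = 0 := fun i => by
    rw [Fm, hm, hm, zero_smul, zero_smul, add_zero, map_zero]
  have hE : ∀ i, Em (kern hb i j) s ρ h m = 0 := fun i => by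
    rw [Em, comb, hm, hm, zero_smul, zero_smul, add_zero, map_zero]
  simp only [gam, hF, hE, hm, mul_zero, add_zero, sub_zero]

end Hop

/-! ### The functional between the function spaces -/

section Spaces

variable {ε : ℝ} {k : ℕ}

/-- The weighted Fourier coefficients of pairs of elements of `X`. -/
def coefX₂ (hε : ε ∈ Ioo (0 : ℝ) 1) (hk : 1 ≤ k) : (Fin 2 → X ε k) →L[ℝ] (Fin 2 → L2 ℂ) :=
  ContinuousLinearMap.pi fun l => (coefX hε hk).comp (ContinuousLinearMap.proj l)

lemma coefX₂_div (hε : ε ∈ Ioo (0 : ℝ) 1) (hk : 1 ≤ k) (f : Fin 2 → X ε k) (l : Fin 2) (n : ℤ) :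
    coefX₂ hε hk f l n / (vt (k - 1) ε⁻¹ n : ℂ) = cf (f l) n := coefX_div hε hk (f l) n

lemma isCoef_coefX₂ (hε : ε ∈ Ioo (0 : ℝ) 1) (hk : 1 ≤ k) (f : Fin 2 → X ε k) :
    IsCoef (k - 1) ε⁻¹ (fun l => f l) (coefX₂ hε hk f) where
  real l m := by
    have h := vt_pos (k - 1) ((one_lt_inv₀ hε.1).2 hε.2) m
    have h' : (vt (k - 1) ε⁻¹ m : ℂ) ≠ 0 := by exact_mod_cast h.ne'
    rw [(div_eq_iff h').1 (coefX₂_div hε hk f l m), map_mul, conj_cf hε, Complex.conj_ofReal]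
  hasSum l ω hω := (hasSum_cf hε (f l) hω).congr_fun fun m => by rw [coefX₂_div]
  hasSum_deriv l ω hω := (hasSum_mul_cf hε (f l) hω).congr_fun fun m => by rw [coefX₂_div]
  differentiableAt l ω hω := (f l).2.1.2.1.differentiableAt ((isOpen_extDom ε).mem_nhds (by
    change ε < ‖ω‖; rw [hω]; exact hε.2))

variable {b : ℝ} (hb : b ∈ Ioo (0 : ℝ) 1) (hε : ε ∈ Ioo (0 : ℝ) 1) (hk : 3 ≤ k) (Ω : ℝ)

/-- The map `G` near the annulus. -/
def Gloc (f : Fin 2 → X ε k) (j : Fin 2) : Y ε (k - 1) :=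
  projY (by omega : 1 ≤ k - 1) hε (Hop (by omega : 1 ≤ k - 1) ((one_lt_inv₀ hε.1).2 hε.2) hb Ω j
    (coefX₂ hε (by omega : 1 ≤ k) f))

lemma eventually_represents : ∀ᶠ f : Fin 2 → X ε k in 𝓝 0, ∀ j,
    Represents b Ω f j (Gloc hb hε hk Ω f j) := by
  have hk1 : 1 ≤ k := by omega
  have hs : 1 ≤ k - 1 := by omega
  have hρ := (one_lt_inv₀ hε.1).2 hε.2
  have hc : Tendsto (coefX₂ hε hk1) (𝓝 0) (𝓝 0) := by
    have := (coefX₂ hε hk1).continuous.tendsto 0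
    rwa [map_zero] at this
  have hsm : ∀ i j, ∀ᶠ f in 𝓝 0, IsSmall hs hρ (kern hb i j) (coefX₂ hε hk1 f) :=
    fun i j => hc.eventually (eventually_isSmall hs hρ (kern hb i j))
  have hall : ∀ᶠ f in 𝓝 0, ∀ i j, IsSmall hs hρ (kern hb i j) (coefX₂ hε hk1 f) :=
    eventually_all.2 fun i => eventually_all.2 fun j => hsm i j
  filter_upwards [hall] with f hf j ω hω
  have hω' : ‖conj ω‖ = 1 := by rwa [RCLike.norm_conj]
  have hcoef := isCoef_coefX₂ hε hk1 f
  have hs2 : 2 ≤ k - 1 := by omega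
  have h1 := Gfun_eq_im hs hρ hω hb Ω j hcoef hs2 (hf 0 j) (hf 1 j)
  have h2 := Gfun_eq_im hs hρ hω' hb Ω j hcoef hs2 (hf 0 j) (hf 1 j)
  rw [Gloc, projY_circle hs hε _ hω hω', ← h1, ← h2, Gfun_conj Ω j hcoef b hω]
  congr 1
  ring

/-- `G` selects some representative; since an element of `Y` is determined by its values on the
circle, the choice is forced. -/
lemma G_eventuallyEq : G ε k b Ω =ᶠ[𝓝 0] Gloc hb hε hk Ω := by
  filter_upwards [eventually_represents hb hε hk Ω] with f hf
  funext j
  have hex : ∃ g : Y ε (k - 1), Represents b Ω f j g := ⟨_, hf j⟩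
  have e : G ε k b Ω f j = hex.choose := dif_pos hex
  rw [e]
  exact Y_ext hε fun ω hω => (hex.choose_spec ω hω).trans (hf j ω hω).symm

/-- On the circle `ω^(m-1)` is the conjugate of `ω^(1-m)`, so taking the odd part makes the
coefficients enter only through `A m - B m`. -/
lemma hasSum_projY {s : ℕ} (hs : 1 ≤ s) (hε : ε ∈ Ioo (0 : ℝ) 1) {x : L2 ℂ} {A B : ℤ → ℂ}
    (h : ∀ (ω : ℂ) (hω : ‖ω‖ = 1), HasSum (fun m : ℤ => A m * ω ^ (1 - m) + B m * ω ^ (m - 1))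
      (ev (sobolev hs ((one_lt_inv₀ hε.1).2 hε.2)) hω x)) {ω : ℂ} (hω : ‖ω‖ = 1) :
    HasSum (fun m : ℤ => ((((A m - B m) * (ω ^ (1 - m) - conj ω ^ (1 - m))).im / 2 : ℝ) : ℂ))
      (projY hs hε x ω) := by
  have hω' : ‖conj ω‖ = 1 := by rwa [RCLike.norm_conj]
  rw [projY_circle hs hε _ hω hω', Complex.hasSum_ofReal]
  refine ((((h ω hω).mapL Complex.imCLM).sub ((h _ hω').mapL Complex.imCLM)).div_const
    2).congr_fun fun m => ?_
  have e : ω ^ (m - 1) = conj ω ^ (1 - m) := by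
    rw [conj_eq_inv_of_norm hω, inv_zpow', neg_sub]
  have e' : conj ω ^ (m - 1) = ω ^ (1 - m) := by
    rw [conj_eq_inv_of_norm hω, inv_zpow', neg_sub]
  rw [Complex.imCLM_apply, Complex.imCLM_apply, ← Complex.sub_im, e, e']
  congr 2
  ring

lemma exists_hasFDerivAt_G : ∃ D : (Fin 2 → X ε k) →L[ℝ] (Fin 2 → Y ε (k - 1)),
    HasFDerivAt (G ε k b Ω) D 0 ∧ ∀ (h : Fin 2 → X ε k) (j : Fin 2) (ω : ℂ), ‖ω‖ = 1 →
      HasSum (fun m : ℤ => (((gam hb Ω (k - 1) ε⁻¹ j (coefX₂ hε (by omega : 1 ≤ k) h) m *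
        (ω ^ (1 - m) - conj ω ^ (1 - m))).im / 2 : ℝ) : ℂ)) (D h j ω) := by
  have hk1 : 1 ≤ k := by omega
  have hs : 1 ≤ k - 1 := by omega
  have hρ := (one_lt_inv₀ hε.1).2 hε.2
  choose D hD hD' using fun j => exists_hasFDerivAt_Hop hs hρ hb Ω j
  -- The middle map is complex linear, but reading off coefficients and taking odd parts are only
  -- real linear, so scalars are restricted.
  refine ⟨ContinuousLinearMap.pi fun j => (projY hs hε).comp
    (((D j).restrictScalars ℝ).comp (coefX₂ hε hk1)), ?_, fun h j ω hω => ?_⟩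
  · refine HasFDerivAt.congr_of_eventuallyEq ?_ (G_eventuallyEq hb hε hk Ω)
    refine hasFDerivAt_pi.2 fun j => (projY hs hε).hasFDerivAt.comp 0 ?_
    have h0 : HasFDerivAt (Hop hs hρ hb Ω j) ((D j).restrictScalars ℝ) (coefX₂ hε hk1 0) := by
      rw [map_zero]
      exact (hD j).restrictScalars ℝ
    exact h0.comp 0 (coefX₂ hε hk1).hasFDerivAt
  · refine (hasSum_projY hs hε (fun ω hω => hD' j ω hω (coefX₂ hε hk1 h)) hω).congr_fun fun m => ?_
    rw [gam_eq_sub]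

/-! ### The Fourier multiplier and the theorem -/

lemma cf_eq_of_hasSum {u : ℂ → ℂ} {a : ℕ+ → ℝ} (h : ∀ ω : ℂ, ‖ω‖ = 1 →
    HasSum (fun n : ℕ+ => (a n : ℂ) * (conj ω) ^ (n : ℕ)) (u ω)) (n : ℕ+) :
    cf u (-((n : ℕ) : ℤ)) = a n := by
  have h1 := (h 1 norm_one).summable.norm
  simp only [map_one, one_pow, mul_one] at h1
  have h2 := hasSum_fourierCoeff h1 (fun n : ℕ+ => -((n : ℕ) : ℤ)) (u := fun θ => u (cs θ))
    (fun θ => (h _ (norm_cm θ)).congr_fun fun m => by rw [conj_cs, zpow_neg, zpow_natCast, inv_pow])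
    (-((n : ℕ) : ℤ))
  refine HasSum.unique h2 ((hasSum_ite_eq n (a n : ℂ)).congr_fun fun m => ?_)
  by_cases hm : m = n
  · rw [if_pos hm, if_pos (by rw [hm]), hm]
  · rw [if_neg hm, if_neg fun he => hm (PNat.coe_inj.1 (by omega))]

/-- Elements of `X` have only negative frequencies `m = -n`, and then `1 - m = n + 1`. The imaginary
part of `z - conj z` for `z = ω^(n+1)` supplies the factor `I/2` and absorbs the sign in `gam_eq`.
-/
lemma hasSum_multiplier {D : ℂ} (h : Fin 2 → X ε k) {a c : ℕ+ → ℝ}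
    (ha : ∀ ω : ℂ, ‖ω‖ = 1 → HasSum (fun n : ℕ+ => (a n : ℂ) * (conj ω) ^ (n : ℕ)) (h 0 ω))
    (hc : ∀ ω : ℂ, ‖ω‖ = 1 → HasSum (fun n : ℕ+ => (c n : ℂ) * (conj ω) ^ (n : ℕ)) (h 1 ω))
    (ω : ℂ) (j : Fin 2)
    (hD : HasSum (fun m : ℤ => (((gam hb Ω (k - 1) ε⁻¹ j (coefX₂ hε (by omega : 1 ≤ k) h) m *
        (ω ^ (1 - m) - conj ω ^ (1 - m))).im / 2 : ℝ) : ℂ)) D) :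
    HasSum (fun n : ℕ+ => I / 2 * (((n : ℕ) + 1 : ℂ) * ((M b Ω ((n : ℕ) + 1) *ᵥ ![a n, c n]) j : ℂ)
      * (ω ^ ((n : ℕ) + 1) - (conj ω) ^ ((n : ℕ) + 1)))) D := by
  have hk1 : 1 ≤ k := by omega
  have hinj : Function.Injective fun n : ℕ+ => -((n : ℕ) : ℤ) := fun m n h => by
    simpa using h
  refine ((hinj.hasSum_iff fun m hm => ?_).2 hD).congr_fun fun n => ?_
  · have hm0 : 0 ≤ m := by
      by_contra hlt
      exact hm ⟨⟨m.natAbs, by omega⟩, by simp only [PNat.mk_coe]; omega⟩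
    rw [gam_eq_zero hb Ω j _ m fun l => by rw [coefX₂_div, cf_eq_zero hε _ hm0]]
    simp
  · have e : ∀ z : ℂ, z ^ (1 - -((n : ℕ) : ℤ)) = z ^ ((n : ℕ) + 1) := fun z => by
      rw [← zpow_natCast]; congr 1; push_cast; ring
    simp only [Function.comp_apply]
    rw [gam_eq hb Ω j _ (isCoef_coefX₂ hε hk1 h).real n (a n) (c n)
      (by rw [coefX₂_div, cf_eq_of_hasSum ha]) (by rw [coefX₂_div, cf_eq_of_hasSum hc]), e, e,
      ← map_pow]
    generalize (M b Ω ((n : ℕ) + 1) *ᵥ ![a n, c n]) j = v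
    generalize ω ^ ((n : ℕ) + 1) = z
    have hi : I * I = -1 := Complex.I_mul_I
    rw [Complex.sub_conj, Complex.im_ofReal_mul, Complex.mul_I_im, Complex.ofReal_re]
    push_cast
    linear_combination ((n : ℕ) + 1) * v * z.im * hi

end Spaces

end VStates

end

theorem mainTheorem5 (b : ℝ) (hb : b ∈ Ioo (0 : ℝ) 1) (ε : ℝ) (hε : ε ∈ Ioo (0 : ℝ) 1)
    (k : ℕ) (hk : 3 ≤ k) (Ω : ℝ) :
    -- the integrals defining `Λ_n(b)` converge
    (∀ n : ℕ, 1 ≤ n → Tendsto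
      (fun R : ℝ => (1 / b) * ∫ t in (0 : ℝ)..R, VStates.besselJ n (b * t) * VStates.besselJ n t)
      atTop (𝓝 (VStates.Lam n b))) ∧
    -- `G(Ω, ·)` is well defined near the annulus and Fréchet differentiable there
    (∀ᶠ f : Fin 2 → VStates.X ε k in 𝓝 0,
      ∀ j : Fin 2, ∃ g : VStates.Y ε (k - 1), VStates.Represents b Ω f j g) ∧
    DifferentiableAt ℝ (VStates.G ε k b Ω) 0 ∧
    -- the derivative is a Fourier multiplier
    ∀ (h : Fin 2 → VStates.X ε k) (a c : ℕ+ → ℝ),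
      (∀ ω : ℂ, ‖ω‖ = 1 → HasSum (fun n : ℕ+ => (a n : ℂ) * (conj ω) ^ (n : ℕ)) (h 0 ω)) →
      (∀ ω : ℂ, ‖ω‖ = 1 → HasSum (fun n : ℕ+ => (c n : ℂ) * (conj ω) ^ (n : ℕ)) (h 1 ω)) →
      ∀ ω : ℂ, ‖ω‖ = 1 → ∀ j : Fin 2,
        HasSum (fun n : ℕ+ => I / 2 * (((n : ℕ) + 1 : ℂ)
            * ((VStates.M b Ω ((n : ℕ) + 1) *ᵥ ![a n, c n]) j : ℂ)
            * (ω ^ ((n : ℕ) + 1) - (conj ω) ^ ((n : ℕ) + 1))))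
          (VStates.DG ε k b Ω h j ω) := by
  obtain ⟨D, hD, hD'⟩ := VStates.exists_hasFDerivAt_G hb hε hk Ω
  refine ⟨fun n _ => VStates.tendsto_Lam hb n, ?_, hD.differentiableAt,
    fun h a c ha hc ω hω j => ?_⟩
  · filter_upwards [VStates.eventually_represents hb hε hk Ω] with f hf j
    exact ⟨_, hf j⟩
  · rw [VStates.DG, hD.fderiv]
    exact VStates.hasSum_multiplier hb hε hk Ω h ha hc ω j (hD' h j ω hω)
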